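/- Let $a,b>0$ and consider the planar polynomial system $$\dot x = xy-a(x^3+xy^2),\qquad \dot y = y^2-(by-b+1)(x^2+y^2),$$ of degree $d=3$. Write $P,Q$ for its right-hand sides, and let $X$ be its Poincaré compactification: the vector field on the unit sphere $S^2\subset\mathbb R^3$ which is the continuous extension to $S^2$ of $z_3^{\,d-1}$ times the push-forward of $(P,Q)$ under the two central projections $(x,y)\mapsto \pm(x,y,1)/\sqrt{1+x^2+y^2}$ onto the open hemispheres $\pm z_3>0$. Explicitly, with $P^*(z)=z_3^3P(z_1/z_3,z_2/z_3)$ and $Q^*(z)=z_3^3Q(z_1/z_3,z_2/z_3)$ (extended as polynomials to $z_3=0$), $X(z)=(P^*,Q^*,0)-(z_1P^*+z_2Q^*)\,z$. The points at infinity are the points of the equator $S^2\cap\{z_3=0\}$; those in positive and negative $x$-direction are $(\pm1,0,0)$, those in positive and negative $y$-direction are $(0,\pm1,0)$. An orbit of $X$ other than $\{p\}$ is called outgoing from (incoming to) $p$ if it converges to $p$ for $t\to-\infty$ (for $t\to+\infty$). A stationary point $p$ of $X$ is called a saddle point if the linearisation of $X$ on the tangent plane at $p$ has one negative and one positive real eigenvalue,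 exactly two orbits are incoming to $p$, exactly two orbits are outgoing from $p$, and $p$ has a neighbourhood $N$ such that every trajectory starting in $N\setminus\{p\}$ leaves $N$ in forward time unless its orbit is incoming to $p$, and leaves $N$ in backward time unless its orbit is outgoing from $p$. It is called a repelling node if both eigenvalues of the linearisation are real and positive, and every trajectory starting in a sufficiently small punctured neighbourhood of $p$ converges to $p$ for $t\to-\infty$ along a well-defined tangent direction. 1. If $a=b$, then every point at infinity is stationary, and it has exactly one outgoing orbit in the closed northern hemisphere $z_3\ge 0$ (the Poincaré disc) and exactly one in the closed southern hemisphere $z_3\le 0$ (its antipodal copy). 2. If $a\neq b$, then the stationary points at infinity are exactly the four points at infinity in positive and negative $x$- and $y$-direction. - If $b>a$, then the points at infinity in positive and negative $x$-direction are saddle points and those in positive and negative $y$-direction are repelling nodes. - If $a>b$, then the points at infinity in positive and negative $x$-direction are repelling nodes and those in positive and negative $y$-direction are saddle points. -/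

import Mathlib

open Filter Topology

/-- The Euclidean plane. -/
abbrev E2 : Type := EuclideanSpace ℝ (Fin 2)

/-- The ambient space of the unit sphere. -/
abbrev E3 : Type := EuclideanSpace ℝ (Fin 3)

/-- First component `x y - a (x ^ 3 + x y ^ 2)` of the planar polynomial system
(with `x = X 0`, `y = X 1`). -/
noncomputable def cdkP (a : ℝ) : MvPolynomial (Fin 2) ℝ :=
  MvPolynomial.X 0 * MvPolynomial.X 1 -
    MvPolynomial.C a * (MvPolynomial.X 0 ^ 3 + MvPolynomial.X 0 * MvPolynomial.X 1 ^ 2)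

/-- Second component `y ^ 2 - (b y - b + 1) (x ^ 2 + y ^ 2)` of the planar polynomial system. -/
noncomputable def cdkQ (b : ℝ) : MvPolynomial (Fin 2) ℝ :=
  MvPolynomial.X 1 ^ 2 -
    (MvPolynomial.C b * MvPolynomial.X 1 - MvPolynomial.C b + 1) *
      (MvPolynomial.X 0 ^ 2 + MvPolynomial.X 1 ^ 2)

/-- The homogenisation in degree `d`, as a function on `ℝ³`: if `P = P₀ + ⋯ + P_d` with `Pᵢ`
homogeneous of degree `i`, this is `∑ z₃ ^ (d - i) Pᵢ(z₁, z₂)`. -/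
noncomputable def homogenization (d : ℕ) (P : MvPolynomial (Fin 2) ℝ) (z : E3) : ℝ :=
  ∑ i ∈ Finset.range (d + 1),
    z 2 ^ (d - i) * MvPolynomial.eval ![z 0, z 1] (MvPolynomial.homogeneousComponent i P)

/-- The degree of the planar polynomial vector field `(P, Q)`. -/
noncomputable def fieldDegree (P Q : MvPolynomial (Fin 2) ℝ) : ℕ :=
  max P.totalDegree Q.totalDegree

/-- The Poincaré compactification of the planar polynomial vector field `(P, Q)`, as a vector
field along the unit sphere `S²` (given by a formula on `ℝ³`).  If `d` is the degree of `(P, Q)`,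
it is the continuous extension to `S²` of `z₃ ^ (d - 1)` times the push-forward of `(P, Q)` under
the two central projections of the plane `{z₃ = 1}` onto the open hemispheres, see
`poincareField_centralProj`. -/
noncomputable def poincareField (P Q : MvPolynomial (Fin 2) ℝ) (z : E3) : E3 :=
  !₂[homogenization (fieldDegree P Q) P z, homogenization (fieldDegree P Q) Q z, 0] -
    (z 0 * homogenization (fieldDegree P Q) P z + z 1 * homogenization (fieldDegree P Q) Q z) • z

/-- Central projection of the plane `{z₃ = 1}` to the northern (`σ = 1`) or southern (`σ = -1`)
open hemisphere of `S²`. -/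
noncomputable def centralProj (σ : ℝ) (q : E2) : E3 :=
  (σ / √(1 + q 0 ^ 2 + q 1 ^ 2)) • !₂[q 0, q 1, 1]

lemma homogenization_centralProj {d : ℕ} {P : MvPolynomial (Fin 2) ℝ} (hd : P.totalDegree ≤ d)
    (σ : ℝ) (q : E2) :
    homogenization d P (centralProj σ q) =
      (centralProj σ q 2) ^ d * MvPolynomial.eval ![q 0, q 1] P := by
  have hs : ∑ i ∈ Finset.range (d + 1), MvPolynomial.homogeneousComponent i P = P := by
    conv_rhs => rw [← MvPolynomial.sum_homogeneousComponent P]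
    symm
    apply Finset.sum_subset
    · intro i hi
      simp only [Finset.mem_range] at hi ⊢
      omega
    · intro i _ hi
      apply MvPolynomial.homogeneousComponent_eq_zero
      simp only [Finset.mem_range] at hi
      omega
  have key : ∀ (c : ℝ) (i : ℕ), MvPolynomial.eval ![c * q 0, c * q 1]
      (MvPolynomial.homogeneousComponent i P) =
      c ^ i * MvPolynomial.eval ![q 0, q 1] (MvPolynomial.homogeneousComponent i P) := by
    intro c i
    have h : ![c * q 0, c * q 1] = c • ![q 0, q 1] := by
      ext j; fin_cases j <;> simp
    rw [h]
    rw [MvPolynomial.eval_eq', MvPolynomial.eval_eq', Finset.mul_sum]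
    apply Finset.sum_congr rfl
    intro e he
    have hdeg := MvPolynomial.homogeneousComponent_isHomogeneous i P
      (MvPolynomial.mem_support_iff.mp he)
    have hdeg' : i = e 0 + e 1 := by
      rw [← hdeg, Finsupp.weight_apply, Finsupp.sum_fintype _ _ (by simp)]
      simp
    simp only [Fin.prod_univ_two, Pi.smul_apply, smul_eq_mul, hdeg', mul_pow, pow_add]
    ring
  conv_rhs => rw [← hs]
  rw [map_sum, Finset.mul_sum, homogenization]
  apply Finset.sum_congr rfl
  intro i hi
  have hi' : i ≤ d := by simp only [Finset.mem_range] at hi; omega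
  have e0 : centralProj σ q 0 = centralProj σ q 2 * q 0 := by simp [centralProj]
  have e1 : centralProj σ q 1 = centralProj σ q 2 * q 1 := by simp [centralProj]
  rw [e0, e1, key, ← mul_assoc, ← pow_add, Nat.sub_add_cancel hi']

/-- On the open hemispheres the compactified field is `z₃ ^ (d - 1)` times the push-forward of the
planar field. -/
lemma poincareField_centralProj (P Q : MvPolynomial (Fin 2) ℝ) {σ : ℝ} (hσ : σ = 1 ∨ σ = -1)
    (q : E2) :
    poincareField P Q (centralProj σ q) =
      (centralProj σ q 2) ^ ((fieldDegree P Q : ℤ) - 1) •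
        fderiv ℝ (centralProj σ) q
          !₂[MvPolynomial.eval ![q 0, q 1] P, MvPolynomial.eval ![q 0, q 1] Q] := by
  set p := MvPolynomial.eval ![q 0, q 1] P with hp
  set r := MvPolynomial.eval ![q 0, q 1] Q with hr
  set D : ℝ := 1 + q 0 ^ 2 + q 1 ^ 2 with hD
  have hD0 : 0 < D := by positivity
  have hS : 0 < √D := Real.sqrt_pos.mpr hD0
  have hSq : √D ^ 2 = D := Real.sq_sqrt hD0.le
  have hσ2 : σ ^ 2 = 1 := by rcases hσ with h | h <;> simp [h]
  have hσ0 : σ ≠ 0 := by rcases hσ with h | h <;> simp [h]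
  have hz : centralProj σ q 2 = σ / √D := by simp [centralProj, hD]
  have hz0 : centralProj σ q 2 ≠ 0 := by rw [hz]; positivity
  have hdiff : DifferentiableAt ℝ (centralProj σ) q := by
    have h1 : DifferentiableAt ℝ (fun x : E2 => σ / √(1 + x 0 ^ 2 + x 1 ^ 2)) q := by
      have h3 : DifferentiableAt ℝ (fun x : E2 => √(1 + x 0 ^ 2 + x 1 ^ 2)) q :=
        DifferentiableAt.sqrt (by fun_prop) hD0.ne'
      have h4 : √(1 + q 0 ^ 2 + q 1 ^ 2) ≠ 0 := hS.ne'
      simpa only [div_eq_mul_inv] using (h3.fun_inv h4).const_mul σ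
    have h2 : DifferentiableAt ℝ (fun x : E2 => (!₂[x 0, x 1, 1] : E3)) q := by
      rw [differentiableAt_piLp]
      intro i
      fin_cases i <;> simp <;> fun_prop
    exact h1.smul h2
  -- the derivative along the line through `q` in direction `(p, r)`
  have hline : HasDerivAt (fun t : ℝ => q + t • (!₂[p, r] : E2)) !₂[p, r] 0 := by
    simpa using ((hasDerivAt_id (0 : ℝ)).smul_const (!₂[p, r] : E2)).const_add q
  have hcomp : HasDerivAt (fun t : ℝ => centralProj σ (q + t • (!₂[p, r] : E2)))
      (fderiv ℝ (centralProj σ) q !₂[p, r]) 0 := by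
    have h : HasFDerivAt (centralProj σ) (fderiv ℝ (centralProj σ) q)
        (q + (0 : ℝ) • (!₂[p, r] : E2)) := by simpa using hdiff.hasFDerivAt
    exact h.comp_hasDerivAt (0 : ℝ) hline
  have hf0 : HasDerivAt (fun t : ℝ => q 0 + t * p) p 0 := by
    simpa using ((hasDerivAt_id (0 : ℝ)).mul_const p).const_add (q 0)
  have hf1 : HasDerivAt (fun t : ℝ => q 1 + t * r) r 0 := by
    simpa using ((hasDerivAt_id (0 : ℝ)).mul_const r).const_add (q 1)
  have hs : HasDerivAt (fun t : ℝ => √(1 + (q 0 + t * p) ^ 2 + (q 1 + t * r) ^ 2))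
      ((q 0 * p + q 1 * r) / √D) 0 := by
    have h := (((hf0.pow 2).const_add 1).add (hf1.pow 2)).sqrt (by simpa [hD] using hD0.ne')
    refine (h.congr_deriv ?_)
    simp [hD]
    field_simp
  have hc : HasDerivAt (fun t : ℝ => σ / √(1 + (q 0 + t * p) ^ 2 + (q 1 + t * r) ^ 2))
      (-σ * (q 0 * p + q 1 * r) / √D ^ 3) 0 := by
    have h := (hasDerivAt_const (0 : ℝ) σ).div hs (by simpa [hD] using hS.ne')
    refine (h.congr_deriv ?_)
    simp [← hD]
    field_simp
  have hfd : fderiv ℝ (centralProj σ) q !₂[p, r] =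
      centralProj σ q 2 • (!₂[p, r, 0] : E3) -
        (centralProj σ q 2 * (centralProj σ q 0 * p + centralProj σ q 1 * r)) •
          centralProj σ q := by
    have e0 : centralProj σ q 0 = σ / √D * q 0 := by simp [centralProj, hD]
    have e1 : centralProj σ q 1 = σ / √D * q 1 := by simp [centralProj, hD]
    ext i
    have hi : HasDerivAt (fun t : ℝ => centralProj σ (q + t • (!₂[p, r] : E2)) i)
        (fderiv ℝ (centralProj σ) q !₂[p, r] i) 0 :=
      (EuclideanSpace.proj i : E3 →L[ℝ] ℝ).hasFDerivAt.comp_hasDerivAt (0 : ℝ) hcomp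
    fin_cases i
    · have h := hc.mul hf0
      have hu := hi.unique (h.congr_of_eventuallyEq (Eventually.of_forall fun t => by
        simp [centralProj]))
      simp only [Fin.zero_eta] at hu ⊢
      rw [hu]
      simp [e0, e1, hz, ← hD]
      field_simp
      grind
    · have h := hc.mul hf1
      have hu := hi.unique (h.congr_of_eventuallyEq (Eventually.of_forall fun t => by
        simp [centralProj]))
      simp only [Fin.mk_one] at hu ⊢
      rw [hu]
      simp [e0, e1, hz, ← hD]
      field_simp
      grind
    · have hu := hi.unique (hc.congr_of_eventuallyEq (Eventually.of_forall fun t => by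
        simp [centralProj]))
      simp only [Fin.reduceFinMk] at hu ⊢
      rw [hu]
      simp [e0, e1, hz]
      field_simp
      grind
  rw [hfd, poincareField, 
    homogenization_centralProj (d := fieldDegree P Q) (P := P) (le_max_left _ _),
    homogenization_centralProj (d := fieldDegree P Q) (P := Q) (le_max_right _ _), zpow_sub_one₀ hz0, zpow_natCast]
  change _ = (centralProj σ q 2 ^ fieldDegree P Q * (centralProj σ q 2)⁻¹) • _
  ext i
  fin_cases i <;> simp [← hp, ← hr, fieldDegree] <;> field_simp

/-- A (complete) trajectory on `S²` of the vector field `V`. -/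
def IsTrajectory (V : E3 → E3) (γ : ℝ → E3) : Prop :=
  (∀ t, γ t ∈ Metric.sphere (0 : E3) 1) ∧ ∀ t, HasDerivAt γ (V (γ t)) t

/-- `O` is an orbit on `S²`, other than `{p}`, that emanates from `p`
(it converges to `p` for `t → -∞`). -/
def IsOutgoingOrbit (V : E3 → E3) (p : E3) (O : Set E3) : Prop :=
  O ≠ {p} ∧ ∃ γ, IsTrajectory V γ ∧ O = Set.range γ ∧ Tendsto γ atBot (𝓝 p)

/-- `O` is an orbit on `S²`, other than `{p}`, that converges to `p` for `t → ∞`. -/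
def IsIncomingOrbit (V : E3 → E3) (p : E3) (O : Set E3) : Prop :=
  O ≠ {p} ∧ ∃ γ, IsTrajectory V γ ∧ O = Set.range γ ∧ Tendsto γ atTop (𝓝 p)

/-- The linear part of `V` at the point `p` of `S²`, restricted to the tangent plane `p^⊥`, has
the real eigenvalues `l` and `m` (counted with multiplicity): it is triangular with diagonal
`(l, m)` in a basis `e₁, e₂` of the tangent plane. -/
def HasTangentEigenvalues (V : E3 → E3) (p : E3) (l m : ℝ) : Prop :=
  ∃ L : E3 →L[ℝ] E3, HasFDerivAt V L p ∧
    ∃ e₁ e₂ : E3, LinearIndependent ℝ ![e₁, e₂] ∧ inner ℝ p e₁ = 0 ∧ inner ℝ p e₂ = 0 ∧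
      L e₁ = l • e₁ ∧ ∃ c : ℝ, L e₂ = c • e₁ + m • e₂

/-- `p` is a (hyperbolic) saddle point of `V` on `S²`: the eigenvalues at the stationary point `p`
are real of opposite sign, exactly two orbits converge to `p` for `t → ∞`, exactly two orbits
converge to `p` for `t → -∞`, and every other trajectory that starts close to `p` (and not in `p`)
leaves a fixed neighbourhood of `p` both in forward and in backward time. -/
def IsSaddlePoint (V : E3 → E3) (p : E3) : Prop :=
  V p = 0 ∧ (∃ l m : ℝ, l < 0 ∧ 0 < m ∧ HasTangentEigenvalues V p l m) ∧
    {O | IsIncomingOrbit V p O}.ncard = 2 ∧ {O | IsOutgoingOrbit V p O}.ncard = 2 ∧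
    ∃ δ > 0, ∀ γ, IsTrajectory V γ → γ 0 ∈ Metric.ball p δ → γ 0 ≠ p →
      ((∃ t > 0, γ t ∉ Metric.ball p δ) ∨ IsIncomingOrbit V p (Set.range γ)) ∧
      ((∃ t < 0, γ t ∉ Metric.ball p δ) ∨ IsOutgoingOrbit V p (Set.range γ))

/-- `p` is a (hyperbolic) repelling node of `V` on `S²`: the eigenvalues at the stationary point
`p` are real and positive, and every trajectory that starts close to `p` (and not in `p`)
converges to `p` for `t → -∞`, along a well-defined tangent direction. -/
def IsRepellingNode (V : E3 → E3) (p : E3) : Prop :=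
  V p = 0 ∧ (∃ l m : ℝ, 0 < l ∧ 0 < m ∧ HasTangentEigenvalues V p l m) ∧
    ∃ δ > 0, ∀ γ, IsTrajectory V γ → γ 0 ∈ Metric.ball p δ → γ 0 ≠ p →
      Tendsto γ atBot (𝓝 p) ∧
        ∃ w : E3, Tendsto (fun t => ‖γ t - p‖⁻¹ • (γ t - p)) atBot (𝓝 w) ∧ w ≠ 0

/-- The points at infinity: the equator of `S²`. -/
def infinityCircle : Set E3 := {z | z ∈ Metric.sphere (0 : E3) 1 ∧ z 2 = 0}

/-! Write (u, v, w) for the coordinates `z 0`, `z 1`, `z 2`. Written out, the compactified field is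
(F u, H v + K w, G w) (`cdkField`). So u and w solve homogeneous linear scalar equations along every
trajectory: the meridian u = 0 and the equator w = 0 are invariant, and the signs of u and w are
constant. The field is odd, so only the points (1,0,0) and (0,1,0) need work. Their linear parts are
triangular with diagonals (a - b, a) and (b - a, b).

The nonlinear statements come directly from scalar differential inequalities, without a
linearisation or invariant manifold theorem. A quantity whose growth rate is at least c > 0 tends to
0 in backward time; if it stays bounded in forward time, it is 0.

Nodes: a quadratic Lyapunov function gives convergence (`backward_trap`), and the limit of a ratio
of coordinates gives the tangent direction. At (0,1,0) the ratio w/u tends to 0 off the meridian. At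
(1,0,0) the ratio y = v/w either converges to (b - 1)/b or blows up (`backward_dichotomy`).

Saddles: incoming orbits lie on the equator, where u/v and v/u satisfy linear equations with
constant coefficients. Outgoing orbits at (0,1,0) lie on the meridian. At (1,0,0) no explicit
invariant curve carries the outgoing orbits. Existence is a shooting argument in the strip (b - 1)/b
≤ y ≤ 1 (`exists_trapped_trajectory`). For uniqueness, such orbits are written as graphs of y over
log |w/u|. The distance between two graphs does not increase along this variable near -∞ and tends
to 0 there, so they coincide (`exists_common_point_x`).

For a = b the field on the sphere is w times a field R (`reducedField`) which crosses the equator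
transversally. Through each equatorial point p passes one orbit of R; its part just above the
equator, with time changed by the factor w, is the unique outgoing orbit in the upper hemisphere. -/

/-! ### Scalar linear equations and differential inequalities -/

lemma HasDerivAt.comp_neg_id {f : ℝ → ℝ} {d t : ℝ} (h : HasDerivAt f d (-t)) :
    HasDerivAt (fun t => f (-t)) (-d) t := by
  simpa [Function.comp_def] using h.scomp t (hasDerivAt_neg t)

/-- Multiplying a solution of `f' = g f + e` by an integrating factor. -/
lemma exists_integratingFactor {f g e : ℝ → ℝ} (hg : Continuous g)
    (hf : ∀ t, HasDerivAt f (g t * f t + e t) t) :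
    ∃ E : ℝ → ℝ, (∀ t, 0 < E t) ∧ ∀ t, HasDerivAt (fun t => f t * E t) (e t * E t) t := by
  refine ⟨fun t => Real.exp (-∫ s in (0 : ℝ)..t, g s), fun t => Real.exp_pos _, fun t => ?_⟩
  have h1 : HasDerivAt (fun t => ∫ s in (0 : ℝ)..t, g s) (g t) t :=
    intervalIntegral.integral_hasDerivAt_right (hg.intervalIntegrable _ _)
      (hg.stronglyMeasurableAtFilter _ _) hg.continuousAt
  refine ((hf t).mul h1.neg.exp).congr_deriv ?_
  simp only [Pi.neg_apply]
  ring

/-- A solution of the linear equation `f' = g f` is a positive multiple of its initial value. -/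
lemma exists_pos_mul_of_linear {f g : ℝ → ℝ} (hg : Continuous g)
    (hf : ∀ t, HasDerivAt f (g t * f t) t) (t₀ t : ℝ) : ∃ k > 0, f t = k * f t₀ := by
  obtain ⟨E, hE, hd⟩ := exists_integratingFactor (e := 0) hg (by simpa using hf)
  have h := is_const_of_deriv_eq_zero (fun t => (hd t).differentiableAt)
    (fun t => by simpa using (hd t).deriv) t t₀
  refine ⟨E t₀ / E t, div_pos (hE _) (hE _), ?_⟩
  have := (hE t).ne'
  field_simp
  linarith

lemma eq_zero_of_linear {f g : ℝ → ℝ} (hg : Continuous g)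
    (hf : ∀ t, HasDerivAt f (g t * f t) t) {t₀ : ℝ} (h : f t₀ = 0) (t : ℝ) : f t = 0 := by
  obtain ⟨k, -, hk⟩ := exists_pos_mul_of_linear hg hf t₀ t
  simp [hk, h]

lemma ne_zero_of_linear {f g : ℝ → ℝ} (hg : Continuous g)
    (hf : ∀ t, HasDerivAt f (g t * f t) t) {t₀ : ℝ} (h : f t₀ ≠ 0) (t : ℝ) : f t ≠ 0 :=
  fun h' => h (eq_zero_of_linear hg hf h' t₀)

lemma pos_of_linear {f g : ℝ → ℝ} (hg : Continuous g)
    (hf : ∀ t, HasDerivAt f (g t * f t) t) {t₀ : ℝ} (h : 0 < f t₀) (t : ℝ) : 0 < f t := by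
  obtain ⟨k, hk0, hk⟩ := exists_pos_mul_of_linear hg hf t₀ t
  rw [hk]; positivity

lemma sign_of_linear {f g : ℝ → ℝ} (hg : Continuous g)
    (hf : ∀ t, HasDerivAt f (g t * f t) t) {t₀ : ℝ} (h : f t₀ ≠ 0) :
    (∀ t, 0 < f t) ∨ ∀ t, f t < 0 := by
  rcases lt_or_gt_of_ne h with h | h
  · have := pos_of_linear (f := fun t => -f t) hg
      (fun t => (hf t).neg.congr_deriv (by ring)) (neg_pos.2 h)
    exact Or.inr fun t => neg_pos.1 (this t)
  · exact Or.inl (pos_of_linear hg hf h)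

/-- Negativity propagates backwards along `f' = g f + e` with `e ≥ 0`. -/
lemma neg_backward {f g e : ℝ → ℝ} (hg : Continuous g)
    (hf : ∀ t, HasDerivAt f (g t * f t + e t) t) (he : ∀ t, 0 ≤ e t) {t₀ : ℝ} (h : f t₀ < 0)
    {t : ℝ} (ht : t ≤ t₀) : f t < 0 := by
  obtain ⟨E, hE, hd⟩ := exists_integratingFactor hg hf
  have hm : Monotone fun t => f t * E t := monotone_of_deriv_nonneg
    (fun t => (hd t).differentiableAt) fun t => by
      rw [(hd t).deriv]; exact mul_nonneg (he t) (hE t).le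
  have h1 : f t * E t < 0 := (hm ht).trans_lt (mul_neg_of_neg_of_pos h (hE _))
  exact neg_of_mul_neg_left h1 (hE t).le

/-- If `f f' ≥ c f²` on `[s, t]`, then `|f|` grows there at least like `exp (c t)`. -/
lemma abs_mul_exp_le {f f' : ℝ → ℝ} {c s t : ℝ} (hst : s ≤ t)
    (hf : ∀ τ ∈ Set.Icc s t, HasDerivAt f (f' τ) τ)
    (h : ∀ τ ∈ Set.Icc s t, c * f τ ^ 2 ≤ f τ * f' τ) :
    |f s| * Real.exp (c * (t - s)) ≤ |f t| := by
  have hd : ∀ τ ∈ Set.Icc s t, HasDerivAt (fun τ => f τ ^ 2 * Real.exp (-(2 * c) * τ))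
      (2 * (f τ * f' τ - c * f τ ^ 2) * Real.exp (-(2 * c) * τ)) τ := fun τ hτ => by
    refine (((hf τ hτ).pow 2).mul
      (((hasDerivAt_id τ).const_mul (-(2 * c))).exp)).congr_deriv ?_
    simp
    ring
  have hm : MonotoneOn (fun τ => f τ ^ 2 * Real.exp (-(2 * c) * τ)) (Set.Icc s t) := by
    refine monotoneOn_of_deriv_nonneg (convex_Icc s t)
      (fun τ hτ => (hd τ hτ).continuousAt.continuousWithinAt)
      (fun τ hτ => (hd τ (interior_subset hτ)).differentiableAt.differentiableWithinAt)
      fun τ hτ => ?_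
    rw [(hd τ (interior_subset hτ)).deriv]
    have := h τ (interior_subset hτ)
    have := Real.exp_pos (-(2 * c) * τ)
    apply mul_nonneg _ this.le
    linarith
  have h1 := hm (Set.left_mem_Icc.2 hst) (Set.right_mem_Icc.2 hst) hst
  simp only at h1
  have h2 : (f s * Real.exp (c * (t - s))) ^ 2 ≤ f t ^ 2 := by
    have e1 : (f s * Real.exp (c * (t - s))) ^ 2 =
        f s ^ 2 * Real.exp (-(2 * c) * s) * Real.exp (2 * c * t) := by
      rw [mul_pow, ← Real.exp_nat_mul, mul_assoc, ← Real.exp_add]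
      congr 2
      push_cast; ring
    have e2 : f t ^ 2 = f t ^ 2 * Real.exp (-(2 * c) * t) * Real.exp (2 * c * t) := by
      rw [mul_assoc, ← Real.exp_add]; simp
    rw [e1, e2]
    gcongr
  have h3 := sq_le_sq.1 h2
  rwa [abs_mul, abs_of_pos (Real.exp_pos _)] at h3

/-- If `f f' ≤ c f²` on `[s, t]`, then `|f|` grows there at most like `exp (c t)`. -/
lemma abs_le_mul_exp {f f' : ℝ → ℝ} {c s t : ℝ} (hst : s ≤ t)
    (hf : ∀ τ ∈ Set.Icc s t, HasDerivAt f (f' τ) τ)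
    (h : ∀ τ ∈ Set.Icc s t, f τ * f' τ ≤ c * f τ ^ 2) :
    |f t| ≤ |f s| * Real.exp (c * (t - s)) := by
  have hmem : ∀ τ ∈ Set.Icc (-t) (-s), -τ ∈ Set.Icc s t := fun τ hτ =>
    ⟨by linarith [hτ.2], by linarith [hτ.1]⟩
  have h1 := abs_mul_exp_le (f := fun τ => f (-τ)) (f' := fun τ => -f' (-τ)) (c := -c)
    (neg_le_neg hst) (fun τ hτ => (hf (-τ) (hmem τ hτ)).comp_neg_id)
    (fun τ hτ => by have := h (-τ) (hmem τ hτ); linarith)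
  simp only [neg_neg] at h1
  calc |f t| = |f t| * Real.exp (-c * (-s - -t)) * Real.exp (c * (t - s)) := by
        rw [mul_assoc, ← Real.exp_add]; ring_nf; simp
    _ ≤ _ := by gcongr

lemma tendsto_exp_mul_atBot {c : ℝ} (hc : 0 < c) (T : ℝ) :
    Tendsto (fun t : ℝ => Real.exp (c * (t - T))) atBot (𝓝 0) :=
  Real.tendsto_exp_atBot.comp
    ((tendsto_id.atBot_add tendsto_const_nhds (C := -T)).const_mul_atBot hc)

lemma tendsto_exp_mul_atTop {c : ℝ} (hc : 0 < c) (T : ℝ) :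
    Tendsto (fun t : ℝ => Real.exp (c * (t - T))) atTop atTop :=
  Real.tendsto_exp_atTop.comp
    ((tendsto_id.atTop_add tendsto_const_nhds (C := -T)).const_mul_atTop hc)

lemma tendsto_atBot_zero_of_le {f f' : ℝ → ℝ} {c T : ℝ} (hc : 0 < c)
    (hf : ∀ t ≤ T, HasDerivAt f (f' t) t) (h : ∀ t ≤ T, c * f t ^ 2 ≤ f t * f' t) :
    Tendsto f atBot (𝓝 0) := by
  rw [tendsto_zero_iff_abs_tendsto_zero]
  have h2 : Tendsto (fun t => |f T| * Real.exp (c * (t - T))) atBot (𝓝 0) := by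
    simpa using (tendsto_exp_mul_atBot hc T).const_mul (|f T|)
  refine squeeze_zero' (Eventually.of_forall fun _ => abs_nonneg _) ?_ h2
  filter_upwards [eventually_le_atBot T] with t ht
  have h1 := abs_mul_exp_le ht (fun τ hτ => hf τ hτ.2) (fun τ hτ => h τ hτ.2)
  calc |f t| = |f t| * Real.exp (c * (T - t)) * Real.exp (c * (t - T)) := by
        rw [mul_assoc, ← Real.exp_add]; ring_nf; simp
    _ ≤ _ := by gcongr

lemma tendsto_atTop_zero_of_le {f f' : ℝ → ℝ} {c T : ℝ} (hc : 0 < c)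
    (hf : ∀ t ≥ T, HasDerivAt f (f' t) t) (h : ∀ t ≥ T, f t * f' t ≤ -c * f t ^ 2) :
    Tendsto f atTop (𝓝 0) := by
  have := tendsto_atBot_zero_of_le (f := fun t => f (-t)) (f' := fun t => -f' (-t)) (T := -T) hc
    (fun τ hτ => (hf (-τ) (by linarith)).comp_neg_id)
    (fun τ hτ => by have := h (-τ) (by linarith); linarith)
  simpa [Function.comp_def] using this.comp tendsto_neg_atTop_atBot

/-- Exponential growth contradicts boundedness. -/
lemma eq_zero_of_growth_atTop {f f' : ℝ → ℝ} {c T C : ℝ} (hc : 0 < c)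
    (hf : ∀ t ≥ T, HasDerivAt f (f' t) t) (h : ∀ t ≥ T, c * f t ^ 2 ≤ f t * f' t)
    (hC : ∀ t ≥ T, |f t| ≤ C) : f T = 0 := by
  by_contra h0
  have h1 : Tendsto (fun t => |f T| * Real.exp (c * (t - T))) atTop atTop :=
    (tendsto_exp_mul_atTop hc T).const_mul_atTop (abs_pos.2 h0)
  obtain ⟨t, ht, ht'⟩ := ((h1.eventually_gt_atTop C).and (eventually_ge_atTop T)).exists
  have := abs_mul_exp_le ht' (fun τ hτ => hf τ hτ.1) (fun τ hτ => h τ hτ.1)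
  linarith [hC t ht']

lemma eq_zero_of_growth_atBot {f f' : ℝ → ℝ} {c T C : ℝ} (hc : 0 < c)
    (hf : ∀ t ≤ T, HasDerivAt f (f' t) t) (h : ∀ t ≤ T, f t * f' t ≤ -c * f t ^ 2)
    (hC : ∀ t ≤ T, |f t| ≤ C) : f T = 0 := by
  have := eq_zero_of_growth_atTop (f := fun t => f (-t)) (f' := fun t => -f' (-t)) (T := -T) hc
    (fun τ hτ => (hf (-τ) (by linarith)).comp_neg_id)
    (fun τ hτ => by have := h (-τ) (by linarith); linarith)
    (fun τ hτ => hC (-τ) (by linarith))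
  simpa using this

/-- A barrier argument in backward time. -/
lemma le_of_backward_barrier {f f' : ℝ → ℝ} {m t₀ : ℝ} (hf : ∀ t ≤ t₀, HasDerivAt f (f' t) t)
    (h0 : f t₀ ≤ m) (hb : ∀ t ≤ t₀, f t = m → 0 < f' t) {t : ℝ} (ht : t ≤ t₀) : f t ≤ m := by
  have hd : ∀ s ∈ Set.Icc (-t₀) (-t), HasDerivAt (fun s => f (-s)) (-f' (-s)) s := fun s hs => 
    (hf (-s) (by linarith [hs.1])).comp_neg_id
  have := image_le_of_deriv_right_lt_deriv_boundary (f := fun s => f (-s))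
    (f' := fun s => -f' (-s)) (a := -t₀) (b := -t) (B := fun _ => m) (B' := fun _ => 0)
    (fun s hs => (hd s hs).continuousAt.continuousWithinAt)
    (fun s hs => (hd s (Set.Ico_subset_Icc_self hs)).hasDerivWithinAt)
    (by simpa using h0) (fun _ => hasDerivAt_const _ _)
    (fun s hs he => by simpa using hb (-s) (by linarith [hs.1]) he)
    (x := -t) ⟨by linarith, le_rfl⟩
  simpa using this

/-- A nonnegative function which satisfies `f' ≥ c f` wherever it is smaller than `d` stays small
in backward time and tends to `0`. -/
lemma backward_trap {f f' : ℝ → ℝ} {c d t₀ : ℝ} (hc : 0 < c)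
    (hf : ∀ t ≤ t₀, HasDerivAt f (f' t) t) (hpos : ∀ t ≤ t₀, 0 ≤ f t)
    (h : ∀ t ≤ t₀, f t < d → c * f t ≤ f' t) (h0 : f t₀ < d) :
    (∀ t ≤ t₀, f t < d) ∧ Tendsto f atBot (𝓝 0) := by
  have hd : 0 < d := (hpos t₀ le_rfl).trans_lt h0
  have hf0 := hpos t₀ le_rfl
  have h1 : ∀ t ≤ t₀, f t < d := fun t ht => by
    have := le_of_backward_barrier (m := (f t₀ + d) / 2) hf (by linarith)
      (fun t ht he => (show 0 < c * f t by rw [he]; positivity).trans_le (h t ht (by linarith))) ht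
    linarith
  refine ⟨h1, tendsto_atBot_zero_of_le hc hf fun t ht => ?_⟩
  have := h t ht (h1 t ht)
  have := mul_le_mul_of_nonneg_left this (hpos t ht)
  linarith

/-- Solutions of `f' = -ρ f + e` with `ρ ≥ c > 0` and vanishing forcing term `e` either tend
to `0` or blow up in backward time. -/
lemma backward_dichotomy {f ρ e : ℝ → ℝ} {c : ℝ} (hc : 0 < c)
    (hf : ∀ᶠ t in atBot, HasDerivAt f (-ρ t * f t + e t) t) (hρ : ∀ᶠ t in atBot, c ≤ ρ t)
    (he : Tendsto e atBot (𝓝 0)) :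
    Tendsto f atBot (𝓝 0) ∨ Tendsto f atBot atTop ∨ Tendsto f atBot atBot := by
  -- If f reaches ε at a time before which |e| < cε/2, damping beats forcing: ε is a barrier in
  -- backward time, and above it f' ≤ -(c/2) f, so f grows backwards like exp(c/2 · (t₀ - t)).
  have key : ∀ (f e : ℝ → ℝ) (T ε t₀ : ℝ), 0 < ε → t₀ ≤ T →
      (∀ t ≤ T, HasDerivAt f (-ρ t * f t + e t) t ∧ c ≤ ρ t ∧ |e t| < c * ε / 2) → ε ≤ f t₀ →
      Tendsto f atBot atTop := by
    intro f e T ε t₀ hε ht₀ hT h0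
    have hge : ∀ t ≤ t₀, ε ≤ f t := fun t ht => by
      have := le_of_backward_barrier (f := fun t => -f t) (f' := fun t => -(-ρ t * f t + e t))
        (m := -ε) (t₀ := t₀) (fun t ht => (hT t (ht.trans ht₀)).1.neg) (by linarith)
        (fun t ht he => by
          obtain ⟨-, h2, h3⟩ := hT t (ht.trans ht₀)
          have hft : f t = ε := by linarith
          rw [hft]
          have := mul_le_mul_of_nonneg_right h2 hε.le
          have := (abs_lt.1 h3).2
          nlinarith) ht
      linarith
    have hgrow : ∀ t ≤ t₀, ε * Real.exp (c / 2 * (t₀ - t)) ≤ f t := fun t ht => by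
      have h1 := abs_le_mul_exp (c := -(c / 2)) ht (fun τ hτ => (hT τ (hτ.2.trans ht₀)).1)
        (fun τ hτ => by
          obtain ⟨-, h2, h3⟩ := hT τ (hτ.2.trans ht₀)
          have hp := hge τ hτ.2
          have hfp : 0 < f τ := hε.trans_le hp
          have h4 : -ρ τ * f τ + e τ ≤ -(c / 2) * f τ := by
            have := mul_le_mul_of_nonneg_right h2 hfp.le
            have := mul_le_mul_of_nonneg_left hp hc.le
            have := (abs_lt.1 h3).2
            nlinarith
          have := mul_le_mul_of_nonneg_left h4 hfp.le
          linarith)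
      rw [abs_of_pos (hε.trans_le h0), abs_of_pos (hε.trans_le (hge t ht))] at h1
      calc ε * Real.exp (c / 2 * (t₀ - t)) ≤ f t₀ * Real.exp (c / 2 * (t₀ - t)) := by gcongr
        _ ≤ f t * Real.exp (-(c / 2) * (t₀ - t)) * Real.exp (c / 2 * (t₀ - t)) := by gcongr
        _ = f t := by rw [mul_assoc, ← Real.exp_add]; ring_nf; simp
    have h5 : Tendsto (fun t => ε * Real.exp (c / 2 * (t₀ - t))) atBot atTop := by
      have := ((tendsto_exp_mul_atTop (half_pos hc) (-t₀)).comp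
        tendsto_neg_atBot_atTop).const_mul_atTop hε
      refine this.congr fun t => ?_
      simp only [Function.comp]
      ring_nf
    exact tendsto_atTop_mono' _ ((eventually_le_atBot t₀).mono hgrow) h5
  by_cases h0 : Tendsto f atBot (𝓝 0)
  · exact Or.inl h0
  right
  rw [Metric.tendsto_nhds] at h0
  push Not at h0
  obtain ⟨ε, hε, hfreq⟩ := h0
  have hsmall : ∀ᶠ t in atBot, |e t| < c * ε / 2 := by
    have := (Metric.tendsto_nhds.1 he) (c * ε / 2) (by positivity)
    simpa [Real.dist_eq] using this
  obtain ⟨T, hT⟩ := eventually_atBot.1 (hf.and (hρ.and hsmall))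
  obtain ⟨t₀, h1, ht₀⟩ := (hfreq.and_eventually (eventually_le_atBot T)).exists
  have h1 : ε ≤ |f t₀| := by simpa [Real.dist_eq] using h1
  rcases le_abs.1 h1 with h1 | h1
  · exact Or.inl (key f e T ε t₀ hε ht₀ hT h1)
  · right
    have := key (fun t => -f t) (fun t => -e t) T ε t₀ hε ht₀ (fun t ht => by
      obtain ⟨h2, h3, h4⟩ := hT t ht
      refine ⟨h2.neg.congr_deriv (by ring), h3, by simpa using h4⟩) h1
    exact tendsto_neg_atTop_iff.1 this

/-- Two continuous positive functions which tend to `0` have a common value. -/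
lemma exists_common_value {l₁ l₂ : Filter ℝ} [l₁.NeBot] [l₂.NeBot] {f g : ℝ → ℝ}
    (hf : Continuous f) (hg : Continuous g) (hf0 : ∀ t, 0 < f t) (hg0 : ∀ t, 0 < g t)
    (hfl : Tendsto f l₁ (𝓝 0)) (hgl : Tendsto g l₂ (𝓝 0)) : ∃ s t, f s = g t := by
  have attain : ∀ {l : Filter ℝ} [l.NeBot] {f : ℝ → ℝ}, Continuous f → Tendsto f l (𝓝 0) →
      ∀ c, 0 < c → c ≤ f 0 → ∃ t, f t = c := by
    intro l _ f hf hfl c hc hc'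
    obtain ⟨t, ht⟩ := (hfl.eventually_lt_const hc).exists
    exact mem_range_of_exists_le_of_exists_ge hf ⟨t, ht.le⟩ ⟨0, hc'⟩
  obtain ⟨s, hs⟩ := attain hf hfl (min (f 0) (g 0)) (lt_min (hf0 0) (hg0 0)) (min_le_left _ _)
  obtain ⟨t, ht⟩ := attain hg hgl (min (f 0) (g 0)) (lt_min (hf0 0) (hg0 0)) (min_le_right _ _)
  exact ⟨s, t, hs.trans ht.symm⟩

/-- The inverse of a function on `(-∞, T]` whose derivative is bounded below. -/
lemma exists_inverse_of_deriv_ge {f f' : ℝ → ℝ} {c T : ℝ} (hc : 0 < c)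
    (hf : ∀ t ≤ T, HasDerivAt f (f' t) t) (h : ∀ t ≤ T, c ≤ f' t) :
    ∃ g : ℝ → ℝ, (∀ x ≤ f T, g x ≤ T ∧ f (g x) = x) ∧
      (∀ x < f T, HasDerivAt g (f' (g x))⁻¹ x) ∧ Tendsto g atBot atBot := by
  have hlow : ∀ s t, s ≤ t → t ≤ T → c * (t - s) ≤ f t - f s := by
    intro s t hst ht
    have hsub : ∀ {τ}, τ ∈ interior (Set.Iic T) → τ ≤ T := fun hτ =>
      Set.mem_Iic.1 (interior_subset hτ)
    refine Convex.mul_sub_le_image_sub_of_le_deriv (convex_Iic T)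
      (fun τ hτ => (hf τ hτ).continuousAt.continuousWithinAt)
      (fun τ hτ => (hf τ (hsub hτ)).differentiableAt.differentiableWithinAt)
      (fun τ hτ => ?_) s (hst.trans ht) t ht hst
    rw [(hf τ (hsub hτ)).deriv]
    exact h τ (hsub hτ)
  have hex : ∀ x, ∃ t, x ≤ f T → t ≤ T ∧ f t = x := by
    intro x
    by_cases hx : x ≤ f T
    -- Going back by (f T - x)/c is far enough for the slope bound c to force f s ≤ x, so x is
    -- attained on [s, T].
    · set s := T - (f T - x) / c with hs
      have hsT : s ≤ T := by
        have : 0 ≤ (f T - x) / c := div_nonneg (by linarith) hc.le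
        linarith
      have hfs : f s ≤ x := by
        have h1 := hlow s T hsT le_rfl
        have h2 : c * (T - s) = f T - x := by rw [hs]; field_simp; ring
        linarith
      obtain ⟨t, ht, ht'⟩ := intermediate_value_Icc hsT
        (fun τ hτ => (hf τ hτ.2).continuousAt.continuousWithinAt) ⟨hfs, hx⟩
      exact ⟨t, fun _ => ⟨ht.2, ht'⟩⟩
    · exact ⟨0, fun h => absurd h hx⟩
  choose g hg using hex
  -- The inverse is 1/c-Lipschitz; this supplies the continuity that differentiating an inverse
  -- function requires.
  have hlip : ∀ x ≤ f T, ∀ y ≤ f T, |g x - g y| ≤ |x - y| / c := by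
    have : ∀ x ≤ f T, ∀ y ≤ f T, g x ≤ g y → |g x - g y| ≤ |x - y| / c := by
      intro x hx y hy hxy
      have h1 := hlow _ _ hxy (hg y hy).1
      rw [(hg y hy).2, (hg x hx).2] at h1
      rw [abs_sub_comm, abs_of_nonneg (by linarith), le_div_iff₀ hc, mul_comm]
      exact h1.trans (by rw [abs_sub_comm]; exact le_abs_self _)
    intro x hx y hy
    rcases le_total (g x) (g y) with h1 | h1
    · exact this x hx y hy h1
    · rw [abs_sub_comm, abs_sub_comm x]; exact this y hy x hx h1
  refine ⟨g, hg, fun x hx => ?_, ?_⟩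
  · have hcont : ContinuousAt g x := by
      rw [ContinuousAt, tendsto_iff_dist_tendsto_zero]
      have h2 : Tendsto (fun y => |y - x| / c) (𝓝 x) (𝓝 0) := by
        have : Continuous fun y : ℝ => |y - x| / c := by fun_prop
        simpa using this.tendsto x
      refine squeeze_zero' (Eventually.of_forall fun _ => dist_nonneg) ?_ h2
      filter_upwards [gt_mem_nhds hx] with y hy
      exact hlip y hy.le x hx.le
    refine HasDerivAt.of_local_left_inverse hcont (hf _ (hg x hx.le).1)
      (hc.trans_le (h _ (hg x hx.le).1)).ne' ?_
    filter_upwards [gt_mem_nhds hx] with y hy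
    exact (hg y hy.le).2
  · refine tendsto_atBot.2 fun N => ?_
    filter_upwards [eventually_le_atBot (f T), eventually_lt_atBot (f (min N T))] with x hx hx'
    by_contra hN
    push Not at hN
    have h1 := hlow (min N T) (g x) ((min_le_left _ _).trans hN.le) (hg x hx).1
    rw [(hg x hx).2] at h1
    have : 0 ≤ c * (g x - min N T) :=
      mul_nonneg hc.le (by linarith [min_le_left N T])
    linarith

/-! ### Global flows, on a normed space and on the sphere -/

section GlobalFlow

variable {E : Type*} [NormedAddCommGroup E] [NormedSpace ℝ E]

/-- A bounded Lipschitz vector field has global solutions. -/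
lemma exists_global_solution [CompleteSpace E] {V : E → E} {K L : NNReal} (hK : LipschitzWith K V)
    (hL : ∀ x, ‖V x‖ ≤ L) (q : E) : ∃ γ : ℝ → E, γ 0 = q ∧ ∀ t, HasDerivAt γ (V (γ t)) t := by
  have hloc : ∀ T : NNReal, ∃ γ : ℝ → E, γ 0 = q ∧
      ∀ t ∈ Set.Ioo (-T : ℝ) T, HasDerivAt γ (V (γ t)) t := by
    intro T
    have h0 : (0 : ℝ) ∈ Set.Icc (-T : ℝ) T := ⟨by simp, by simp⟩
    -- A solution of speed at most L stays within L·T of q, so one Picard–Lindelöf step covers [-T,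
    -- T], however large T is.
    have hpl : IsPicardLindelof (fun _ => V) (⟨0, h0⟩ : Set.Icc (-T : ℝ) T) q (L * T) 0 L K :=
      IsPicardLindelof.of_time_independent (fun x _ => hL x) hK.lipschitzOnWith (by simp)
    obtain ⟨γ, h1, h2⟩ := hpl.exists_eq_forall_mem_Icc_hasDerivWithinAt₀
    exact ⟨γ, h1, fun t ht => (h2 t (Set.Ioo_subset_Icc_self ht)).hasDerivAt
      (Icc_mem_nhds ht.1 ht.2)⟩
  choose γ h1 h2 using hloc
  have hagree : ∀ (S T : NNReal), S ≤ T → Set.EqOn (γ S) (γ T) (Set.Ioo (-S : ℝ) S) := by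
    intro S T hST
    rcases eq_or_lt_of_le S.2 with hS | hS
    · intro t ht
      have h3 : (S : ℝ) = 0 := hS.symm
      exfalso
      rw [h3] at ht
      linarith [ht.1, ht.2]
    · have hST' : (S : ℝ) ≤ T := hST
      have hS' : (0 : ℝ) < S := hS
      refine ODE_solution_unique_of_mem_Ioo (v := fun _ => V) (s := fun _ => Set.univ) (t₀ := 0)
        (fun _ _ => hK.lipschitzOnWith) ⟨by linarith, hS⟩ (fun t ht => ⟨h2 S t ht, trivial⟩)
        (fun t ht => ⟨h2 T t ⟨by linarith [ht.1], by linarith [ht.2]⟩, trivial⟩)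
        ((h1 S).trans (h1 T).symm)
  -- At time t the solution on the window of half-length |t| + 1 is used; near t it agrees with the
  -- single solution on the window |t| + 2.
  refine ⟨fun t => γ (‖t‖₊ + 1) t, h1 _, fun t => ?_⟩
  have hev : (fun s => γ (‖s‖₊ + 1) s) =ᶠ[𝓝 t] γ (‖t‖₊ + 2) := by
    have : ∀ᶠ s in 𝓝 t, ‖s‖₊ < ‖t‖₊ + 1 :=
      (continuous_nnnorm.tendsto t).eventually_lt_const (by simp)
    filter_upwards [this] with s hs
    refine hagree _ _ ?_ ?_
    · calc ‖s‖₊ + 1 ≤ ‖t‖₊ + 1 + 1 := by gcongr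
        _ = ‖t‖₊ + 2 := by rw [add_assoc, one_add_one_eq_two]
    · have : |s| < |s| + 1 := by linarith
      simpa [abs_lt] using abs_lt.1 this
  refine (HasDerivAt.congr_of_eventuallyEq (h2 (‖t‖₊ + 2) t ?_) hev).congr_deriv ?_
  · have : |t| < |t| + 2 := by linarith
    simpa [abs_lt] using abs_lt.1 this
  · exact congrArg V hev.self_of_nhds.symm

lemma dist_solutions_le {V : E → E} {K : NNReal} (hK : LipschitzWith K V) {f g : ℝ → E}
    (hf : ∀ t, HasDerivAt f (V (f t)) t) (hg : ∀ t, HasDerivAt g (V (g t)) t) (t : ℝ) :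
    dist (f t) (g t) ≤ dist (f 0) (g 0) * Real.exp (K * |t|) := by
  rcases le_total 0 t with ht | ht
  · have := dist_le_of_trajectories_ODE (v := fun _ => V) (a := 0) (b := t) (fun _ => hK)
      (HasDerivAt.continuousOn fun s _ => hf s) (fun s _ => (hf s).hasDerivWithinAt)
      (HasDerivAt.continuousOn fun s _ => hg s) (fun s _ => (hg s).hasDerivWithinAt) le_rfl t
      ⟨ht, le_rfl⟩
    simpa [abs_of_nonneg ht] using this
  · have hrev : ∀ {f : ℝ → E}, (∀ t, HasDerivAt f (V (f t)) t) →
        ∀ t, HasDerivAt (fun s => f (-s)) (-V (f (-t))) t := fun hf t => by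
      simpa [Function.comp_def] using (hf (-t)).scomp t (hasDerivAt_neg t)
    have := dist_le_of_trajectories_ODE (v := fun _ x => -V x) (a := 0) (b := -t)
      (f := fun s => f (-s)) (g := fun s => g (-s)) (fun _ => hK.neg)
      (HasDerivAt.continuousOn fun s _ => hrev hf s) (fun s _ => (hrev hf s).hasDerivWithinAt)
      (HasDerivAt.continuousOn fun s _ => hrev hg s) (fun s _ => (hrev hg s).hasDerivWithinAt)
      le_rfl (-t) ⟨by linarith, le_rfl⟩
    simpa [abs_of_nonpos ht] using this

end GlobalFlow

/-- Global flow on the sphere of a vector field which is tangent to it. -/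
theorem exists_sphere_flow {V : E3 → E3} (hV : ContDiff ℝ 1 V) {κ : E3 → ℝ} (hκ : Continuous κ)
    (hr : ∀ z, inner ℝ z (V z) = κ z * (1 - ‖z‖ ^ 2)) :
    ∃ Φ : E3 → ℝ → E3, (∀ q ∈ Metric.sphere (0 : E3) 1, IsTrajectory V (Φ q) ∧ Φ q 0 = q) ∧
      ∀ t, ContinuousOn (fun q => Φ q t) (Metric.sphere (0 : E3) 1) := by
  -- The cutoff is 1 on the ball of radius 2 and supported in the ball of radius 3. It makes the
  -- field bounded and globally Lipschitz without changing it on the sphere.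
  let φ : ContDiffBump (0 : E3) := ⟨2, 3, by norm_num, by norm_num⟩
  have hφ1 : ∀ z ∈ Metric.sphere (0 : E3) 1, φ z = 1 := fun z hz =>
    φ.one_of_mem_closedBall (by
      have : ‖z‖ = 1 := by simpa using hz
      simp [φ, this])
  set U : E3 → E3 := fun z => φ z • V z with hU
  have hUc : ContDiff ℝ 1 U := φ.contDiff.smul hV
  have hUs : HasCompactSupport U := φ.hasCompactSupport.smul_right
  obtain ⟨K, hK⟩ := hUc.lipschitzWith_of_hasCompactSupport hUs one_ne_zero
  obtain ⟨L, hL⟩ := hUs.exists_bound_of_continuous hUc.continuous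
  have hL' : ∀ x, ‖U x‖ ≤ L.toNNReal := fun x => (hL x).trans (Real.le_coe_toNNReal L)
  choose Φ h1 h2 using fun q => exists_global_solution hK hL' q
  have hs : ∀ q ∈ Metric.sphere (0 : E3) 1, ∀ t, Φ q t ∈ Metric.sphere (0 : E3) 1 := by
    intro q hq t
    have hcont : Continuous (Φ q) := continuous_iff_continuousAt.2 fun t => (h2 q t).continuousAt
    -- By `hr`, 1 - ‖z‖² solves a homogeneous linear equation, so its initial value 0 persists.
    have hd : ∀ t, HasDerivAt (fun t => 1 - ‖Φ q t‖ ^ 2)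
        (-2 * φ (Φ q t) * κ (Φ q t) * (1 - ‖Φ q t‖ ^ 2)) t := fun t => by
      refine ((h2 q t).norm_sq.const_sub 1).congr_deriv ?_
      rw [hU]
      simp only [inner_smul_right, hr]
      ring
    have h0 : 1 - ‖Φ q 0‖ ^ 2 = 0 := by
      have : ‖q‖ = 1 := by simpa using hq
      rw [h1, this]; norm_num
    have := eq_zero_of_linear (f := fun t => 1 - ‖Φ q t‖ ^ 2)
      (g := fun t => -2 * φ (Φ q t) * κ (Φ q t))
      (((continuous_const.mul (φ.continuous.comp hcont))).mul (hκ.comp hcont)) hd h0 t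
    have h3 : ‖Φ q t‖ ^ 2 = 1 := by linarith
    have h4 : ‖Φ q t‖ = 1 :=
      (pow_eq_one_iff_of_nonneg (norm_nonneg _) two_ne_zero).1 h3
    simpa using h4
  refine ⟨Φ, fun q hq => ⟨⟨hs q hq, fun t => ?_⟩, h1 q⟩, fun t => Continuous.continuousOn ?_⟩
  · have := h2 q t
    simpa only [hU, hφ1 _ (hs q hq t), one_smul] using this
  · refine (LipschitzWith.of_dist_le_mul (K := (Real.exp (K * |t|)).toNNReal)
      fun q q' => ?_).continuous
    have := dist_solutions_le hK (h2 q) (h2 q') t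
    rw [h1, h1] at this
    rw [Real.coe_toNNReal _ (Real.exp_pos _).le, mul_comm]
    exact this

lemma exists_lipschitzOnWith_sphere {V : E3 → E3} (hV : ContDiff ℝ 1 V) :
    ∃ K, LipschitzOnWith K V (Metric.sphere (0 : E3) 1) := by
  obtain ⟨K, hK⟩ := hV.contDiffOn.exists_lipschitzOnWith one_ne_zero
    (convex_closedBall (0 : E3) 1) (isCompact_closedBall 0 1)
  exact ⟨K, hK.mono Metric.sphere_subset_closedBall⟩

lemma IsTrajectory.continuous {V : E3 → E3} {γ : ℝ → E3} (h : IsTrajectory V γ) : Continuous γ :=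
  continuous_iff_continuousAt.2 fun t => (h.2 t).continuousAt

lemma IsTrajectory.comp_add {V : E3 → E3} {γ : ℝ → E3} (h : IsTrajectory V γ) (s : ℝ) :
    IsTrajectory V fun t => γ (t + s) :=
  ⟨fun _ => h.1 _, fun t => (h.2 (t + s)).comp_add_const t s⟩

lemma IsTrajectory.eq_of_eq {V : E3 → E3} (hV : ContDiff ℝ 1 V) {γ₁ γ₂ : ℝ → E3}
    (h₁ : IsTrajectory V γ₁) (h₂ : IsTrajectory V γ₂) {t₀ : ℝ} (h : γ₁ t₀ = γ₂ t₀) :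
    γ₁ = γ₂ := by
  obtain ⟨K, hK⟩ := exists_lipschitzOnWith_sphere hV
  exact ODE_solution_unique_univ (v := fun _ => V) (fun _ => hK) (fun t => ⟨h₁.2 t, h₁.1 t⟩)
    (fun t => ⟨h₂.2 t, h₂.1 t⟩) h

/-- Trajectories through a common point differ by a time shift. -/
lemma IsTrajectory.eq_shift {V : E3 → E3} (hV : ContDiff ℝ 1 V) {γ₁ γ₂ : ℝ → E3}
    (h₁ : IsTrajectory V γ₁) (h₂ : IsTrajectory V γ₂) {s t : ℝ} (h : γ₁ s = γ₂ t) (τ : ℝ) :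
    γ₁ τ = γ₂ (τ + (t - s)) :=
  congrFun (h₁.eq_of_eq hV (h₂.comp_add (t - s)) (t₀ := s) (by simpa using h)) τ

lemma IsTrajectory.range_eq {V : E3 → E3} (hV : ContDiff ℝ 1 V) {γ₁ γ₂ : ℝ → E3}
    (h₁ : IsTrajectory V γ₁) (h₂ : IsTrajectory V γ₂) {s t : ℝ} (h : γ₁ s = γ₂ t) :
    Set.range γ₁ = Set.range γ₂ := by
  have key : ∀ {γ₁ γ₂ : ℝ → E3}, IsTrajectory V γ₁ → IsTrajectory V γ₂ → ∀ {s t}, γ₁ s = γ₂ t →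
      Set.range γ₁ ⊆ Set.range γ₂ := by
    rintro γ₁ γ₂ h₁ h₂ s t h _ ⟨τ, rfl⟩
    exact ⟨_, (h₁.eq_shift hV h₂ h τ).symm⟩
  exact (key h₁ h₂ h).antisymm (key h₂ h₁ h.symm)

/-- A trajectory which passes through a stationary point is constant. -/
lemma IsTrajectory.eq_const {V : E3 → E3} (hV : ContDiff ℝ 1 V) {γ : ℝ → E3}
    (h : IsTrajectory V γ) {t₀ : ℝ} (h0 : V (γ t₀) = 0) (t : ℝ) : γ t = γ t₀ :=
  congrFun (h.eq_of_eq hV (γ₂ := fun _ => γ t₀)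
    ⟨fun _ => h.1 t₀, fun s => by simpa [h0] using hasDerivAt_const s (γ t₀)⟩ rfl) t

/-! ### The compactified system in coordinates -/

/-- Radial coefficient: `cdkG a b z * z` is the normal part removed by the compactification. -/
noncomputable def cdkG (a b : ℝ) (z : E3) : ℝ :=
  (z 0 ^ 2 + z 1 ^ 2) * (a * z 0 ^ 2 + b * z 1 ^ 2 - b * z 1 * z 2)

/-- With `cdkH` and `cdkK` this splits the field so that the first and third components are
multiples of their own coordinate. Only the second has a coupling term, `cdkK b z * z 2`, which
vanishes on the equator. -/
noncomputable def cdkF (a b : ℝ) (z : E3) : ℝ :=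
  z 2 * z 1 - a * (z 0 ^ 2 + z 1 ^ 2) + cdkG a b z

noncomputable def cdkH (a b : ℝ) (z : E3) : ℝ :=
  z 2 * z 1 - b * (z 0 ^ 2 + z 1 ^ 2) + cdkG a b z

noncomputable def cdkK (b : ℝ) (z : E3) : ℝ := (b - 1) * (z 0 ^ 2 + z 1 ^ 2)

/-- The Poincaré compactification of the system, written out. -/
noncomputable def cdkField (a b : ℝ) (z : E3) : E3 :=
  !₂[cdkF a b z * z 0, cdkH a b z * z 1 + cdkK b z * z 2, cdkG a b z * z 2]

section Polynomials

open MvPolynomial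

lemma totalDegree_cdkP_le (a : ℝ) : (cdkP a).totalDegree ≤ 3 := by
  have h : ∀ i : Fin 2, (X i : MvPolynomial (Fin 2) ℝ).totalDegree = 1 := fun i => totalDegree_X i
  unfold cdkP
  refine (totalDegree_sub _ _).trans (max_le ?_ ?_)
  · refine (totalDegree_mul _ _).trans ?_
    simp [h]
  · refine (totalDegree_mul _ _).trans ?_
    rw [totalDegree_C, zero_add]
    refine (totalDegree_add _ _).trans (max_le ?_ ?_)
    · exact (totalDegree_pow _ _).trans (by simp [h])
    · refine (totalDegree_mul _ _).trans ?_
      have := totalDegree_pow (X 1 : MvPolynomial (Fin 2) ℝ) 2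
      rw [h] at this ⊢
      omega

lemma totalDegree_cdkQ_le (b : ℝ) : (cdkQ b).totalDegree ≤ 3 := by
  have h : ∀ i : Fin 2, (X i : MvPolynomial (Fin 2) ℝ).totalDegree = 1 := fun i => totalDegree_X i
  have hp : ∀ i : Fin 2, (X i ^ 2 : MvPolynomial (Fin 2) ℝ).totalDegree ≤ 2 := fun i =>
    (totalDegree_pow _ _).trans (by simp [h])
  unfold cdkQ
  refine (totalDegree_sub _ _).trans (max_le ((hp 1).trans (by norm_num)) ?_)
  refine (totalDegree_mul _ _).trans ?_
  have h1 : (C b * X 1 - C b + 1 : MvPolynomial (Fin 2) ℝ).totalDegree ≤ 1 := by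
    refine (totalDegree_add _ _).trans (max_le ((totalDegree_sub _ _).trans (max_le ?_ ?_)) ?_)
    · exact (totalDegree_mul _ _).trans (by simp [h])
    · simp
    · simp
  have h2 : (X 0 ^ 2 + X 1 ^ 2 : MvPolynomial (Fin 2) ℝ).totalDegree ≤ 2 :=
    (totalDegree_add _ _).trans (max_le (hp 0) (hp 1))
  omega

lemma isHomogeneous_C_mul {n : ℕ} (r : ℝ) {φ : MvPolynomial (Fin 2) ℝ} (h : φ.IsHomogeneous n) :
    (C r * φ).IsHomogeneous n := by
  simpa using (isHomogeneous_C (Fin 2) r).mul h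

lemma homogeneousComponent_cdkP (a : ℝ) (i : ℕ) : homogeneousComponent i (cdkP a) =
    (if i = 2 then X 0 * X 1 else 0) -
      (if i = 3 then C a * (X 0 ^ 3 + X 0 * X 1 ^ 2) else 0) := by
  have h2 : (X 0 * X 1 : MvPolynomial (Fin 2) ℝ).IsHomogeneous 2 :=
    (isHomogeneous_X ℝ 0).mul (isHomogeneous_X ℝ 1)
  have h3 : (C a * (X 0 ^ 3 + X 0 * X 1 ^ 2) : MvPolynomial (Fin 2) ℝ).IsHomogeneous 3 :=
    isHomogeneous_C_mul a ((isHomogeneous_X_pow 0 3).add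
      ((isHomogeneous_X ℝ 0).mul (isHomogeneous_X_pow 1 2)))
  rw [cdkP, map_sub, homogeneousComponent_of_mem h2, homogeneousComponent_of_mem h3]

lemma homogeneousComponent_cdkQ (b : ℝ) (i : ℕ) : homogeneousComponent i (cdkQ b) =
    (if i = 2 then X 1 ^ 2 + C (b - 1) * (X 0 ^ 2 + X 1 ^ 2) else 0) -
      (if i = 3 then C b * (X 1 * (X 0 ^ 2 + X 1 ^ 2)) else 0) := by
  have hq : (X 0 ^ 2 + X 1 ^ 2 : MvPolynomial (Fin 2) ℝ).IsHomogeneous 2 :=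
    (isHomogeneous_X_pow 0 2).add (isHomogeneous_X_pow 1 2)
  have h2 : (X 1 ^ 2 + C (b - 1) * (X 0 ^ 2 + X 1 ^ 2) :
      MvPolynomial (Fin 2) ℝ).IsHomogeneous 2 :=
    (isHomogeneous_X_pow 1 2).add (isHomogeneous_C_mul _ hq)
  have h3 : (C b * (X 1 * (X 0 ^ 2 + X 1 ^ 2)) : MvPolynomial (Fin 2) ℝ).IsHomogeneous 3 :=
    isHomogeneous_C_mul b ((isHomogeneous_X ℝ 1).mul hq)
  have e : cdkQ b = (X 1 ^ 2 + C (b - 1) * (X 0 ^ 2 + X 1 ^ 2)) -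
      C b * (X 1 * (X 0 ^ 2 + X 1 ^ 2)) := by
    rw [cdkQ, C_sub, C_1]; ring
  rw [e, map_sub, homogeneousComponent_of_mem h2, homogeneousComponent_of_mem h3]

lemma fieldDegree_cdk {a : ℝ} (ha : a ≠ 0) (b : ℝ) : fieldDegree (cdkP a) (cdkQ b) = 3 := by
  refine le_antisymm (max_le (totalDegree_cdkP_le a) (totalDegree_cdkQ_le b))
    (le_max_of_le_left ?_)
  by_contra hlt
  have h0 := homogeneousComponent_eq_zero 3 (cdkP a) (by omega)
  rw [homogeneousComponent_cdkP] at h0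
  -- The cubic part of the first component takes the value -a at (1,0).
  have := congrArg (MvPolynomial.eval ![1, 0]) h0
  simp [ha] at this

/-- Since z₁P* + z₂Q* = -`cdkG a b z`, removing the normal part adds `cdkG a b z • z` to (P*, Q*,
0). The identity holds on all of ℝ³, not only on the sphere. -/
lemma poincareField_cdk {a : ℝ} (ha : a ≠ 0) (b : ℝ) :
    poincareField (cdkP a) (cdkQ b) = cdkField a b := by
  funext z
  have hP : homogenization 3 (cdkP a) z =
      z 2 * (z 0 * z 1) - a * (z 0 ^ 3 + z 0 * z 1 ^ 2) := by
    simp [homogenization, Finset.sum_range_succ, homogeneousComponent_cdkP]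
    ring
  have hQ : homogenization 3 (cdkQ b) z =
      z 2 * (z 1 ^ 2 + (b - 1) * (z 0 ^ 2 + z 1 ^ 2)) - b * (z 1 * (z 0 ^ 2 + z 1 ^ 2)) := by
    simp [homogenization, Finset.sum_range_succ, homogeneousComponent_cdkQ]
    ring
  rw [poincareField, fieldDegree_cdk ha, hP, hQ]
  ext i
  fin_cases i <;> simp [cdkField, cdkF, cdkH, cdkK, cdkG] <;> ring

end Polynomials

lemma continuous_cdkG (a b : ℝ) : Continuous (cdkG a b) := by unfold cdkG; fun_prop
lemma continuous_cdkF (a b : ℝ) : Continuous (cdkF a b) := by unfold cdkF cdkG; fun_prop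
lemma continuous_cdkH (a b : ℝ) : Continuous (cdkH a b) := by unfold cdkH cdkG; fun_prop
lemma continuous_cdkK (b : ℝ) : Continuous (cdkK b) := by unfold cdkK; fun_prop

lemma contDiff_cdkField (a b : ℝ) : ContDiff ℝ 1 (cdkField a b) := by
  rw [contDiff_euclidean]
  intro i
  fin_cases i <;> (simp [cdkField, cdkF, cdkH, cdkK, cdkG]; fun_prop)

lemma inner_E3 (x y : E3) : inner ℝ x y = x 0 * y 0 + x 1 * y 1 + x 2 * y 2 := by
  simp [PiLp.inner_apply, Fin.sum_univ_three, mul_comm]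

lemma norm_sq_E3 (x : E3) : ‖x‖ ^ 2 = x 0 ^ 2 + x 1 ^ 2 + x 2 ^ 2 := by
  simp [EuclideanSpace.norm_sq_eq, Fin.sum_univ_three]

lemma mem_sphere_E3 {x : E3} :
    x ∈ Metric.sphere (0 : E3) 1 ↔ x 0 ^ 2 + x 1 ^ 2 + x 2 ^ 2 = 1 := by
  rw [← norm_sq_E3, mem_sphere_zero_iff_norm, pow_eq_one_iff_of_nonneg (norm_nonneg _) two_ne_zero]

lemma exists_cdk_flow (a b : ℝ) :
    ∃ Φ : E3 → ℝ → E3,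
      (∀ q ∈ Metric.sphere (0 : E3) 1, IsTrajectory (cdkField a b) (Φ q) ∧ Φ q 0 = q) ∧
      ∀ t, ContinuousOn (fun q => Φ q t) (Metric.sphere (0 : E3) 1) :=
  exists_sphere_flow (contDiff_cdkField a b) (continuous_cdkG a b).neg fun z => by
    rw [inner_E3, norm_sq_E3]
    simp [cdkField, cdkF, cdkH, cdkK, cdkG]
    ring

lemma cdkField_neg (a b : ℝ) (z : E3) : cdkField a b (-z) = -cdkField a b z := by
  ext i
  fin_cases i <;> simp [cdkField, cdkF, cdkH, cdkK, cdkG] <;> ring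

section Trajectory

variable {a b : ℝ} {γ : ℝ → E3}

lemma IsTrajectory.hasDerivAt_apply {V : E3 → E3} (h : IsTrajectory V γ) (i : Fin 3) (t : ℝ) :
    HasDerivAt (fun t => γ t i) (V (γ t) i) t :=
  (EuclideanSpace.proj i : E3 →L[ℝ] ℝ).hasFDerivAt.comp_hasDerivAt t (h.2 t)

lemma IsTrajectory.sq_sum {V : E3 → E3} (h : IsTrajectory V γ) (t : ℝ) :
    γ t 0 ^ 2 + γ t 1 ^ 2 + γ t 2 ^ 2 = 1 := mem_sphere_E3.1 (h.1 t)

lemma IsTrajectory.abs_le_one {V : E3 → E3} (h : IsTrajectory V γ) (i : Fin 3) (t : ℝ) :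
    |γ t i| ≤ 1 := by
  have := h.sq_sum t
  rw [← sq_le_one_iff_abs_le_one]
  fin_cases i <;> simp only [Fin.zero_eta, Fin.mk_one, Fin.reduceFinMk] <;>
    nlinarith [sq_nonneg (γ t 0), sq_nonneg (γ t 1), sq_nonneg (γ t 2)]

lemma IsTrajectory.deriv0 (h : IsTrajectory (cdkField a b) γ) (t : ℝ) :
    HasDerivAt (fun t => γ t 0) (cdkF a b (γ t) * γ t 0) t := h.hasDerivAt_apply 0 t

lemma IsTrajectory.deriv1 (h : IsTrajectory (cdkField a b) γ) (t : ℝ) :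
    HasDerivAt (fun t => γ t 1) (cdkH a b (γ t) * γ t 1 + cdkK b (γ t) * γ t 2) t :=
  h.hasDerivAt_apply 1 t

lemma IsTrajectory.deriv2 (h : IsTrajectory (cdkField a b) γ) (t : ℝ) :
    HasDerivAt (fun t => γ t 2) (cdkG a b (γ t) * γ t 2) t := h.hasDerivAt_apply 2 t

end Trajectory

/-! ### Linear parts at (1,0,0) and (0,1,0) -/

lemma fderiv_eq_of_line {V : E3 → E3} (hV : ContDiff ℝ 1 V) {p e d : E3}
    (h : ∀ i, HasDerivAt (fun t : ℝ => V (p + t • e) i) (d i) 0) : fderiv ℝ V p e = d := by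
  have hline : HasDerivAt (fun t : ℝ => p + t • e) e 0 := by
    simpa using ((hasDerivAt_id (0 : ℝ)).smul_const e).const_add p
  have hd : HasFDerivAt V (fderiv ℝ V p) (p + (0 : ℝ) • e) := by
    simpa using (hV.differentiable one_ne_zero p).hasFDerivAt
  have hc := hd.comp_hasDerivAt (0 : ℝ) hline
  ext i
  exact ((EuclideanSpace.proj i : E3 →L[ℝ] ℝ).hasFDerivAt.comp_hasDerivAt (0 : ℝ) hc).unique (h i)

lemma hasDerivAt_zero_of_expansion {g r : ℝ → ℝ} {c₁ : ℝ} (hr : DifferentiableAt ℝ r 0)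
    (h : ∀ t, g t = c₁ * t + t ^ 2 * r t) : HasDerivAt g c₁ 0 := by
  rw [funext h]
  refine (((hasDerivAt_id (0 : ℝ)).const_mul c₁).add
    (((hasDerivAt_id (0 : ℝ)).pow 2).mul hr.hasDerivAt)).congr_deriv ?_
  simp

/-- In a basis of the tangent plane, the eigenvalues can be read off from line derivatives. -/
lemma hasTangentEigenvalues_of_line {V : E3 → E3} (hV : ContDiff ℝ 1 V) {p e₁ e₂ : E3}
    {l m c : ℝ} (hli : LinearIndependent ℝ ![e₁, e₂]) (h1 : inner ℝ p e₁ = 0)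
    (h2 : inner ℝ p e₂ = 0)
    (hd1 : ∀ i, HasDerivAt (fun t : ℝ => V (p + t • e₁) i) (l * e₁ i) 0)
    (hd2 : ∀ i, HasDerivAt (fun t : ℝ => V (p + t • e₂) i) (c * e₁ i + m * e₂ i) 0) :
    HasTangentEigenvalues V p l m :=
  ⟨_, (hV.differentiable one_ne_zero _).hasFDerivAt, e₁, e₂, hli, h1, h2,
    fderiv_eq_of_line hV hd1, c, fderiv_eq_of_line hV hd2⟩

/-- The equatorial direction is an eigenvector for a - b. The direction (0,0,1) contributes a, with
off-diagonal entry b - 1 from the coupling term, so the linear part is only triangular in this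
basis. -/
lemma hasTangentEigenvalues_x (a b : ℝ) :
    HasTangentEigenvalues (cdkField a b) !₂[1, 0, 0] (a - b) a := by
  refine hasTangentEigenvalues_of_line (contDiff_cdkField a b) (e₁ := !₂[0, 1, 0])
    (e₂ := !₂[0, 0, 1]) (c := b - 1) ?_ (by simp [inner_E3]) (by simp [inner_E3])
    (fun i => ?_) (fun i => ?_)
  · rw [LinearIndependent.pair_iff]
    intro s t h
    have h1 := congrArg (fun z : E3 => z 1) h
    have h2 := congrArg (fun z : E3 => z 2) h
    simp at h1 h2
    exact ⟨h1, h2⟩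
  · refine hasDerivAt_zero_of_expansion
      -- Along this line the field is polynomial in t; r collects what remains after the linear
      -- term, divided by t².
      (r := fun t => ![(1 + t ^ 2) * b, t * (a + b * t ^ 2), 0] i) ?_ fun t => ?_
    · fin_cases i <;> simp <;> fun_prop
    · fin_cases i <;> simp [cdkField, cdkF, cdkH, cdkK, cdkG] <;> ring
  · refine hasDerivAt_zero_of_expansion (r := 0) (differentiableAt_const 0) fun t => ?_
    fin_cases i <;> simp [cdkField, cdkF, cdkH, cdkK, cdkG]

lemma hasTangentEigenvalues_y (a b : ℝ) :
    HasTangentEigenvalues (cdkField a b) !₂[0, 1, 0] (b - a) b := by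
  refine hasTangentEigenvalues_of_line (contDiff_cdkField a b) (e₁ := !₂[1, 0, 0])
    (e₂ := !₂[0, 0, 1]) (c := 0) ?_ (by simp [inner_E3]) (by simp [inner_E3])
    (fun i => ?_) (fun i => ?_)
  · rw [LinearIndependent.pair_iff]
    intro s t h
    have h1 := congrArg (fun z : E3 => z 0) h
    have h2 := congrArg (fun z : E3 => z 2) h
    simp at h1 h2
    exact ⟨h1, h2⟩
  · refine hasDerivAt_zero_of_expansion
      (r := fun t => ![t * (b + a * t ^ 2), (1 + t ^ 2) * a, 0] i) ?_ fun t => ?_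
    · fin_cases i <;> simp <;> fun_prop
    · fin_cases i <;> simp [cdkField, cdkF, cdkH, cdkK, cdkG] <;> ring
  · refine hasDerivAt_zero_of_expansion (r := fun _ => ![0, 0, -b] i) (by fun_prop) fun t => ?_
    fin_cases i <;> simp [cdkField, cdkF, cdkH, cdkK, cdkG] <;> ring

/-! ### Transfer to antipodal points -/

section Antipode

variable {V : E3 → E3}

lemma IsTrajectory.neg (hV : ∀ z, V (-z) = -V z) {γ : ℝ → E3} (h : IsTrajectory V γ) :
    IsTrajectory V fun t => -γ t :=
  ⟨fun t => by simpa using h.1 t, fun t => by rw [hV]; exact (h.2 t).neg⟩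

lemma image_neg_ne {O : Set E3} {p : E3} (h : O ≠ {p}) : (fun z => -z) '' O ≠ {-p} := fun h' =>
  h (neg_injective.image_injective (by simpa using h'))

lemma isOutgoingOrbit_image_neg (hV : ∀ z, V (-z) = -V z) {p : E3} {O : Set E3}
    (h : IsOutgoingOrbit V p O) : IsOutgoingOrbit V (-p) ((fun z => -z) '' O) := by
  obtain ⟨h0, γ, h1, h2, h3⟩ := h
  refine ⟨image_neg_ne h0, fun t => -γ t, h1.neg hV, ?_, h3.neg⟩
  rw [h2, ← Set.range_comp]; rfl

lemma isIncomingOrbit_image_neg (hV : ∀ z, V (-z) = -V z) {p : E3} {O : Set E3}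
    (h : IsIncomingOrbit V p O) : IsIncomingOrbit V (-p) ((fun z => -z) '' O) := by
  obtain ⟨h0, γ, h1, h2, h3⟩ := h
  refine ⟨image_neg_ne h0, fun t => -γ t, h1.neg hV, ?_, h3.neg⟩
  rw [h2, ← Set.range_comp]; rfl

lemma ncard_setOf_neg {P : E3 → Set E3 → Prop} (hP : ∀ p O, P p O → P (-p) ((fun z => -z) '' O))
    (p : E3) : {O | P (-p) O}.ncard = {O | P p O}.ncard := by
  have h : {O | P (-p) O} = (fun O => (fun z : E3 => -z) '' O) '' {O | P p O} := by
    ext O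
    constructor
    · intro hO
      refine ⟨_, by simpa using hP _ _ hO, ?_⟩
      simp
    · rintro ⟨O, hO, rfl⟩
      exact hP _ _ hO
  rw [h, Set.ncard_image_of_injective _ neg_injective.image_injective]

lemma HasTangentEigenvalues.neg (hV : ∀ z, V (-z) = -V z) {p : E3} {l m : ℝ}
    (h : HasTangentEigenvalues V p l m) : HasTangentEigenvalues V (-p) l m := by
  obtain ⟨L, hL, e₁, e₂, h1, h2, h3, h4⟩ := h
  refine ⟨L, ?_, e₁, e₂, h1, by simpa using h2, by simpa using h3, h4⟩
  have hc : HasFDerivAt (fun z => -V (-z)) L (-p) := by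
    have h5 : HasFDerivAt V L (- -p) := by simpa using hL
    have h6 := (h5.comp (-p) (hasFDerivAt_id (-p)).neg).neg
    have h7 : -(L.comp (-ContinuousLinearMap.id ℝ E3)) = L := by ext; simp
    rw [h7] at h6
    exact h6
  simpa [hV] using hc

lemma neg_mem_ball {p z : E3} {δ : ℝ} : -z ∈ Metric.ball p δ ↔ z ∈ Metric.ball (-p) δ := by
  rw [Metric.mem_ball, Metric.mem_ball, ← dist_neg_neg, neg_neg]

lemma IsRepellingNode.neg (hV : ∀ z, V (-z) = -V z) {p : E3} (h : IsRepellingNode V p) :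
    IsRepellingNode V (-p) := by
  obtain ⟨h0, ⟨l, m, hl, hm, he⟩, δ, hδ, h1⟩ := h
  refine ⟨by simp [hV, h0], ⟨l, m, hl, hm, he.neg hV⟩, δ, hδ, fun γ hγ hb hp => ?_⟩
  obtain ⟨h2, w, h3, hw⟩ := h1 _ (hγ.neg hV) (neg_mem_ball.2 hb) fun h => hp (by simp [← h])
  refine ⟨by simpa using h2.neg, -w, ?_, neg_ne_zero.2 hw⟩
  refine h3.neg.congr fun t => ?_
  rw [← smul_neg, ← norm_neg (-γ t - p)]
  congr 2
  · congr 1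
    abel
  · abel

lemma IsSaddlePoint.neg (hV : ∀ z, V (-z) = -V z) {p : E3} (h : IsSaddlePoint V p) :
    IsSaddlePoint V (-p) := by
  obtain ⟨h0, ⟨l, m, hl, hm, he⟩, hin, hout, δ, hδ, h1⟩ := h
  have hr : ∀ γ : ℝ → E3, (fun z => -z) '' Set.range (fun t => -γ t) = Set.range γ := fun γ => by
    rw [← Set.range_comp]; simp [Function.comp_def]
  refine ⟨by simp [hV, h0], ⟨l, m, hl, hm, he.neg hV⟩, ?_, ?_, δ, hδ, fun γ hγ hb hp => ?_⟩
  · rw [ncard_setOf_neg (P := IsIncomingOrbit V) fun p O => isIncomingOrbit_image_neg hV, hin]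
  · rw [ncard_setOf_neg (P := IsOutgoingOrbit V) fun p O => isOutgoingOrbit_image_neg hV, hout]
  · obtain ⟨h2, h3⟩ := h1 _ (hγ.neg hV) (neg_mem_ball.2 hb) fun h => hp (by simp [← h])
    constructor
    · rcases h2 with ⟨t, ht, ht'⟩ | h2
      · exact Or.inl ⟨t, ht, fun hm => ht' (neg_mem_ball.2 hm)⟩
      · exact Or.inr (hr γ ▸ isIncomingOrbit_image_neg hV h2)
    · rcases h3 with ⟨t, ht, ht'⟩ | h3
      · exact Or.inl ⟨t, ht, fun hm => ht' (neg_mem_ball.2 hm)⟩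
      · exact Or.inr (hr γ ▸ isOutgoingOrbit_image_neg hV h3)

end Antipode

/-! ### Convergence and tangent directions at the two points -/

lemma tendsto_apply_E3 {l : Filter ℝ} {γ : ℝ → E3} {p : E3} (h : Tendsto γ l (𝓝 p)) (i : Fin 3) :
    Tendsto (fun t => γ t i) l (𝓝 (p i)) :=
  ((EuclideanSpace.proj i : E3 →L[ℝ] ℝ).continuous.tendsto p).comp h

lemma tendsto_E3_of_apply {l : Filter ℝ} {γ : ℝ → E3} {p : E3}
    (h : ∀ i, Tendsto (fun t => γ t i) l (𝓝 (p i))) : Tendsto γ l (𝓝 p) :=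
  ((PiLp.continuous_toLp 2 fun _ : Fin 3 => ℝ).tendsto _).comp (tendsto_pi_nhds.2 h)

lemma tendsto_of_norm_sq_le {l : Filter ℝ} {γ : ℝ → E3} {p : E3} {f : ℝ → ℝ}
    (h : ∀ᶠ t in l, ‖γ t - p‖ ^ 2 ≤ f t) (hf : Tendsto f l (𝓝 0)) : Tendsto γ l (𝓝 p) := by
  rw [tendsto_iff_norm_sub_tendsto_zero]
  have h1 : Tendsto (fun t => ‖γ t - p‖ ^ 2) l (𝓝 0) :=
    squeeze_zero' (Eventually.of_forall fun _ => by positivity) h hf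
  simpa using h1.sqrt

/-- Any scale k of eventually constant sign may replace the distance to p: normalising a nonzero
limit q gives the direction ±q/‖q‖. -/
lemma exists_tangent_direction {l : Filter ℝ} {γ : ℝ → E3} {p q : E3} {k : ℝ → ℝ} (hq : q ≠ 0)
    (hk : (∀ᶠ t in l, 0 < k t) ∨ ∀ᶠ t in l, k t < 0)
    (h : Tendsto (fun t => (k t)⁻¹ • (γ t - p)) l (𝓝 q)) :
    ∃ w : E3, Tendsto (fun t => ‖γ t - p‖⁻¹ • (γ t - p)) l (𝓝 w) ∧ w ≠ 0 := by
  have key : ∀ {q : E3} {k : ℝ → ℝ}, q ≠ 0 → (∀ᶠ t in l, 0 < k t) →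
      Tendsto (fun t => (k t)⁻¹ • (γ t - p)) l (𝓝 q) →
      ∃ w : E3, Tendsto (fun t => ‖γ t - p‖⁻¹ • (γ t - p)) l (𝓝 w) ∧ w ≠ 0 := by
    intro q k hq hk h
    refine ⟨‖q‖⁻¹ • q, ((h.norm.inv₀ (norm_ne_zero_iff.2 hq)).smul h).congr' ?_,
      smul_ne_zero (inv_ne_zero (norm_ne_zero_iff.2 hq)) hq⟩
    filter_upwards [hk] with t ht
    rw [norm_smul, smul_smul, norm_inv, Real.norm_of_nonneg ht.le, mul_inv, inv_inv]
    congr 1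
    field_simp
  rcases hk with hk | hk
  · exact key hq hk h
  · refine key (k := fun t => -k t) (neg_ne_zero.2 hq) (hk.mono fun t => neg_pos.2) ?_
    refine h.neg.congr fun t => ?_
    rw [inv_neg, neg_smul]

lemma norm_sub_y_sq {z : E3} (hz : z ∈ Metric.sphere (0 : E3) 1) :
    ‖z - !₂[0, 1, 0]‖ ^ 2 = 2 * (1 - z 1) := by
  have := mem_sphere_E3.1 hz
  rw [norm_sq_E3]
  simp
  linarith

lemma norm_sub_x_sq {z : E3} (hz : z ∈ Metric.sphere (0 : E3) 1) :
    ‖z - !₂[1, 0, 0]‖ ^ 2 = 2 * (1 - z 0) := by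
  have := mem_sphere_E3.1 hz
  rw [norm_sq_E3]
  simp
  linarith

lemma norm_sub_y_sq_le {z : E3} (hz : z ∈ Metric.sphere (0 : E3) 1) (h : 0 ≤ z 1) :
    ‖z - !₂[0, 1, 0]‖ ^ 2 ≤ 2 * (z 0 ^ 2 + z 2 ^ 2) := by
  have := mem_sphere_E3.1 hz
  rw [norm_sub_y_sq hz]
  nlinarith [sq_nonneg (z 0), sq_nonneg (z 2)]

lemma norm_sub_x_sq_le {z : E3} (hz : z ∈ Metric.sphere (0 : E3) 1) (h : 0 ≤ z 0) :
    ‖z - !₂[1, 0, 0]‖ ^ 2 ≤ 2 * (z 1 ^ 2 + z 2 ^ 2) := by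
  have := mem_sphere_E3.1 hz
  rw [norm_sub_x_sq hz]
  nlinarith [sq_nonneg (z 1), sq_nonneg (z 2)]

lemma mem_ball_of_norm_sq_lt {z p : E3} {δ : ℝ} (hδ : 0 < δ) (h : ‖z - p‖ ^ 2 < δ ^ 2) :
    z ∈ Metric.ball p δ := by
  rw [mem_ball_iff_norm]
  exact lt_of_pow_lt_pow_left₀ 2 hδ.le h

lemma norm_sq_lt_of_mem_ball {z p : E3} {δ : ℝ} (h : z ∈ Metric.ball p δ) :
    ‖z - p‖ ^ 2 < δ ^ 2 := by
  rw [mem_ball_iff_norm] at h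
  gcongr

lemma tendsto_y {l : Filter ℝ} {γ : ℝ → E3} (hγ : ∀ t, γ t ∈ Metric.sphere (0 : E3) 1)
    (hv : ∀ᶠ t in l, 0 ≤ γ t 1) (h0 : Tendsto (fun t => γ t 0) l (𝓝 0))
    (h2 : Tendsto (fun t => γ t 2) l (𝓝 0)) : Tendsto γ l (𝓝 !₂[0, 1, 0]) :=
  tendsto_of_norm_sq_le (hv.mono fun t ht => norm_sub_y_sq_le (hγ t) ht)
    (by simpa using ((h0.pow 2).add (h2.pow 2)).const_mul 2)

lemma tendsto_x {l : Filter ℝ} {γ : ℝ → E3} (hγ : ∀ t, γ t ∈ Metric.sphere (0 : E3) 1)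
    (hv : ∀ᶠ t in l, 0 ≤ γ t 0) (h1 : Tendsto (fun t => γ t 1) l (𝓝 0))
    (h2 : Tendsto (fun t => γ t 2) l (𝓝 0)) : Tendsto γ l (𝓝 !₂[1, 0, 0]) :=
  tendsto_of_norm_sq_le (hv.mono fun t ht => norm_sub_x_sq_le (hγ t) ht)
    (by simpa using ((h1.pow 2).add (h2.pow 2)).const_mul 2)

/-- Only the two tangential ratios matter: on the sphere v - 1 = -(u² + w²)/(1 + v), so the normal
component is of second order and vanishes in the limit. -/
lemma direction_y {l : Filter ℝ} {γ : ℝ → E3} (hγ : ∀ t, γ t ∈ Metric.sphere (0 : E3) 1)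
    (hl : Tendsto γ l (𝓝 !₂[0, 1, 0])) {k : ℝ → ℝ} {α β : ℝ} (hαβ : α ≠ 0 ∨ β ≠ 0)
    (hk : (∀ᶠ t in l, 0 < k t) ∨ ∀ᶠ t in l, k t < 0)
    (h0 : Tendsto (fun t => γ t 0 / k t) l (𝓝 α)) (h2 : Tendsto (fun t => γ t 2 / k t) l (𝓝 β)) :
    ∃ w : E3, Tendsto (fun t => ‖γ t - !₂[0, 1, 0]‖⁻¹ • (γ t - !₂[0, 1, 0])) l (𝓝 w) ∧
      w ≠ 0 := by
  have e0 := tendsto_apply_E3 hl 0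
  have e1 := tendsto_apply_E3 hl 1
  have e2 := tendsto_apply_E3 hl 2
  simp at e0 e1 e2
  have h1 : Tendsto (fun t => (γ t 1 - 1) / k t) l (𝓝 0) := by
    have : Tendsto (fun t => -(γ t 0 * (γ t 0 / k t) + γ t 2 * (γ t 2 / k t)) / (1 + γ t 1)) l
        (𝓝 (-(0 * α + 0 * β) / (1 + 1))) :=
      ((e0.mul h0).add (e2.mul h2)).neg.div (e1.const_add 1) (by norm_num)
    simp only [zero_mul, add_zero, neg_zero, zero_div] at this
    refine this.congr' ?_
    filter_upwards [e1.eventually_const_lt one_half_lt_one] with t ht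
    have := mem_sphere_E3.1 (hγ t)
    have h3 : 1 + γ t 1 ≠ 0 := by linarith
    rw [div_eq_iff h3]
    rw [← mul_div_assoc, ← mul_div_assoc, ← add_div, ← neg_div, div_mul_eq_mul_div]
    congr 1
    linarith
  refine exists_tangent_direction (q := !₂[α, 0, β]) (k := k) ?_ hk ?_
  · intro h
    have i0 := congrArg (fun z : E3 => z 0) h
    have i2 := congrArg (fun z : E3 => z 2) h
    simp at i0 i2
    tauto
  · refine tendsto_E3_of_apply fun i => ?_
    fin_cases i
    · simpa [div_eq_inv_mul] using h0
    · simpa [div_eq_inv_mul] using h1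
    · simpa [div_eq_inv_mul] using h2

lemma direction_x {l : Filter ℝ} {γ : ℝ → E3} (hγ : ∀ t, γ t ∈ Metric.sphere (0 : E3) 1)
    (hl : Tendsto γ l (𝓝 !₂[1, 0, 0])) {k : ℝ → ℝ} {α β : ℝ} (hαβ : α ≠ 0 ∨ β ≠ 0)
    (hk : (∀ᶠ t in l, 0 < k t) ∨ ∀ᶠ t in l, k t < 0)
    (h1 : Tendsto (fun t => γ t 1 / k t) l (𝓝 α)) (h2 : Tendsto (fun t => γ t 2 / k t) l (𝓝 β)) :
    ∃ w : E3, Tendsto (fun t => ‖γ t - !₂[1, 0, 0]‖⁻¹ • (γ t - !₂[1, 0, 0])) l (𝓝 w) ∧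
      w ≠ 0 := by
  have e0 := tendsto_apply_E3 hl 0
  have e1 := tendsto_apply_E3 hl 1
  have e2 := tendsto_apply_E3 hl 2
  simp at e0 e1 e2
  have h0 : Tendsto (fun t => (γ t 0 - 1) / k t) l (𝓝 0) := by
    have : Tendsto (fun t => -(γ t 1 * (γ t 1 / k t) + γ t 2 * (γ t 2 / k t)) / (1 + γ t 0)) l
        (𝓝 (-(0 * α + 0 * β) / (1 + 1))) :=
      ((e1.mul h1).add (e2.mul h2)).neg.div (e0.const_add 1) (by norm_num)
    simp only [zero_mul, add_zero, neg_zero, zero_div] at this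
    refine this.congr' ?_
    filter_upwards [e0.eventually_const_lt one_half_lt_one] with t ht
    have := mem_sphere_E3.1 (hγ t)
    have h3 : 1 + γ t 0 ≠ 0 := by linarith
    rw [div_eq_iff h3]
    rw [← mul_div_assoc, ← mul_div_assoc, ← add_div, ← neg_div, div_mul_eq_mul_div]
    congr 1
    linarith
  refine exists_tangent_direction (q := !₂[0, α, β]) (k := k) ?_ hk ?_
  · intro h
    have i0 := congrArg (fun z : E3 => z 1) h
    have i2 := congrArg (fun z : E3 => z 2) h
    simp at i0 i2
    tauto
  · refine tendsto_E3_of_apply fun i => ?_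
    fin_cases i
    · simpa [div_eq_inv_mul] using h0
    · simpa [div_eq_inv_mul] using h1
    · simpa [div_eq_inv_mul] using h2

/-! ### Ratios of coordinates along trajectories -/

section Trajectory

variable {a b : ℝ} {γ : ℝ → E3}

/-- The field is orthogonal to the position vector on the sphere. This expresses the derivative of
v, times v, through the definite terms F u² + G w². -/
lemma IsTrajectory.tangent (h : IsTrajectory (cdkField a b) γ) (t : ℝ) :
    cdkF a b (γ t) * γ t 0 ^ 2 +
      (cdkH a b (γ t) * γ t 1 + cdkK b (γ t) * γ t 2) * γ t 1 + cdkG a b (γ t) * γ t 2 ^ 2 = 0 := by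
  have := h.sq_sum t
  simp only [cdkF, cdkH, cdkK, cdkG]
  linear_combination ((γ t 0 ^ 2 + γ t 1 ^ 2) *
    (a * γ t 0 ^ 2 + b * γ t 1 ^ 2 - b * γ t 1 * γ t 2)) * this

lemma IsTrajectory.continuous_F (h : IsTrajectory (cdkField a b) γ) :
    Continuous fun t => cdkF a b (γ t) := (continuous_cdkF a b).comp h.continuous

lemma IsTrajectory.continuous_G (h : IsTrajectory (cdkField a b) γ) :
    Continuous fun t => cdkG a b (γ t) := (continuous_cdkG a b).comp h.continuous

lemma IsTrajectory.continuous_H (h : IsTrajectory (cdkField a b) γ) :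
    Continuous fun t => cdkH a b (γ t) := (continuous_cdkH a b).comp h.continuous

/-- On the meridian `z₁ = 0`, the sign of `z₂` is invariant. -/
lemma IsTrajectory.deriv1_meridian (h : IsTrajectory (cdkField a b) γ) (h0 : ∀ t, γ t 0 = 0)
    (t : ℝ) : HasDerivAt (fun t => γ t 1)
      ((cdkH a b (γ t) + (b - 1) * γ t 1 * γ t 2) * γ t 1) t :=
  (h.deriv1 t).congr_deriv (by simp only [cdkK, h0 t]; ring)

/-- On the equator, the sign of `z₂` is invariant. -/
lemma IsTrajectory.deriv1_equator (h : IsTrajectory (cdkField a b) γ) (h2 : ∀ t, γ t 2 = 0)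
    (t : ℝ) : HasDerivAt (fun t => γ t 1) (cdkH a b (γ t) * γ t 1) t :=
  (h.deriv1 t).congr_deriv (by rw [h2 t]; ring)

/-- Derivative of `z₃ / z₁`. -/
lemma IsTrajectory.deriv_ratio_wu (h : IsTrajectory (cdkField a b) γ) {t : ℝ} (h0 : γ t 0 ≠ 0) :
    HasDerivAt (fun t => γ t 2 / γ t 0)
      ((a * (γ t 0 ^ 2 + γ t 1 ^ 2) - γ t 2 * γ t 1) * (γ t 2 / γ t 0)) t := by
  refine ((h.deriv2 t).div (h.deriv0 t) h0).congr_deriv ?_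
  -- The term `cdkG` is common to both growth rates and cancels in that of the ratio.
  simp only [cdkF]
  field_simp
  ring

/-- Derivative of `z₂ / z₁` on the equator. -/
lemma IsTrajectory.deriv_ratio_vu (h : IsTrajectory (cdkField a b) γ) (h2 : ∀ t, γ t 2 = 0)
    {t : ℝ} (h0 : γ t 0 ≠ 0) :
    HasDerivAt (fun t => γ t 1 / γ t 0) ((a - b) * (γ t 1 / γ t 0)) t := by
  refine ((h.deriv1_equator h2 t).div (h.deriv0 t) h0).congr_deriv ?_
  have := h.sq_sum t
  simp only [cdkF, cdkH, h2 t] at this ⊢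
  field_simp
  linear_combination γ t 1 * (a - b) * this

/-- Derivative of `z₁ / z₂` on the equator. -/
lemma IsTrajectory.deriv_ratio_uv (h : IsTrajectory (cdkField a b) γ) (h2 : ∀ t, γ t 2 = 0)
    {t : ℝ} (h1 : γ t 1 ≠ 0) :
    HasDerivAt (fun t => γ t 0 / γ t 1) ((b - a) * (γ t 0 / γ t 1)) t := by
  refine ((h.deriv0 t).div (h.deriv1_equator h2 t) h1).congr_deriv ?_
  have := h.sq_sum t
  simp only [cdkF, cdkH, h2 t] at this ⊢
  field_simp
  linear_combination γ t 0 * (b - a) * this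

end Trajectory

/-! ### Repelling node at (0,1,0) for a < b -/

theorem isRepellingNode_y {a b : ℝ} (ha : 0 < a) (hab : a < b) :
    IsRepellingNode (cdkField a b) !₂[0, 1, 0] := by
  set p : E3 := !₂[0, 1, 0] with hp
  have hFp : cdkF a b p = b - a := by simp [cdkF, cdkG, hp]; ring
  have hGp : cdkG a b p = b := by simp [cdkG, hp]
  set c := (b - a) / 2 with hc
  have hc0 : 0 < c := by linarith
  have hev : ∀ᶠ z in 𝓝 p, c < cdkF a b z ∧ c < cdkG a b z ∧ 1 / 2 < z 1 := by
    refine (((continuous_cdkF a b).tendsto p).eventually_const_lt (by rw [hFp]; linarith)).and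
      ((((continuous_cdkG a b).tendsto p).eventually_const_lt (by rw [hGp]; linarith)).and ?_)
    have : Continuous fun z : E3 => z 1 := by fun_prop
    exact (this.tendsto p).eventually_const_lt (by simp [hp]; norm_num)
  obtain ⟨δ, hδ, hball⟩ := Metric.eventually_nhds_iff_ball.1 hev
  refine ⟨by ext i; fin_cases i <;> simp [cdkField, cdkF, cdkH, cdkK, cdkG, hp],
    ⟨b - a, b, by linarith, by linarith, hasTangentEigenvalues_y a b⟩, δ, hδ,
    fun γ hγ h0 hne => ?_⟩
  -- The Lyapunov function 1 - v is half the squared distance to p, whence δ²/2. By tangency its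
  -- derivative times v is F u² + G w² ≥ c(1 - v²) ≥ c(1 - v)v, and v > 0 cancels.
  have htrap := backward_trap (f := fun t => 1 - γ t 1) (t₀ := 0) (d := δ ^ 2 / 2) hc0
    (fun t _ => (hγ.deriv1 t).const_sub 1)
    (fun t _ => by linarith [(abs_le.1 (hγ.abs_le_one 1 t)).2])
    (fun t _ hlt => by
      obtain ⟨h1, h2, h3⟩ := hball (γ t) (mem_ball_of_norm_sq_lt hδ (by
        rw [hp, norm_sub_y_sq (hγ.1 t)]; linarith))
      have h4 := hγ.tangent t
      have h5 := hγ.sq_sum t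
      have h6 := (abs_le.1 (hγ.abs_le_one 1 t)).2
      have h7 : c * (1 - γ t 1) * γ t 1 ≤
          -(cdkH a b (γ t) * γ t 1 + cdkK b (γ t) * γ t 2) * γ t 1 := by
        have i1 := mul_le_mul_of_nonneg_right h1.le (sq_nonneg (γ t 0))
        have i2 := mul_le_mul_of_nonneg_right h2.le (sq_nonneg (γ t 2))
        have i3 : 0 ≤ c * (1 - γ t 1) := mul_nonneg hc0.le (by linarith)
        have i4 : c * γ t 0 ^ 2 + c * γ t 2 ^ 2 = c * (1 - γ t 1) * (1 + γ t 1) := by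
          linear_combination c * h5
        linarith
      exact le_of_mul_le_mul_right h7 (by linarith))
    (by
      have := norm_sq_lt_of_mem_ball h0
      rw [hp, norm_sub_y_sq (hγ.1 0)] at this
      linarith)
  have hlim : Tendsto γ atBot (𝓝 p) :=
    tendsto_of_norm_sq_le (Eventually.of_forall fun t => (norm_sub_y_sq (hγ.1 t)).le)
      (by simpa using htrap.2.const_mul 2)
  refine ⟨hlim, ?_⟩
  -- On the meridian the direction is ±(0,0,1). Off it, w/u has growth rate G - F, which tends to a
  -- > 0, so w/u tends to 0 in backward time and the direction is ±(1,0,0).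
  by_cases hu : γ 0 0 = 0
  · have hu' := eq_zero_of_linear hγ.continuous_F hγ.deriv0 hu
    have hw : γ 0 2 ≠ 0 := fun hw => hne (by
      have h1 := hγ.sq_sum 0
      have h2 := (hball _ h0).2.2
      simp only at hu'
      rw [hu', hw] at h1
      have h3 : γ 0 1 = 1 := by nlinarith
      ext i; fin_cases i <;> simp [hp, hu', hw, h3])
    have hw' := ne_zero_of_linear hγ.continuous_G hγ.deriv2 hw
    refine direction_y hγ.1 hlim (k := fun t => γ t 2) (α := 0) (β := 1) (by simp) ?_ ?_ ?_
    · exact (sign_of_linear hγ.continuous_G hγ.deriv2 hw).imp Eventually.of_forall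
        Eventually.of_forall
    · simp [hu']
    · exact tendsto_const_nhds.congr fun t => (div_self (hw' t)).symm
  · have hu' := ne_zero_of_linear hγ.continuous_F hγ.deriv0 hu
    refine direction_y hγ.1 hlim (k := fun t => γ t 0) (α := 1) (β := 0) (by simp) ?_ ?_ ?_
    · exact (sign_of_linear hγ.continuous_F hγ.deriv0 hu).imp Eventually.of_forall
        Eventually.of_forall
    · exact tendsto_const_nhds.congr fun t => (div_self (hu' t)).symm
    · have hcont : Continuous fun z : E3 => a * (z 0 ^ 2 + z 1 ^ 2) - z 2 * z 1 := by fun_prop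
      have : ∀ᶠ t in atBot, a / 2 < a * (γ t 0 ^ 2 + γ t 1 ^ 2) - γ t 2 * γ t 1 :=
        ((hcont.tendsto p).comp hlim).eventually_const_lt (by simp [hp]; linarith)
      obtain ⟨T, hT⟩ := eventually_atBot.1 this
      refine tendsto_atBot_zero_of_le (half_pos ha) (T := T)
        (fun t _ => hγ.deriv_ratio_wu (hu' t)) fun t ht => ?_
      have := mul_le_mul_of_nonneg_right (hT t ht).le (sq_nonneg (γ t 2 / γ t 0))
      linarith

/-! ### Counting the orbits that converge to a point -/

lemma range_ne_singleton {γ : ℝ → E3} {p : E3} {t : ℝ} (h : γ t ≠ p) : Set.range γ ≠ {p} :=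
  fun h' => h (by have : γ t ∈ ({p} : Set E3) := h' ▸ Set.mem_range_self t; simpa using this)

lemma IsTrajectory.ne_of_range_ne {V : E3 → E3} (hV : ContDiff ℝ 1 V) {p : E3} (hp : V p = 0)
    {γ : ℝ → E3} (h : IsTrajectory V γ) (hr : Set.range γ ≠ {p}) (t : ℝ) : γ t ≠ p := by
  intro ht
  refine hr ?_
  have hc : γ = fun _ => p := funext fun s => (h.eq_const hV (t₀ := t) (by rw [ht, hp]) s).trans ht
  rw [hc, Set.range_const]

/-- Orbits that converge to `p` are distinguished by the sign of the `k`-th coordinate. -/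
lemma ncard_orbits_eq_two {V : E3 → E3} (hV : ContDiff ℝ 1 V) {p : E3} {l : Filter ℝ} {k : Fin 3}
    (hpk : p k = 0)
    (hex : ∀ σ : ℝ, σ ^ 2 = 1 → ∃ γ, IsTrajectory V γ ∧ Tendsto γ l (𝓝 p) ∧ 0 < σ * γ 0 k)
    (hsgn : ∀ γ, IsTrajectory V γ → Tendsto γ l (𝓝 p) → Set.range γ ≠ {p} → ∀ t, γ t k ≠ 0)
    (huniq : ∀ γ₁ γ₂, IsTrajectory V γ₁ → IsTrajectory V γ₂ → Tendsto γ₁ l (𝓝 p) →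
      Tendsto γ₂ l (𝓝 p) → Set.range γ₁ ≠ {p} → Set.range γ₂ ≠ {p} → 0 < γ₁ 0 k * γ₂ 0 k →
      ∃ s t, γ₁ s = γ₂ t) :
    {O : Set E3 | O ≠ {p} ∧ ∃ γ, IsTrajectory V γ ∧ O = Set.range γ ∧ Tendsto γ l (𝓝 p)}.ncard
      = 2 := by
  obtain ⟨γ₁, h1, l1, s1⟩ := hex 1 (by norm_num)
  obtain ⟨γ₂, h2, l2, s2⟩ := hex (-1) (by norm_num)
  rw [one_mul] at s1
  have s2 : γ₂ 0 k < 0 := by linarith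
  have r1 : Set.range γ₁ ≠ {p} := range_ne_singleton (t := 0) fun h => by
    rw [h, hpk] at s1; exact lt_irrefl _ s1
  have r2 : Set.range γ₂ ≠ {p} := range_ne_singleton (t := 0) fun h => by
    rw [h, hpk] at s2; exact lt_irrefl _ s2
  have hne : Set.range γ₁ ≠ Set.range γ₂ := by
    intro h
    obtain ⟨t, ht⟩ : γ₂ 0 ∈ Set.range γ₁ := h ▸ Set.mem_range_self 0
    have hcont : Continuous fun t => γ₁ t k :=
      continuous_iff_continuousAt.2 fun t => (h1.hasDerivAt_apply k t).continuousAt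
    obtain ⟨s, hs⟩ := mem_range_of_exists_le_of_exists_ge hcont (c := 0)
      ⟨t, by rw [ht]; exact s2.le⟩ ⟨0, s1.le⟩
    exact hsgn γ₁ h1 l1 r1 s hs
  rw [← Set.ncard_pair hne]
  congr 1
  ext O
  constructor
  · rintro ⟨hO, γ, hγ, rfl, hl⟩
    rcases lt_or_gt_of_ne (hsgn γ hγ hl hO 0) with h | h
    · obtain ⟨s, t, hst⟩ := huniq γ γ₂ hγ h2 hl l2 hO r2 (mul_pos_of_neg_of_neg h s2)
      exact Or.inr (hγ.range_eq hV h2 hst)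
    · obtain ⟨s, t, hst⟩ := huniq γ γ₁ hγ h1 hl l1 hO r1 (mul_pos h s1)
      exact Or.inl (hγ.range_eq hV h1 hst)
  · rintro (rfl | rfl)
    · exact ⟨r1, γ₁, h1, rfl, l1⟩
    · exact ⟨r2, γ₂, h2, rfl, l2⟩

lemma mul_pos_of_linear {f₁ g₁ f₂ g₂ : ℝ → ℝ} (hg₁ : Continuous g₁) (hg₂ : Continuous g₂)
    (h₁ : ∀ t, HasDerivAt f₁ (g₁ t * f₁ t) t) (h₂ : ∀ t, HasDerivAt f₂ (g₂ t * f₂ t) t)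
    (h : 0 < f₁ 0 * f₂ 0) (s t : ℝ) : 0 < f₁ s * f₂ t := by
  obtain ⟨k₁, p₁, e₁⟩ := exists_pos_mul_of_linear hg₁ h₁ 0 s
  obtain ⟨k₂, p₂, e₂⟩ := exists_pos_mul_of_linear hg₂ h₂ 0 t
  rw [e₁, e₂, mul_mul_mul_comm]
  positivity

lemma eq_of_sq_eq_of_mul_pos {x y : ℝ} (h : x ^ 2 = y ^ 2) (hxy : 0 < x * y) : x = y := by
  rcases sq_eq_sq_iff_eq_or_eq_neg.1 h with h | h
  · exact h
  · rw [h] at hxy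
    nlinarith [sq_nonneg y]

/-- Squaring makes both functions positive, as the intermediate value argument requires; the signs
are compared separately by `eq_of_sq_eq_of_mul_pos`. -/
lemma exists_common_sq {l₁ l₂ : Filter ℝ} [l₁.NeBot] [l₂.NeBot] {f g : ℝ → ℝ}
    (hf : Continuous f) (hg : Continuous g) (hf0 : ∀ t, f t ≠ 0) (hg0 : ∀ t, g t ≠ 0)
    (hfl : Tendsto f l₁ (𝓝 0)) (hgl : Tendsto g l₂ (𝓝 0)) : ∃ s t, f s ^ 2 = g t ^ 2 :=
  exists_common_value (f := fun t => f t ^ 2) (g := fun t => g t ^ 2) (hf.pow 2) (hg.pow 2)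
    (fun t => by have := hf0 t; positivity) (fun t => by have := hg0 t; positivity)
    (by simpa using hfl.pow 2) (by simpa using hgl.pow 2)

lemma tendsto_zero_of_sq {l : Filter ℝ} {f : ℝ → ℝ} (h : Tendsto (fun t => f t ^ 2) l (𝓝 0)) :
    Tendsto f l (𝓝 0) := by
  rw [tendsto_zero_iff_abs_tendsto_zero]
  simpa [Real.sqrt_sq_eq_abs, Function.comp_def] using h.sqrt

/-! ### Saddle at (0,1,0) for b < a -/

section SaddleY

variable {a b : ℝ} {γ : ℝ → E3}

lemma cdkF_y (a b : ℝ) : cdkF a b !₂[0, 1, 0] = b - a := by simp [cdkF, cdkG]; ring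
lemma cdkG_y (a b : ℝ) : cdkG a b !₂[0, 1, 0] = b := by simp [cdkG]
lemma cdkField_y (a b : ℝ) : cdkField a b !₂[0, 1, 0] = 0 := by
  ext i; fin_cases i <;> simp [cdkField, cdkF, cdkH, cdkK, cdkG]

lemma eq_y_of_coords {z : E3} (hz : z ∈ Metric.sphere (0 : E3) 1) (h0 : z 0 = 0) (h2 : z 2 = 0)
    (h1 : 0 < z 1) : z = !₂[0, 1, 0] := by
  have h := mem_sphere_E3.1 hz
  rw [h0, h2] at h
  have h3 : z 1 = 1 := by nlinarith
  ext i; fin_cases i <;> simp [h0, h2, h3]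

lemma IsTrajectory.tendsto_ratio_uv (hab : b < a) (h : IsTrajectory (cdkField a b) γ)
    (h2 : ∀ t, γ t 2 = 0) (h1 : ∀ t, 0 < γ t 1) :
    Tendsto (fun t => γ t 0 / γ t 1) atTop (𝓝 0) :=
  tendsto_atTop_zero_of_le (c := a - b) (T := 0) (by linarith)
    (fun t _ => h.deriv_ratio_uv h2 (h1 t).ne') fun t _ => by ring_nf; exact le_rfl

/-- Trajectories in the open half equator around `(0, 1, 0)` are incoming if `b < a`. -/
lemma IsTrajectory.tendsto_y_of_equator (hab : b < a) (h : IsTrajectory (cdkField a b) γ)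
    (h2 : ∀ t, γ t 2 = 0) (h1 : ∀ t, 0 < γ t 1) : Tendsto γ atTop (𝓝 !₂[0, 1, 0]) := by
  refine tendsto_y h.1 (Eventually.of_forall fun t => (h1 t).le) ?_ (by simp [h2])
  refine squeeze_zero_norm (fun t => ?_) (tendsto_zero_iff_abs_tendsto_zero _ |>.1
    (h.tendsto_ratio_uv hab h2 h1))
  have h3 := (abs_le.1 (h.abs_le_one 1 t)).2
  simp only [Function.comp, abs_div, abs_of_pos (h1 t), Real.norm_eq_abs]
  exact le_div_self (abs_nonneg _) (h1 t) h3

/-- Near the point w grows at rate G > b/2, which is incompatible with |w| ≤ 1 unless w = 0; hence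
incoming orbits lie on the equator. -/
lemma IsTrajectory.incoming_y (hb : 0 < b) (h : IsTrajectory (cdkField a b) γ)
    (hl : Tendsto γ atTop (𝓝 !₂[0, 1, 0])) : (∀ t, γ t 2 = 0) ∧ ∀ t, 0 < γ t 1 := by
  have hG : ∀ᶠ t in atTop, b / 2 < cdkG a b (γ t) :=
    (((continuous_cdkG a b).tendsto _).comp hl).eventually_const_lt (by rw [cdkG_y]; linarith)
  obtain ⟨T, hT⟩ := eventually_atTop.1 hG
  have h2T : γ T 2 = 0 := eq_zero_of_growth_atTop (half_pos hb) (fun t _ => h.deriv2 t)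
    (fun t ht => by
      have := mul_le_mul_of_nonneg_right (hT t ht).le (sq_nonneg (γ t 2))
      linarith) (fun t _ => h.abs_le_one 2 t)
  have h2 := eq_zero_of_linear h.continuous_G h.deriv2 h2T
  refine ⟨h2, ?_⟩
  obtain ⟨s, hs⟩ := ((tendsto_apply_E3 hl 1).eventually_const_lt (u := 0) (by simp)).exists
  exact pos_of_linear h.continuous_H (h.deriv1_equator h2) hs

lemma ncard_incoming_y (hb : 0 < b) (hab : b < a) :
    {O | IsIncomingOrbit (cdkField a b) !₂[0, 1, 0] O}.ncard = 2 := by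
  refine ncard_orbits_eq_two (contDiff_cdkField a b) (l := atTop) (k := 0) (by simp) ?_ ?_ ?_
  · intro σ hσ
    obtain ⟨Φ, hΦ, -⟩ := exists_cdk_flow a b
    -- Any point of the open half equator v > 0 with u of sign σ would do.
    obtain ⟨hγ, h0⟩ := hΦ !₂[σ * (3 / 5), 4 / 5, 0] (mem_sphere_E3.2 (by
      simp [mul_pow, hσ]; norm_num))
    have h2 := eq_zero_of_linear hγ.continuous_G hγ.deriv2 (t₀ := 0) (by rw [h0]; simp)
    have h1 := pos_of_linear hγ.continuous_H (hγ.deriv1_equator h2) (t₀ := 0)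
      (by rw [h0]; simp)
    refine ⟨_, hγ, hγ.tendsto_y_of_equator hab h2 h1, ?_⟩
    rw [h0]
    simp
    nlinarith
  · intro γ hγ hl hr t h0
    obtain ⟨h2, h1⟩ := hγ.incoming_y hb hl
    exact hγ.ne_of_range_ne (contDiff_cdkField a b) (cdkField_y a b) hr t
      (eq_y_of_coords (hγ.1 t) h0 (h2 t) (h1 t))
  · intro γ₁ γ₂ hγ₁ hγ₂ hl₁ hl₂ hr₁ hr₂ hpos
    obtain ⟨w₁, v₁⟩ := hγ₁.incoming_y hb hl₁
    obtain ⟨w₂, v₂⟩ := hγ₂.incoming_y hb hl₂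
    have hu := mul_pos_of_linear hγ₁.continuous_F hγ₂.continuous_F hγ₁.deriv0 hγ₂.deriv0 hpos
    have c₁ : Continuous fun t => γ₁ t 0 / γ₁ t 1 := continuous_iff_continuousAt.2 fun t =>
      (hγ₁.deriv_ratio_uv w₁ (v₁ t).ne').continuousAt
    have c₂ : Continuous fun t => γ₂ t 0 / γ₂ t 1 := continuous_iff_continuousAt.2 fun t =>
      (hγ₂.deriv_ratio_uv w₂ (v₂ t).ne').continuousAt
    have n₁ : ∀ t, γ₁ t 0 ≠ 0 := fun t h => by have := hu t 0; simp [h] at this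
    have n₂ : ∀ t, γ₂ t 0 ≠ 0 := fun t h => by have := hu 0 t; simp [h] at this
    -- On the equator with v > 0 the ratio u/v determines the point. Two orbits on the same side
    -- both take every sufficiently small value of that sign, so they meet.
    obtain ⟨s, t, hst⟩ := exists_common_sq c₁ c₂
      (fun t => div_ne_zero (n₁ t) (v₁ t).ne') (fun t => div_ne_zero (n₂ t) (v₂ t).ne')
      (hγ₁.tendsto_ratio_uv hab w₁ v₁) (hγ₂.tendsto_ratio_uv hab w₂ v₂)
    refine ⟨s, t, ?_⟩
    have hr : γ₁ s 0 / γ₁ s 1 = γ₂ t 0 / γ₂ t 1 := by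
      refine eq_of_sq_eq_of_mul_pos hst ?_
      rw [div_mul_div_comm]
      exact div_pos (hu s t) (mul_pos (v₁ s) (v₂ t))
    have q₁ := hγ₁.sq_sum s
    have q₂ := hγ₂.sq_sum t
    have p₁ := v₁ s
    have p₂ := v₂ t
    rw [w₁] at q₁
    rw [w₂] at q₂
    have e₁ : γ₁ s 0 = γ₁ s 0 / γ₁ s 1 * γ₁ s 1 := by field_simp
    have e₂ : γ₂ t 0 = γ₁ s 0 / γ₁ s 1 * γ₂ t 1 := by rw [hr]; field_simp
    set m := γ₁ s 0 / γ₁ s 1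
    have hv : γ₁ s 1 = γ₂ t 1 := by
      rw [← sq_eq_sq₀ p₁.le p₂.le]
      rw [e₁] at q₁
      rw [e₂] at q₂
      have hm : 0 < m ^ 2 + 1 := by positivity
      refine mul_left_cancel₀ hm.ne' ?_
      linear_combination q₁ - q₂
    ext i
    fin_cases i
    · simp only [Fin.zero_eta]; rw [e₁, e₂, hv]
    · exact hv
    · simp [w₁, w₂]

/-- Here F is close to b - a < 0, so a nonzero u would grow without bound in backward time; outgoing
orbits lie on the meridian. -/
lemma IsTrajectory.outgoing_y (hab : b < a) (h : IsTrajectory (cdkField a b) γ)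
    (hl : Tendsto γ atBot (𝓝 !₂[0, 1, 0])) : (∀ t, γ t 0 = 0) ∧ ∀ t, 0 < γ t 1 := by
  have hF : ∀ᶠ t in atBot, cdkF a b (γ t) < -((a - b) / 2) :=
    (((continuous_cdkF a b).tendsto _).comp hl).eventually_lt_const (by rw [cdkF_y]; linarith)
  obtain ⟨T, hT⟩ := eventually_atBot.1 hF
  have h0T : γ T 0 = 0 := eq_zero_of_growth_atBot (half_pos (sub_pos.2 hab))
    (fun t _ => h.deriv0 t)
    (fun t ht => by
      have := mul_le_mul_of_nonneg_right (hT t ht).le (sq_nonneg (γ t 0))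
      linarith) (fun t _ => h.abs_le_one 0 t)
  have h0 := eq_zero_of_linear h.continuous_F h.deriv0 h0T
  refine ⟨h0, ?_⟩
  obtain ⟨s, hs⟩ := ((tendsto_apply_E3 hl 1).eventually_const_lt (u := 0) (by simp)).exists
  exact pos_of_linear (h.continuous_H.add
    ((continuous_const.mul (continuous_iff_continuousAt.2 fun t => (h.deriv1 t).continuousAt)).mul
      (continuous_iff_continuousAt.2 fun t => (h.deriv2 t).continuousAt)))
    (h.deriv1_meridian h0) hs

lemma ncard_outgoing_y (hb : 0 < b) (hab : b < a) :
    {O | IsOutgoingOrbit (cdkField a b) !₂[0, 1, 0] O}.ncard = 2 := by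
  refine ncard_orbits_eq_two (contDiff_cdkField a b) (l := atBot) (k := 2) (by simp) ?_ ?_ ?_
  · intro σ hσ
    obtain ⟨Φ, hΦ, -⟩ := exists_cdk_flow a b
    have hev : ∀ᶠ z in 𝓝 (!₂[0, 1, 0] : E3), b / 2 < cdkG a b z :=
      ((continuous_cdkG a b).tendsto _).eventually_const_lt (by rw [cdkG_y]; linarith)
    obtain ⟨δ, hδ, hball⟩ := Metric.eventually_nhds_iff_ball.1 hev
    -- The bound 1/2 makes v = √(1 - ε²) positive; the bound δ/2 starts the orbit with w² < δ²/2. On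
    -- the meridian this inequality keeps it in the δ-ball.
    set ε := min (1 / 2) (δ / 2) with hε
    have hε0 : 0 < ε := by positivity
    have hε1 : ε ^ 2 ≤ (1 / 2) ^ 2 := by gcongr; exact min_le_left _ _
    have hε2 : ε ^ 2 ≤ (δ / 2) ^ 2 := by gcongr; exact min_le_right _ _
    have hv : 0 < √(1 - ε ^ 2) := Real.sqrt_pos.2 (by linarith)
    obtain ⟨hγ, h0⟩ := hΦ !₂[0, √(1 - ε ^ 2), σ * ε] (mem_sphere_E3.2 (by
      simp [mul_pow, hσ]
      rw [Real.sq_sqrt (by linarith)]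
      ring))
    have hu := eq_zero_of_linear hγ.continuous_F hγ.deriv0 (t₀ := 0) (by rw [h0]; simp)
    have hv' := pos_of_linear (hγ.continuous_H.add
      ((continuous_const.mul
        (continuous_iff_continuousAt.2 fun t => (hγ.deriv1 t).continuousAt)).mul
        (continuous_iff_continuousAt.2 fun t => (hγ.deriv2 t).continuousAt)))
      (hγ.deriv1_meridian hu) (t₀ := 0) (by rw [h0]; simpa using hv)
    have htrap := backward_trap (t₀ := 0) (d := δ ^ 2 / 2) hb
      (fun t _ => (hγ.deriv2 t).pow 2) (fun t _ => sq_nonneg _)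
      (fun t _ hlt => by
        have h1 := hball _ (mem_ball_of_norm_sq_lt hδ
          ((norm_sub_y_sq_le (hγ.1 t) (hv' t).le).trans_lt (by
            have := hu t
            simp only [Pi.pow_apply] at this hlt
            rw [this]; linarith)))
        have := mul_le_mul_of_nonneg_right h1.le (sq_nonneg (Φ !₂[0, √(1 - ε ^ 2), σ * ε] t 2))
        simp only [Pi.pow_apply]
        norm_num
        linarith)
      (by simp [h0, mul_pow, hσ]; nlinarith)
    refine ⟨_, hγ, tendsto_y hγ.1 (Eventually.of_forall fun t => (hv' t).le) (by simp [hu])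
      (tendsto_zero_of_sq htrap.2), ?_⟩
    rw [h0]
    simp
    nlinarith
  · intro γ hγ hl hr t h2
    obtain ⟨h0, h1⟩ := hγ.outgoing_y hab hl
    exact hγ.ne_of_range_ne (contDiff_cdkField a b) (cdkField_y a b) hr t
      (eq_y_of_coords (hγ.1 t) (h0 t) h2 (h1 t))
  · intro γ₁ γ₂ hγ₁ hγ₂ hl₁ hl₂ hr₁ hr₂ hpos
    obtain ⟨u₁, v₁⟩ := hγ₁.outgoing_y hab hl₁
    obtain ⟨u₂, v₂⟩ := hγ₂.outgoing_y hab hl₂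
    have hw := mul_pos_of_linear hγ₁.continuous_G hγ₂.continuous_G hγ₁.deriv2 hγ₂.deriv2 hpos
    have c₁ : Continuous fun t => γ₁ t 2 := continuous_iff_continuousAt.2 fun t =>
      (hγ₁.deriv2 t).continuousAt
    have c₂ : Continuous fun t => γ₂ t 2 := continuous_iff_continuousAt.2 fun t =>
      (hγ₂.deriv2 t).continuousAt
    have n₁ : ∀ t, γ₁ t 2 ≠ 0 := fun t h => by have := hw t 0; simp [h] at this
    have n₂ : ∀ t, γ₂ t 2 ≠ 0 := fun t h => by have := hw 0 t; simp [h] at this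
    obtain ⟨s, t, hst⟩ := exists_common_sq c₁ c₂ n₁ n₂
      (by simpa using tendsto_apply_E3 hl₁ 2) (by simpa using tendsto_apply_E3 hl₂ 2)
    refine ⟨s, t, ?_⟩
    have q₁ := hγ₁.sq_sum s
    have q₂ := hγ₂.sq_sum t
    rw [u₁] at q₁
    rw [u₂] at q₂
    ext i
    fin_cases i
    · simp [u₁, u₂]
    · simp only [Fin.mk_one]
      rw [← sq_eq_sq₀ (v₁ s).le (v₂ t).le]
      linarith
    · exact eq_of_sq_eq_of_mul_pos hst (hw s t)

theorem isSaddlePoint_y (hb : 0 < b) (hab : b < a) :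
    IsSaddlePoint (cdkField a b) !₂[0, 1, 0] := by
  refine ⟨cdkField_y a b, ⟨b - a, b, by linarith, hb, hasTangentEigenvalues_y a b⟩,
    ncard_incoming_y hb hab, ncard_outgoing_y hb hab, ?_⟩
  set p : E3 := !₂[0, 1, 0] with hp
  have hev : ∀ᶠ z in 𝓝 p,
      cdkF a b z < -((a - b) / 2) ∧ b / 2 < cdkG a b z ∧ 0 < z 1 := by
    refine (((continuous_cdkF a b).tendsto p).eventually_lt_const
      (by rw [hp, cdkF_y]; linarith)).and
      ((((continuous_cdkG a b).tendsto p).eventually_const_lt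
      (by rw [hp, cdkG_y]; linarith)).and ?_)
    have : Continuous fun z : E3 => z 1 := by fun_prop
    exact (this.tendsto p).eventually_const_lt (by simp [hp])
  obtain ⟨δ, hδ, hball⟩ := Metric.eventually_nhds_iff_ball.1 hev
  refine ⟨δ, hδ, fun γ hγ h0 hne => ⟨?_, ?_⟩⟩
  -- Staying in the ball forever forces w = 0 in forward time, and below u = 0 in backward time; the
  -- orbit is then incoming, respectively outgoing.
  · by_contra! hcon
    obtain ⟨hin, hnot⟩ := hcon
    have hin' : ∀ t ≥ 0, γ t ∈ Metric.ball p δ := fun t ht => by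
      rcases ht.lt_or_eq with ht | rfl
      · exact hin t ht
      · exact h0
    have h2 : γ 0 2 = 0 := eq_zero_of_growth_atTop (half_pos hb) (fun t _ => hγ.deriv2 t)
      (fun t ht => by
        have := mul_le_mul_of_nonneg_right (hball _ (hin' t ht)).2.1.le (sq_nonneg (γ t 2))
        linarith) (fun t _ => hγ.abs_le_one 2 t)
    have h2' := eq_zero_of_linear hγ.continuous_G hγ.deriv2 h2
    have h1 := pos_of_linear hγ.continuous_H (hγ.deriv1_equator h2') (hball _ h0).2.2
    exact hnot ⟨range_ne_singleton hne, γ, hγ, rfl, hγ.tendsto_y_of_equator hab h2' h1⟩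
  · by_contra! hcon
    obtain ⟨hin, hnot⟩ := hcon
    have hin' : ∀ t ≤ 0, γ t ∈ Metric.ball p δ := fun t ht => by
      rcases ht.lt_or_eq with ht | rfl
      · exact hin t ht
      · exact h0
    have hu : γ 0 0 = 0 := eq_zero_of_growth_atBot (half_pos (sub_pos.2 hab))
      (fun t _ => hγ.deriv0 t)
      (fun t ht => by
        have := mul_le_mul_of_nonneg_right (hball _ (hin' t ht)).1.le (sq_nonneg (γ t 0))
        linarith) (fun t _ => hγ.abs_le_one 0 t)
    have hu' := eq_zero_of_linear hγ.continuous_F hγ.deriv0 hu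
    have hw : Tendsto (fun t => γ t 2) atBot (𝓝 0) :=
      tendsto_atBot_zero_of_le (half_pos hb) (T := 0) (fun t _ => hγ.deriv2 t) fun t ht => by
        have := mul_le_mul_of_nonneg_right (hball _ (hin' t ht)).2.1.le (sq_nonneg (γ t 2))
        linarith
    refine hnot ⟨range_ne_singleton hne, γ, hγ, rfl, tendsto_y hγ.1 ?_ (by simp [hu']) hw⟩
    filter_upwards [eventually_le_atBot 0] with t ht
    exact (hball _ (hin' t ht)).2.2.le

end SaddleY

/-! ### Repelling node at (1,0,0) for b < a -/

section PoleX

variable {a b : ℝ} {γ : ℝ → E3}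

lemma cdkG_x (a b : ℝ) : cdkG a b !₂[1, 0, 0] = a := by simp [cdkG]
lemma cdkH_x (a b : ℝ) : cdkH a b !₂[1, 0, 0] = a - b := by simp [cdkH, cdkG]; ring
lemma cdkK_x (b : ℝ) : cdkK b !₂[1, 0, 0] = b - 1 := by simp [cdkK]
lemma cdkField_x (a b : ℝ) : cdkField a b !₂[1, 0, 0] = 0 := by
  ext i; fin_cases i <;> simp [cdkField, cdkF, cdkH, cdkK, cdkG]

lemma eq_x_of_coords {z : E3} (hz : z ∈ Metric.sphere (0 : E3) 1) (h1 : z 1 = 0) (h2 : z 2 = 0)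
    (h0 : 0 < z 0) : z = !₂[1, 0, 0] := by
  have h := mem_sphere_E3.1 hz
  rw [h1, h2] at h
  have h3 : z 0 = 1 := by nlinarith
  ext i; fin_cases i <;> simp [h1, h2, h3]

/-- In the affine coordinate `y = z₂ / z₃`, the slow manifold is `y = (b - 1) / b`. -/
lemma IsTrajectory.deriv_ratio_vw (hb : b ≠ 0) (h : IsTrajectory (cdkField a b) γ) {t : ℝ}
    (h2 : γ t 2 ≠ 0) : HasDerivAt (fun t => γ t 1 / γ t 2 - (b - 1) / b)
      (-(b * (γ t 0 ^ 2 + γ t 1 ^ 2)) * (γ t 1 / γ t 2 - (b - 1) / b) + γ t 1 ^ 2) t := by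
  refine (((h.deriv1 t).div (h.deriv2 t) h2).sub_const _).congr_deriv ?_
  simp only [cdkH, cdkK]
  field_simp
  ring

/-- The deviation of v/w from (b - 1)/b is damped at rate b(u² + v²), which tends to b, and forced
by v², which tends to 0; so `backward_dichotomy` applies. -/
lemma IsTrajectory.dichotomy_x (hb : 0 < b) (h : IsTrajectory (cdkField a b) γ)
    (hl : Tendsto γ atBot (𝓝 !₂[1, 0, 0])) (h2 : ∀ t, γ t 2 ≠ 0) :
    Tendsto (fun t => γ t 1 / γ t 2) atBot (𝓝 ((b - 1) / b)) ∨
      Tendsto (fun t => γ t 1 / γ t 2) atBot atTop ∨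
      Tendsto (fun t => γ t 1 / γ t 2) atBot atBot := by
  have hcont : Continuous fun z : E3 => b * (z 0 ^ 2 + z 1 ^ 2) := by fun_prop
  have hρ : ∀ᶠ t in atBot, b / 2 < b * (γ t 0 ^ 2 + γ t 1 ^ 2) :=
    ((hcont.tendsto _).comp hl).eventually_const_lt (by simp; linarith)
  have he : Tendsto (fun t => γ t 1 ^ 2) atBot (𝓝 0) := by
    simpa using (tendsto_apply_E3 hl 1).pow 2
  rcases backward_dichotomy (half_pos hb)
    (Eventually.of_forall fun t => h.deriv_ratio_vw hb.ne' (h2 t)) (hρ.mono fun t => le_of_lt) he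
    with h | h | h
  · left
    simpa using h.add_const ((b - 1) / b)
  · right; left
    simpa using tendsto_atTop_add_const_right _ ((b - 1) / b) h
  · right; right
    simpa using tendsto_atBot_add_const_right _ ((b - 1) / b) h

theorem isRepellingNode_x (hb : 0 < b) (hab : b < a) :
    IsRepellingNode (cdkField a b) !₂[1, 0, 0] := by
  refine ⟨cdkField_x a b, ⟨a - b, a, by linarith, by linarith, hasTangentEigenvalues_x a b⟩, ?_⟩
  set p : E3 := !₂[1, 0, 0] with hp
  set c := (a - b) / 2 with hc
  have hc0 : 0 < c := by linarith
  set B := (b - 1) ^ 2 + 1 with hB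
  have hB0 : 0 < B := by positivity
  have hev : ∀ᶠ z in 𝓝 p, c < cdkH a b z ∧ c < cdkG a b z ∧ cdkK b z ^ 2 < B ∧ 0 < z 0 := by
    refine (((continuous_cdkH a b).tendsto p).eventually_const_lt
      (by rw [hp, cdkH_x]; linarith)).and
      ((((continuous_cdkG a b).tendsto p).eventually_const_lt
      (by rw [hp, cdkG_x]; linarith)).and
      (((((continuous_cdkK b).pow 2).tendsto p).eventually_lt_const
      (by rw [Pi.pow_apply, hp, cdkK_x]; linarith)).and ?_))
    have : Continuous fun z : E3 => z 0 := by fun_prop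
    exact (this.tendsto p).eventually_const_lt (by simp [hp])
  obtain ⟨δ, hδ, hball⟩ := Metric.eventually_nhds_iff_ball.1 hev
  -- The weight C lets v² + C w² absorb the coupling term 2Kvw: c²v² + 2cKvw + c²C w² ≥ (cv + Kw)²,
  -- because c²C = c² + B and K² < B near p.
  set C := 1 + B / c ^ 2 with hC
  have hC1 : 1 ≤ C := by
    have : 0 ≤ B / c ^ 2 := by positivity
    linarith
  have hCc : c ^ 2 * C = c ^ 2 + B := by rw [hC]; field_simp
  -- Within this radius the weighted form v² + C w² is below δ²/2, and that in turn bounds the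
  -- distance to p by δ.
  have hδ' : 0 < δ / (2 * C) := by positivity
  refine ⟨δ / (2 * C), hδ', fun γ hγ h0 hne => ?_⟩
  have hδδ : δ / (2 * C) ≤ δ := div_le_self hδ.le (by linarith)
  have hu := pos_of_linear hγ.continuous_F hγ.deriv0 (hball _ (Metric.ball_subset_ball hδδ h0)).2.2.2
  have hle : ∀ t, ‖γ t - p‖ ^ 2 ≤ 2 * (γ t 1 ^ 2 + C * γ t 2 ^ 2) := fun t => by
    have h1 := norm_sub_x_sq_le (hγ.1 t) (hu t).le
    have h2 := mul_le_mul_of_nonneg_right hC1 (sq_nonneg (γ t 2))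
    linarith
  have htrap := backward_trap (f := fun t => γ t 1 ^ 2 + C * γ t 2 ^ 2) (t₀ := 0)
    (d := δ ^ 2 / 2) hc0
    (fun t _ => ((hγ.deriv1 t).pow 2).add (((hγ.deriv2 t).pow 2).const_mul C))
    (fun t _ => by positivity)
    (fun t _ hlt => by
      obtain ⟨h1, h2, h3, -⟩ := hball (γ t) (mem_ball_of_norm_sq_lt hδ ((hle t).trans_lt
        (by linarith)))
      set H := cdkH a b (γ t)
      set G := cdkG a b (γ t)
      set K := cdkK b (γ t)
      set v := γ t 1
      set w := γ t 2
      have i1 := mul_le_mul_of_nonneg_right h1.le (sq_nonneg v)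
      have i2 := mul_le_mul_of_nonneg_right h2.le (sq_nonneg w)
      have i3 := mul_le_mul_of_nonneg_right h3.le (sq_nonneg w)
      have i4 := mul_le_mul_of_nonneg_left i2 (by linarith : 0 ≤ C)
      refine le_of_mul_le_mul_left ?_ hc0
      have i5 := mul_le_mul_of_nonneg_left i1 hc0.le
      have i6 := mul_le_mul_of_nonneg_left i4 hc0.le
      have i7 := sq_nonneg (c * v + K * w)
      have i8 : c ^ 2 * C * w ^ 2 = (c ^ 2 + B) * w ^ 2 := by rw [hCc]
      have i9 : 0 ≤ c ^ 2 * w ^ 2 := by positivity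
      norm_num
      linarith)
    (by
      have h1 := norm_sq_lt_of_mem_ball h0
      rw [norm_sq_E3] at h1
      simp [hp] at h1
      have h2 : C * (δ / (2 * C)) ^ 2 ≤ δ ^ 2 / 2 := by
        rw [div_pow, mul_pow, ← mul_div_assoc, div_le_div_iff₀ (by positivity) (by norm_num)]
        have : 0 ≤ C * (δ ^ 2 * (C - 1)) := by
          have := sub_nonneg.2 hC1
          positivity
        nlinarith
      have h3 := mul_lt_mul_of_pos_left h1 (by linarith : 0 < C)
      have h4 := mul_le_mul_of_nonneg_right hC1 (sq_nonneg (γ 0 1))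
      have h5 : 0 ≤ C * (γ 0 0 - 1) ^ 2 := by positivity
      linarith)
  have hlim : Tendsto γ atBot (𝓝 p) :=
    tendsto_of_norm_sq_le (Eventually.of_forall hle) (by simpa using htrap.2.const_mul 2)
  refine ⟨hlim, ?_⟩
  by_cases hw : γ 0 2 = 0
  · have hw' := eq_zero_of_linear hγ.continuous_G hγ.deriv2 hw
    have hv : γ 0 1 ≠ 0 := fun hv => hne (eq_x_of_coords (hγ.1 0) hv hw (hu 0))
    have hv' := ne_zero_of_linear hγ.continuous_H (hγ.deriv1_equator hw') hv
    refine direction_x hγ.1 hlim (k := fun t => γ t 1) (α := 1) (β := 0) (by simp) ?_ ?_ ?_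
    · exact (sign_of_linear hγ.continuous_H (hγ.deriv1_equator hw') hv).imp
        Eventually.of_forall Eventually.of_forall
    · exact tendsto_const_nhds.congr fun t => (div_self (hv' t)).symm
    · simp [hw']
  · have hw' := ne_zero_of_linear hγ.continuous_G hγ.deriv2 hw
    have hws := sign_of_linear hγ.continuous_G hγ.deriv2 hw
    have hvw : ∀ t, γ t 1 = γ t 1 / γ t 2 * γ t 2 := fun t => (div_mul_cancel₀ _ (hw' t)).symm
    -- If v/w blows up, v is the dominant coordinate and the direction is equatorial; if v/w
    -- converges, the direction is that of ((b - 1)/b, 1) in the (v, w)-plane.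
    have hblow : (∀ᶠ t in atBot, 0 < γ t 1) ∨ (∀ᶠ t in atBot, γ t 1 < 0) →
        Tendsto (fun t => (γ t 1 / γ t 2)⁻¹) atBot (𝓝 0) →
        ∃ w : E3, Tendsto (fun t => ‖γ t - p‖⁻¹ • (γ t - p)) atBot (𝓝 w) ∧ w ≠ 0 := by
      intro hs hy
      refine direction_x hγ.1 hlim (k := fun t => γ t 1) (α := 1) (β := 0) (by simp) hs ?_ ?_
      · have hne : ∀ᶠ t in atBot, γ t 1 ≠ 0 := by
          rcases hs with hs | hs
          · exact hs.mono fun t => ne_of_gt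
          · exact hs.mono fun t => ne_of_lt
        refine tendsto_const_nhds.congr' ?_
        filter_upwards [hne] with t ht
        exact (div_self ht).symm
      · simpa only [inv_div] using hy
    rcases hγ.dichotomy_x hb hlim hw' with h | h | h
    · refine direction_x hγ.1 hlim (k := fun t => γ t 2) (α := (b - 1) / b) (β := 1) (by simp)
        (hws.imp Eventually.of_forall Eventually.of_forall) h ?_
      exact tendsto_const_nhds.congr fun t => (div_self (hw' t)).symm
    · refine hblow (hws.imp (fun hs => ?_) fun hs => ?_) (tendsto_inv_atTop_zero.comp h)
      · filter_upwards [h.eventually_gt_atTop 0] with t ht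
        rw [hvw]; exact mul_pos ht (hs t)
      · filter_upwards [h.eventually_gt_atTop 0] with t ht
        rw [hvw]; exact mul_neg_of_pos_of_neg ht (hs t)
    · refine hblow (hws.symm.imp (fun hs => ?_) fun hs => ?_) (tendsto_inv_atBot_zero.comp h)
      · filter_upwards [h.eventually_lt_atBot 0] with t ht
        rw [hvw]; exact mul_pos_of_neg_of_neg ht (hs t)
      · filter_upwards [h.eventually_lt_atBot 0] with t ht
        rw [hvw]; exact mul_neg_of_neg_of_pos ht (hs t)

end PoleX

/-! ### Saddle at (1,0,0) for a < b -/

section SaddleX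

variable {a b : ℝ} {γ : ℝ → E3}

lemma IsTrajectory.continuous_apply {V : E3 → E3} (h : IsTrajectory V γ) (i : Fin 3) :
    Continuous fun t => γ t i :=
  continuous_iff_continuousAt.2 fun t => (h.hasDerivAt_apply i t).continuousAt

lemma IsTrajectory.tendsto_ratio_vu (hab : a < b) (h : IsTrajectory (cdkField a b) γ)
    (h2 : ∀ t, γ t 2 = 0) (h0 : ∀ t, 0 < γ t 0) :
    Tendsto (fun t => γ t 1 / γ t 0) atTop (𝓝 0) :=
  tendsto_atTop_zero_of_le (c := b - a) (T := 0) (by linarith)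
    (fun t _ => h.deriv_ratio_vu h2 (h0 t).ne') fun t _ => by ring_nf; exact le_rfl

/-- Trajectories in the open half equator around `(1, 0, 0)` are incoming if `a < b`. -/
lemma IsTrajectory.tendsto_x_of_equator (hab : a < b) (h : IsTrajectory (cdkField a b) γ)
    (h2 : ∀ t, γ t 2 = 0) (h0 : ∀ t, 0 < γ t 0) : Tendsto γ atTop (𝓝 !₂[1, 0, 0]) := by
  refine tendsto_x h.1 (Eventually.of_forall fun t => (h0 t).le) ?_ (by simp [h2])
  refine squeeze_zero_norm (fun t => ?_) (tendsto_zero_iff_abs_tendsto_zero _ |>.1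
    (h.tendsto_ratio_vu hab h2 h0))
  have h3 := (abs_le.1 (h.abs_le_one 0 t)).2
  simp only [Function.comp, abs_div, abs_of_pos (h0 t), Real.norm_eq_abs]
  exact le_div_self (abs_nonneg _) (h0 t) h3

lemma IsTrajectory.pos_of_tendsto_x {l : Filter ℝ} [l.NeBot]
    (h : IsTrajectory (cdkField a b) γ) (hl : Tendsto γ l (𝓝 !₂[1, 0, 0])) (t : ℝ) :
    0 < γ t 0 := by
  obtain ⟨s, hs⟩ := ((tendsto_apply_E3 hl 0).eventually_const_lt (u := 0) (by simp)).exists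
  exact pos_of_linear h.continuous_F h.deriv0 hs t

lemma IsTrajectory.incoming_x (ha : 0 < a) (h : IsTrajectory (cdkField a b) γ)
    (hl : Tendsto γ atTop (𝓝 !₂[1, 0, 0])) : ∀ t, γ t 2 = 0 := by
  have hG : ∀ᶠ t in atTop, a / 2 < cdkG a b (γ t) :=
    (((continuous_cdkG a b).tendsto _).comp hl).eventually_const_lt (by rw [cdkG_x]; linarith)
  obtain ⟨T, hT⟩ := eventually_atTop.1 hG
  have h2T : γ T 2 = 0 := eq_zero_of_growth_atTop (half_pos ha) (fun t _ => h.deriv2 t)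
    (fun t ht => by
      have := mul_le_mul_of_nonneg_right (hT t ht).le (sq_nonneg (γ t 2))
      linarith) (fun t _ => h.abs_le_one 2 t)
  exact eq_zero_of_linear h.continuous_G h.deriv2 h2T

/-- A point of the sphere with `z₁ > 0` is determined by `z₂ / z₁` and `z₃ / z₁`. -/
lemma eq_of_ratios {z z' : E3} (hz : z ∈ Metric.sphere (0 : E3) 1)
    (hz' : z' ∈ Metric.sphere (0 : E3) 1) (h0 : 0 < z 0) (h0' : 0 < z' 0) {m n : ℝ}
    (h1 : z 1 = m * z 0) (h1' : z' 1 = m * z' 0) (h2 : z 2 = n * z 0) (h2' : z' 2 = n * z' 0) :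
    z = z' := by
  have q := mem_sphere_E3.1 hz
  have q' := mem_sphere_E3.1 hz'
  rw [h1, h2] at q
  rw [h1', h2'] at q'
  have h : z 0 = z' 0 := by
    rw [← sq_eq_sq₀ h0.le h0'.le]
    have hm : 0 < 1 + m ^ 2 + n ^ 2 := by positivity
    refine mul_left_cancel₀ hm.ne' ?_
    linear_combination q - q'
  ext i
  fin_cases i
  · exact h
  · simp only [Fin.mk_one]; rw [h1, h1', h]
  · simp only [Fin.reduceFinMk]; rw [h2, h2', h]

lemma ncard_incoming_x (ha : 0 < a) (hab : a < b) :
    {O | IsIncomingOrbit (cdkField a b) !₂[1, 0, 0] O}.ncard = 2 := by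
  refine ncard_orbits_eq_two (contDiff_cdkField a b) (l := atTop) (k := 1) (by simp) ?_ ?_ ?_
  · intro σ hσ
    obtain ⟨Φ, hΦ, -⟩ := exists_cdk_flow a b
    obtain ⟨hγ, h0⟩ := hΦ !₂[4 / 5, σ * (3 / 5), 0] (mem_sphere_E3.2 (by
      simp [mul_pow, hσ]; norm_num))
    have h2 := eq_zero_of_linear hγ.continuous_G hγ.deriv2 (t₀ := 0) (by rw [h0]; simp)
    have h1 := pos_of_linear hγ.continuous_F hγ.deriv0 (t₀ := 0) (by rw [h0]; simp)
    refine ⟨_, hγ, hγ.tendsto_x_of_equator hab h2 h1, ?_⟩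
    rw [h0]
    simp
    nlinarith
  · intro γ hγ hl hr t h1
    exact hγ.ne_of_range_ne (contDiff_cdkField a b) (cdkField_x a b) hr t
      (eq_x_of_coords (hγ.1 t) h1 (hγ.incoming_x ha hl t) (hγ.pos_of_tendsto_x hl t))
  · intro γ₁ γ₂ hγ₁ hγ₂ hl₁ hl₂ hr₁ hr₂ hpos
    have w₁ := hγ₁.incoming_x ha hl₁
    have w₂ := hγ₂.incoming_x ha hl₂
    have u₁ := hγ₁.pos_of_tendsto_x hl₁
    have u₂ := hγ₂.pos_of_tendsto_x hl₂
    have hv := mul_pos_of_linear hγ₁.continuous_H hγ₂.continuous_H (hγ₁.deriv1_equator w₁)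
      (hγ₂.deriv1_equator w₂) hpos
    have n₁ : ∀ t, γ₁ t 1 ≠ 0 := fun t h => by have := hv t 0; simp [h] at this
    have n₂ : ∀ t, γ₂ t 1 ≠ 0 := fun t h => by have := hv 0 t; simp [h] at this
    obtain ⟨s, t, hst⟩ := exists_common_sq
      ((hγ₁.continuous_apply 1).div (hγ₁.continuous_apply 0) fun t => (u₁ t).ne')
      ((hγ₂.continuous_apply 1).div (hγ₂.continuous_apply 0) fun t => (u₂ t).ne')
      (fun t => div_ne_zero (n₁ t) (u₁ t).ne') (fun t => div_ne_zero (n₂ t) (u₂ t).ne')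
      (hγ₁.tendsto_ratio_vu hab w₁ u₁) (hγ₂.tendsto_ratio_vu hab w₂ u₂)
    refine ⟨s, t, ?_⟩
    have hr : γ₁ s 1 / γ₁ s 0 = γ₂ t 1 / γ₂ t 0 := by
      refine eq_of_sq_eq_of_mul_pos hst ?_
      rw [div_mul_div_comm]
      exact div_pos (hv s t) (mul_pos (u₁ s) (u₂ t))
    exact eq_of_ratios (hγ₁.1 s) (hγ₂.1 t) (u₁ s) (u₂ t) (m := γ₁ s 1 / γ₁ s 0) (n := 0)
      (div_mul_cancel₀ _ (u₁ s).ne').symm (by rw [hr, div_mul_cancel₀ _ (u₂ t).ne'])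
      (by simp [w₁]) (by simp [w₂])

/-- On the equator v' = H v with H close to a - b < 0, so no nonconstant orbit there can leave the
point. -/
lemma IsTrajectory.outgoing_x_ne (hab : a < b) (h : IsTrajectory (cdkField a b) γ)
    (hl : Tendsto γ atBot (𝓝 !₂[1, 0, 0])) (hr : Set.range γ ≠ {!₂[1, 0, 0]}) (t : ℝ) :
    γ t 2 ≠ 0 := by
  intro h2
  have h2' := eq_zero_of_linear h.continuous_G h.deriv2 h2
  have hH : ∀ᶠ t in atBot, cdkH a b (γ t) < -((b - a) / 2) :=
    (((continuous_cdkH a b).tendsto _).comp hl).eventually_lt_const (by rw [cdkH_x]; linarith)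
  obtain ⟨T, hT⟩ := eventually_atBot.1 hH
  have h1 : γ T 1 = 0 := eq_zero_of_growth_atBot (half_pos (sub_pos.2 hab))
    (fun t _ => h.deriv1_equator h2' t)
    (fun t ht => by
      have := mul_le_mul_of_nonneg_right (hT t ht).le (sq_nonneg (γ t 1))
      linarith) (fun t _ => h.abs_le_one 1 t)
  exact h.ne_of_range_ne (contDiff_cdkField a b) (cdkField_x a b) hr T
    (eq_x_of_coords (h.1 T) h1 (h2' T) (h.pos_of_tendsto_x hl T))

/-- A blow-up of v/w is excluded: then w/v → 0, the growth rate H + K w/v of v tends to a - b < 0,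
and v would be unbounded in backward time. -/
lemma IsTrajectory.outgoing_x_ratio (hb : 0 < b) (hab : a < b)
    (h : IsTrajectory (cdkField a b) γ) (hl : Tendsto γ atBot (𝓝 !₂[1, 0, 0]))
    (h2 : ∀ t, γ t 2 ≠ 0) : Tendsto (fun t => γ t 1 / γ t 2) atBot (𝓝 ((b - 1) / b)) := by
  have hno : Tendsto (fun t => (γ t 1 / γ t 2)⁻¹) atBot (𝓝 0) →
      (∀ᶠ t in atBot, γ t 1 / γ t 2 ≠ 0) → False := by
    intro hi hne
    have hH : Tendsto (fun t => cdkH a b (γ t) + cdkK b (γ t) * (γ t 1 / γ t 2)⁻¹) atBot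
        (𝓝 (a - b)) := by
      have := (((continuous_cdkH a b).tendsto _).comp hl).add
        ((((continuous_cdkK b).tendsto _).comp hl).mul hi)
      simpa [cdkH_x] using this
    obtain ⟨T, hT⟩ := eventually_atBot.1
      ((hH.eventually_lt_const (show a - b < -((b - a) / 2) by linarith)).and hne)
    have h1 : γ T 1 = 0 := eq_zero_of_growth_atBot (half_pos (sub_pos.2 hab))
      (fun t _ => h.deriv1 t)
      (fun t ht => by
        obtain ⟨i1, i2⟩ := hT t ht
        have := mul_le_mul_of_nonneg_right i1.le (sq_nonneg (γ t 1))
        have hv : γ t 1 ≠ 0 := fun hv => i2 (by simp [hv])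
        have e : (γ t 1 / γ t 2)⁻¹ * γ t 1 ^ 2 = γ t 2 * γ t 1 := by
          have := h2 t
          field_simp
        have e2 := congrArg (fun x => cdkK b (γ t) * x) e
        simp only at e2
        linarith) (fun t _ => h.abs_le_one 1 t)
    exact (hT T le_rfl).2 (by simp [h1])
  rcases h.dichotomy_x hb hl h2 with h | h | h
  · exact h
  · exact (hno (tendsto_inv_atTop_zero.comp h)
      ((h.eventually_gt_atTop 0).mono fun t => ne_of_gt)).elim
  · exact (hno (tendsto_inv_atBot_zero.comp h)
      ((h.eventually_lt_atBot 0).mono fun t => ne_of_lt)).elim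

/-- In the coordinates `y = z₂ / z₃` and `x = log |z₃ / z₁|`, an outgoing trajectory is the graph
of a solution of a scalar differential equation. -/
lemma IsTrajectory.exists_graph (ha : 0 < a) (hb : 0 < b) (h : IsTrajectory (cdkField a b) γ)
    (hl : Tendsto γ atBot (𝓝 !₂[1, 0, 0])) (h2 : ∀ t, γ t 2 ≠ 0)
    (hy : Tendsto (fun t => γ t 1 / γ t 2) atBot (𝓝 ((b - 1) / b))) :
    ∃ (X : ℝ) (g Y : ℝ → ℝ), Tendsto Y atBot (𝓝 ((b - 1) / b)) ∧ ∀ x < X,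
      (γ (g x) 2 / γ (g x) 0) ^ 2 = Real.exp (2 * x) ∧ γ (g x) 1 = Y x * γ (g x) 2 ∧
      HasDerivAt Y
        ((-(1 + Y x ^ 2 * Real.exp (2 * x)) * (b * Y x - (b - 1)) +
            Y x ^ 2 * Real.exp (2 * x)) /
          (a * (1 + Y x ^ 2 * Real.exp (2 * x)) - Y x * Real.exp (2 * x))) x := by
  have h0 := h.pos_of_tendsto_x hl
  have hcont : Continuous fun z : E3 => a * (z 0 ^ 2 + z 1 ^ 2) - z 2 * z 1 := by fun_prop
  obtain ⟨T, hT⟩ := eventually_atBot.1 (((hcont.tendsto _).comp hl).eventually_const_lt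
    (show a / 2 < _ by simp; linarith))
  -- `Real.log` is the logarithm of the absolute value, so both hemispheres are covered. The
  -- derivative exceeds a/2 for t ≤ T, which makes log |w/u| an admissible new time.
  have hL : ∀ t, HasDerivAt (fun t => Real.log (γ t 2 / γ t 0))
      (a * (γ t 0 ^ 2 + γ t 1 ^ 2) - γ t 2 * γ t 1) t := fun t => by
    have hne : γ t 2 / γ t 0 ≠ 0 := div_ne_zero (h2 t) (h0 t).ne'
    refine ((h.deriv_ratio_wu (h0 t).ne').log hne).congr_deriv ?_
    exact mul_div_cancel_right₀ _ hne
  obtain ⟨g, hg1, hg2, hg3⟩ := exists_inverse_of_deriv_ge (half_pos ha) (fun t (_ : t ≤ T) => hL t)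
    fun t ht => (hT t ht).le
  refine ⟨Real.log (γ T 2 / γ T 0), g, fun x => γ (g x) 1 / γ (g x) 2, hy.comp hg3,
    fun x hx => ?_⟩
  obtain ⟨hgT, hgx⟩ := hg1 x hx.le
  set t := g x with ht
  have hne : γ t 2 / γ t 0 ≠ 0 := div_ne_zero (h2 t) (h0 t).ne'
  have hω : (γ t 2 / γ t 0) ^ 2 = Real.exp (2 * x) := by
    rw [← hgx, two_mul, Real.exp_add, Real.exp_log_eq_abs hne, ← sq, sq_abs]
  refine ⟨hω, (div_mul_cancel₀ _ (h2 t)).symm, ?_⟩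
  have hY : HasDerivAt (fun t => γ t 1 / γ t 2)
      (-(b * (γ t 0 ^ 2 + γ t 1 ^ 2)) * (γ t 1 / γ t 2 - (b - 1) / b) + γ t 1 ^ 2) t := by
    simpa using (h.deriv_ratio_vw hb.ne' (h2 t)).add_const ((b - 1) / b)
  have hpos : a * (γ t 0 ^ 2 + γ t 1 ^ 2) - γ t 2 * γ t 1 ≠ 0 := by
    have := hT t hgT
    simp only [Function.comp] at this
    linarith
  refine (hY.comp x (hg2 x hx)).congr_deriv ?_
  simp only
  rw [← ht, ← hω]
  have i2 := h2 t
  have i0 := (h0 t).ne'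
  have hpos' : a * (1 + (γ t 1 / γ t 2) ^ 2 * (γ t 2 / γ t 0) ^ 2) -
      γ t 1 / γ t 2 * (γ t 2 / γ t 0) ^ 2 ≠ 0 := by
    have e : a * (1 + (γ t 1 / γ t 2) ^ 2 * (γ t 2 / γ t 0) ^ 2) -
      γ t 1 / γ t 2 * (γ t 2 / γ t 0) ^ 2 =
      (a * (γ t 0 ^ 2 + γ t 1 ^ 2) - γ t 2 * γ t 1) / γ t 0 ^ 2 := by
      field_simp
    rw [e]
    positivity
  rw [← div_eq_mul_inv, div_eq_div_iff hpos hpos']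
  field_simp

/-- The cross-multiplied difference of the two slopes, with ω = exp(2x). The factor beside y - z is
-ab + O(ω) for bounded y and z, hence negative as x → -∞. -/
lemma graph_difference_identity (a b ω y z : ℝ) :
    (-(1 + y ^ 2 * ω) * (b * y - (b - 1)) + y ^ 2 * ω) * (a * (1 + z ^ 2 * ω) - z * ω) -
      (a * (1 + y ^ 2 * ω) - y * ω) * (-(1 + z ^ 2 * ω) * (b * z - (b - 1)) + z ^ 2 * ω) =
    (y - z) * (-a * b + ω * ((b - 1) + a * (y + z) - a * b * (y ^ 2 + y * z + z ^ 2) +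
      (a * b - b * ω) * (y * z) + b * ω * (y * z) * (y + z) - a * b * ω * (y * z) ^ 2)) := by
  ring

/-- Uniqueness of the outgoing orbit on each side: near x = -∞ the two graphs approach each other as
x increases, yet both start from the limit (b - 1)/b. -/
lemma exists_common_point_x (ha : 0 < a) (hb : 0 < b) (hab : a < b) {γ₁ γ₂ : ℝ → E3}
    (h₁ : IsTrajectory (cdkField a b) γ₁) (h₂ : IsTrajectory (cdkField a b) γ₂)
    (l₁ : Tendsto γ₁ atBot (𝓝 !₂[1, 0, 0])) (l₂ : Tendsto γ₂ atBot (𝓝 !₂[1, 0, 0]))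
    (hpos : 0 < γ₁ 0 2 * γ₂ 0 2) : ∃ s t, γ₁ s = γ₂ t := by
  have hw := mul_pos_of_linear h₁.continuous_G h₂.continuous_G h₁.deriv2 h₂.deriv2 hpos
  have n₁ : ∀ t, γ₁ t 2 ≠ 0 := fun t h => by have := hw t 0; simp [h] at this
  have n₂ : ∀ t, γ₂ t 2 ≠ 0 := fun t h => by have := hw 0 t; simp [h] at this
  have u₁ := h₁.pos_of_tendsto_x l₁
  have u₂ := h₂.pos_of_tendsto_x l₂
  obtain ⟨X₁, g₁, Y₁, t₁, d₁⟩ := h₁.exists_graph ha hb l₁ n₁ (h₁.outgoing_x_ratio hb hab l₁ n₁)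
  obtain ⟨X₂, g₂, Y₂, t₂, d₂⟩ := h₂.exists_graph ha hb l₂ n₂ (h₂.outgoing_x_ratio hb hab l₂ n₂)
  have hexp : Tendsto (fun x : ℝ => Real.exp (2 * x)) atBot (𝓝 0) :=
    Real.tendsto_exp_atBot.comp (tendsto_id.const_mul_atBot two_pos)
  have hβ : ∀ {Y : ℝ → ℝ}, Tendsto Y atBot (𝓝 ((b - 1) / b)) → ∀ᶠ x in atBot,
      0 < a * (1 + Y x ^ 2 * Real.exp (2 * x)) - Y x * Real.exp (2 * x) := fun hY => by
    have := ((((hY.pow 2).mul hexp).const_add 1).const_mul a).sub (hY.mul hexp)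
    exact this.eventually_const_lt (by simpa using ha)
  have hq : ∀ᶠ x in atBot, -a * b + Real.exp (2 * x) * ((b - 1) + a * (Y₁ x + Y₂ x) -
      a * b * (Y₁ x ^ 2 + Y₁ x * Y₂ x + Y₂ x ^ 2) +
      (a * b - b * Real.exp (2 * x)) * (Y₁ x * Y₂ x) +
      b * Real.exp (2 * x) * (Y₁ x * Y₂ x) * (Y₁ x + Y₂ x) -
      a * b * Real.exp (2 * x) * (Y₁ x * Y₂ x) ^ 2) < 0 := by
    have hY := t₁.mul t₂
    have hS := t₁.add t₂
    have := ((hexp.mul (((((hS.const_mul a).const_add (b - 1)).sub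
      ((((t₁.pow 2).add hY).add (t₂.pow 2)).const_mul (a * b))).add
      ((((hexp.const_mul b).const_sub (a * b))).mul hY)).add
      (((hexp.const_mul b).mul hY).mul hS) |>.sub
      ((hexp.const_mul (a * b)).mul (hY.pow 2)))).const_add (-a * b))
    exact this.eventually_lt_const (by simpa using mul_pos ha hb)
  obtain ⟨X, hX⟩ := eventually_atBot.1 ((hβ t₁).and ((hβ t₂).and (hq.and
    ((eventually_lt_atBot X₁).and (eventually_lt_atBot X₂)))))
  -- The derivative of (Y₁ - Y₂)² is nonpositive up to X, so |Y₁ - Y₂| at X is at most its limit 0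
  -- at -∞.
  have hD : Y₁ X - Y₂ X = 0 := by
    have hlim : Tendsto (fun x => |Y₁ x - Y₂ x|) atBot (𝓝 0) := by
      simpa using (t₁.sub t₂).abs
    have hle : ∀ᶠ x in atBot, |Y₁ X - Y₂ X| ≤ |Y₁ x - Y₂ x| := by
      filter_upwards [eventually_le_atBot X] with x hx
      have := abs_le_mul_exp (f := fun x => Y₁ x - Y₂ x) (c := 0) hx
        (fun τ hτ => by
          obtain ⟨-, -, -, i1, i2⟩ := hX τ hτ.2
          exact (d₁ τ i1).2.2.sub (d₂ τ i2).2.2)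
        (fun τ hτ => by
          obtain ⟨i1, i2, i3, -, -⟩ := hX τ hτ.2
          rw [div_sub_div _ _ i1.ne' i2.ne', graph_difference_identity, zero_mul, ← mul_div_assoc,
            ← mul_assoc]
          exact div_nonpos_of_nonpos_of_nonneg
            (mul_nonpos_of_nonneg_of_nonpos (mul_self_nonneg _) i3.le) (mul_pos i1 i2).le)
      simpa using this
    exact abs_nonpos_iff.1 (ge_of_tendsto hlim hle)
  obtain ⟨-, -, -, i1, i2⟩ := hX X le_rfl
  obtain ⟨e₁, f₁, -⟩ := d₁ X i1
  obtain ⟨e₂, f₂, -⟩ := d₂ X i2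
  refine ⟨g₁ X, g₂ X, ?_⟩
  set s := g₁ X
  set t := g₂ X
  have hW : γ₁ s 2 / γ₁ s 0 = γ₂ t 2 / γ₂ t 0 := by
    refine eq_of_sq_eq_of_mul_pos (e₁.trans e₂.symm) ?_
    rw [div_mul_div_comm]
    exact div_pos (hw s t) (mul_pos (u₁ s) (u₂ t))
  have k₁ : γ₁ s 2 = γ₁ s 2 / γ₁ s 0 * γ₁ s 0 := (div_mul_cancel₀ _ (u₁ s).ne').symm
  have k₂ : γ₂ t 2 = γ₁ s 2 / γ₁ s 0 * γ₂ t 0 := by rw [hW, div_mul_cancel₀ _ (u₂ t).ne']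
  refine eq_of_ratios (h₁.1 s) (h₂.1 t) (u₁ s) (u₂ t) (m := Y₁ X * (γ₁ s 2 / γ₁ s 0)) ?_ ?_ k₁ k₂
  · rw [f₁, mul_assoc, ← k₁]
  · rw [f₂, mul_assoc, ← k₂, sub_eq_zero.1 hD]

/-- A shooting argument: some trajectory stays in the strip `0 ≤ y - (b - 1) / b ≤ 1 / b` for all
negative times. -/
lemma exists_trapped_trajectory (hb : 0 < b) {r : ℝ} (hr : r ≠ 0) :
    ∃ γ, IsTrajectory (cdkField a b) γ ∧ γ 0 2 ^ 2 ≤ r ^ 2 ∧ 0 < r * γ 0 2 ∧ 0 < γ 0 0 ∧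
      ∀ t ≤ 0, 0 ≤ γ t 1 / γ t 2 - (b - 1) / b ∧ γ t 1 / γ t 2 - (b - 1) / b ≤ 1 / b := by
  obtain ⟨Φ, hΦ, hcont⟩ := exists_cdk_flow a b
  have hN : ∀ s : ℝ, 0 < 1 + r ^ 2 + (s * r) ^ 2 := fun s => by positivity
  -- The initial points have w/u = r and v/w = s; the parameter s is the one to be shot with, and
  -- the sign of r chooses the hemisphere.
  set q : ℝ → E3 := fun s => (√(1 + r ^ 2 + (s * r) ^ 2))⁻¹ • !₂[1, s * r, r] with hq
  have hqc : Continuous q := by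
    refine Continuous.smul (Continuous.inv₀ (by fun_prop) fun s => (Real.sqrt_pos.2 (hN s)).ne') ?_
    refine (PiLp.continuous_toLp 2 fun _ : Fin 3 => ℝ).comp (continuous_pi fun i => ?_)
    fin_cases i <;> simp <;> fun_prop
  have hq0 : ∀ s, q s 0 = (√(1 + r ^ 2 + (s * r) ^ 2))⁻¹ := fun s => by simp [hq]
  have hq1 : ∀ s, q s 1 = (√(1 + r ^ 2 + (s * r) ^ 2))⁻¹ * (s * r) := fun s => by simp [hq]
  have hq2 : ∀ s, q s 2 = (√(1 + r ^ 2 + (s * r) ^ 2))⁻¹ * r := fun s => by simp [hq]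
  have hN' : ∀ s, 0 < (√(1 + r ^ 2 + (s * r) ^ 2))⁻¹ := fun s =>
    inv_pos.2 (Real.sqrt_pos.2 (hN s))
  have hqs : ∀ s, q s ∈ Metric.sphere (0 : E3) 1 := fun s => by
    have h1 := Real.sq_sqrt (hN s).le
    have h2 := (Real.sqrt_pos.2 (hN s)).ne'
    rw [mem_sphere_E3, hq0, hq1, hq2]
    generalize √(1 + r ^ 2 + (s * r) ^ 2) = m at h1 h2
    field_simp
    linear_combination -h1
  have htr : ∀ s, IsTrajectory (cdkField a b) (Φ (q s)) := fun s => (hΦ _ (hqs s)).1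
  have h00 : ∀ s, Φ (q s) 0 = q s := fun s => (hΦ _ (hqs s)).2
  have hw : ∀ s t, Φ (q s) t 2 ≠ 0 := fun s =>
    ne_zero_of_linear (htr s).continuous_G (htr s).deriv2 (t₀ := 0) (by
      rw [h00, hq2]; exact mul_ne_zero (hN' s).ne' hr)
  set η : ℝ → ℝ → ℝ := fun s t => Φ (q s) t 1 / Φ (q s) t 2 - (b - 1) / b with hη
  have hηc : ∀ t, Continuous fun s => η s t := fun t => by
    have hc : Continuous fun s => Φ (q s) t := (hcont t).comp_continuous hqc hqs
    have hc' : ∀ i, Continuous fun s => Φ (q s) t i := fun i =>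
      (EuclideanSpace.proj i : E3 →L[ℝ] ℝ).continuous.comp hc
    exact ((hc' 1).div (hc' 2) fun s => hw s t).sub continuous_const
  have hη0 : ∀ s, η s 0 = s - (b - 1) / b := fun s => by
    have := (hN' s).ne'
    simp only [hη, h00, hq1, hq2]
    congr 1
    field_simp
  have hρc : ∀ s, Continuous fun t => -(b * (Φ (q s) t 0 ^ 2 + Φ (q s) t 1 ^ 2)) := fun s =>
    (continuous_const.mul ((((htr s).continuous_apply 0).pow 2).add
      (((htr s).continuous_apply 1).pow 2))).neg
  have hlow : ∀ s t₀ t, t ≤ t₀ → η s t₀ < 0 → η s t < 0 := fun s t₀ t ht h =>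
    neg_backward (hρc s) (fun t => (htr s).deriv_ratio_vw hb.ne' (hw s t))
      (fun t => sq_nonneg _) h ht
  -- The deviation 1/b - η obeys the same linear equation with forcing u² instead of v². Both edges
  -- of the strip are therefore one-way in backward time.
  have hup : ∀ s t₀ t, t ≤ t₀ → 1 / b < η s t₀ → 1 / b < η s t := fun s t₀ t ht h => by
    have := neg_backward (f := fun t => 1 / b - η s t) (e := fun t => Φ (q s) t 0 ^ 2) (hρc s)
      (fun t => (((htr s).deriv_ratio_vw hb.ne' (hw s t)).const_sub (1 / b)).congr_deriv (by
        simp only [hη]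
        field_simp
        ring))
      (fun t => sq_nonneg _) (sub_neg.2 h) ht
    exact sub_neg.1 this
  -- Otherwise the parameters leaving below and those leaving above form two open nonempty sets
  -- covering ℝ. They are disjoint because each exit is irreversible, which contradicts
  -- connectedness.
  obtain ⟨s, hs⟩ : ∃ s, ∀ t ≤ 0, 0 ≤ η s t ∧ η s t ≤ 1 / b := by
    by_contra! hcon
    have hA : IsOpen (⋃ t ∈ Set.Iic (0 : ℝ), {s | η s t < 0}) :=
      isOpen_biUnion fun t _ => isOpen_lt (hηc t) continuous_const
    have hB : IsOpen (⋃ t ∈ Set.Iic (0 : ℝ), {s | 1 / b < η s t}) :=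
      isOpen_biUnion fun t _ => isOpen_lt continuous_const (hηc t)
    obtain ⟨s, -, h1, h2⟩ := isPreconnected_univ _ _ hA hB (fun s _ => by
        obtain ⟨t, ht, h⟩ := hcon s
        by_cases h0 : 0 ≤ η s t
        · exact Or.inr (Set.mem_biUnion ht (h h0))
        · exact Or.inl (Set.mem_biUnion ht (not_le.1 h0)))
      ⟨(b - 1) / b - 1, trivial, Set.mem_biUnion Set.self_mem_Iic (by
        simp only [Set.mem_ofPred_eq, hη0]; linarith)⟩
      ⟨(b - 1) / b + 1 / b + 1, trivial, Set.mem_biUnion Set.self_mem_Iic (by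
        simp only [Set.mem_ofPred_eq, hη0]; linarith)⟩
    simp only [Set.mem_iUnion, Set.mem_ofPred_eq] at h1 h2
    obtain ⟨t₁, -, h1⟩ := h1
    obtain ⟨t₂, -, h2⟩ := h2
    have i1 := hlow s t₁ (min t₁ t₂) (min_le_left _ _) h1
    have i2 := hup s t₂ (min t₁ t₂) (min_le_right _ _) h2
    have : 0 < 1 / b := by positivity
    linarith
  refine ⟨Φ (q s), htr s, ?_, ?_, ?_, hs⟩
  · rw [h00, hq2, mul_pow, inv_pow, Real.sq_sqrt (hN s).le]
    refine mul_le_of_le_one_left (sq_nonneg r) (inv_le_one_of_one_le₀ ?_)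
    nlinarith [sq_nonneg r, sq_nonneg (s * r)]
  · rw [h00, hq2, mul_left_comm]
    exact mul_pos (hN' s) (mul_self_pos.2 hr)
  · rw [h00, hq0]
    exact hN' s

lemma exists_outgoing_x (ha : 0 < a) (hb : 0 < b) {σ : ℝ} (hσ : σ ^ 2 = 1) :
    ∃ γ, IsTrajectory (cdkField a b) γ ∧ Tendsto γ atBot (𝓝 !₂[1, 0, 0]) ∧ 0 < σ * γ 0 2 := by
  have hev : ∀ᶠ z in 𝓝 (!₂[1, 0, 0] : E3), a / 2 < cdkG a b z :=
    ((continuous_cdkG a b).tendsto _).eventually_const_lt (by rw [cdkG_x]; linarith)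
  obtain ⟨δ, hδ, hball⟩ := Metric.eventually_nhds_iff_ball.1 hev
  -- M bounds |v/w| on the strip, so the squared distance to the point is at most 2(M² + 1)w²; d is
  -- chosen so that w² < d keeps the orbit in the δ-ball.
  set M := |(b - 1) / b| + 1 / b with hM
  set d := δ ^ 2 / (2 * (M ^ 2 + 1)) with hd
  have hd0 : 0 < d := by positivity
  have hε : √(d / 2) ^ 2 = d / 2 := Real.sq_sqrt (by positivity)
  have hε0 : 0 < √(d / 2) := Real.sqrt_pos.2 (by positivity)
  have hσ0 : σ ≠ 0 := fun h => by simp [h] at hσ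
  obtain ⟨γ, hγ, h1, h2, h3, h4⟩ := exists_trapped_trajectory (a := a) hb
    (mul_ne_zero hσ0 hε0.ne')
  have hu := pos_of_linear hγ.continuous_F hγ.deriv0 h3
  have hw0 : γ 0 2 ≠ 0 := fun h => by simp [h] at h2
  have hw := ne_zero_of_linear hγ.continuous_G hγ.deriv2 hw0
  have hvw : ∀ t ≤ 0, γ t 1 ^ 2 ≤ M ^ 2 * γ t 2 ^ 2 := fun t ht => by
    obtain ⟨i1, i2⟩ := h4 t ht
    have i3 : |γ t 1 / γ t 2| ≤ M := by
      rw [abs_le, hM]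
      constructor
      · have := neg_abs_le ((b - 1) / b)
        have : 0 < 1 / b := by positivity
        linarith
      · have := le_abs_self ((b - 1) / b)
        linarith
    have i4 : (γ t 1 / γ t 2) ^ 2 ≤ M ^ 2 := sq_le_sq.2 (i3.trans (le_abs_self M))
    rw [div_pow, div_le_iff₀ (by have := hw t; positivity)] at i4
    exact i4
  have htrap := backward_trap (t₀ := 0) (d := d) ha
    (fun t _ => (hγ.deriv2 t).pow 2) (fun t _ => sq_nonneg _)
    (fun t ht hlt => by
      simp only [Pi.pow_apply] at hlt
      rw [hd, lt_div_iff₀ (by positivity)] at hlt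
      have i1 := hball _ (mem_ball_of_norm_sq_lt hδ
        ((norm_sub_x_sq_le (hγ.1 t) (hu t).le).trans_lt (by linarith [hvw t ht])))
      have := mul_le_mul_of_nonneg_right i1.le (sq_nonneg (γ t 2))
      simp only [Pi.pow_apply]
      norm_num
      linarith)
    (by
      simp only [Pi.pow_apply]
      rw [mul_pow, hσ, one_mul, hε] at h1
      linarith)
  have hwt : Tendsto (fun t => γ t 2 ^ 2) atBot (𝓝 0) := htrap.2
  refine ⟨γ, hγ, tendsto_x hγ.1 (Eventually.of_forall fun t => (hu t).le)
    (tendsto_zero_of_sq ?_) (tendsto_zero_of_sq hwt), ?_⟩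
  · refine squeeze_zero' (Eventually.of_forall fun t => sq_nonneg _)
      ((eventually_le_atBot 0).mono hvw) ?_
    simpa using hwt.const_mul (M ^ 2)
  · have : 0 < √(d / 2) * (σ * γ 0 2) := by linarith
    exact pos_of_mul_pos_right this hε0.le

theorem isSaddlePoint_x (ha : 0 < a) (hab : a < b) :
    IsSaddlePoint (cdkField a b) !₂[1, 0, 0] := by
  have hb : 0 < b := ha.trans hab
  refine ⟨cdkField_x a b, ⟨a - b, a, by linarith, ha, hasTangentEigenvalues_x a b⟩,
    ncard_incoming_x ha hab, ?_, ?_⟩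
  · exact ncard_orbits_eq_two (contDiff_cdkField a b) (l := atBot) (k := 2) (by simp)
      (fun σ hσ => exists_outgoing_x ha hb hσ)
      (fun γ hγ hl hr => hγ.outgoing_x_ne hab hl hr)
      (fun γ₁ γ₂ h₁ h₂ l₁ l₂ _ _ hpos => exists_common_point_x ha hb hab h₁ h₂ l₁ l₂ hpos)
  set p : E3 := !₂[1, 0, 0] with hp
  have hev : ∀ᶠ z in 𝓝 p,
      cdkH a b z < -((b - a) / 2) ∧ a / 2 < cdkG a b z ∧ 0 < z 0 := by
    refine (((continuous_cdkH a b).tendsto p).eventually_lt_const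
      (by rw [hp, cdkH_x]; linarith)).and
      ((((continuous_cdkG a b).tendsto p).eventually_const_lt
      (by rw [hp, cdkG_x]; linarith)).and ?_)
    have : Continuous fun z : E3 => z 0 := by fun_prop
    exact (this.tendsto p).eventually_const_lt (by simp [hp])
  obtain ⟨δ, hδ, hball⟩ := Metric.eventually_nhds_iff_ball.1 hev
  refine ⟨δ, hδ, fun γ hγ h0 hne => ⟨?_, ?_⟩⟩
  · by_contra! hcon
    obtain ⟨hin, hnot⟩ := hcon
    have hin' : ∀ t ≥ 0, γ t ∈ Metric.ball p δ := fun t ht => by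
      rcases ht.lt_or_eq with ht | rfl
      · exact hin t ht
      · exact h0
    have h2 : γ 0 2 = 0 := eq_zero_of_growth_atTop (half_pos ha) (fun t _ => hγ.deriv2 t)
      (fun t ht => by
        have := mul_le_mul_of_nonneg_right (hball _ (hin' t ht)).2.1.le (sq_nonneg (γ t 2))
        linarith) (fun t _ => hγ.abs_le_one 2 t)
    have h2' := eq_zero_of_linear hγ.continuous_G hγ.deriv2 h2
    have h1 := pos_of_linear hγ.continuous_F hγ.deriv0 (hball _ h0).2.2
    exact hnot ⟨range_ne_singleton hne, γ, hγ, rfl, hγ.tendsto_x_of_equator hab h2' h1⟩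
  · by_contra! hcon
    obtain ⟨hin, hnot⟩ := hcon
    have hin' : ∀ t ≤ 0, γ t ∈ Metric.ball p δ := fun t ht => by
      rcases ht.lt_or_eq with ht | rfl
      · exact hin t ht
      · exact h0
    have hu := pos_of_linear hγ.continuous_F hγ.deriv0 (hball _ h0).2.2
    have hw : Tendsto (fun t => γ t 2) atBot (𝓝 0) :=
      tendsto_atBot_zero_of_le (half_pos ha) (T := 0) (fun t _ => hγ.deriv2 t) fun t ht => by
        have := mul_le_mul_of_nonneg_right (hball _ (hin' t ht)).2.1.le (sq_nonneg (γ t 2))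
        linarith
    have he : Tendsto (fun t => cdkK b (γ t) * γ t 2) atBot (𝓝 0) := by
      refine squeeze_zero_norm (fun t => ?_) (by simpa using hw.abs.const_mul |b - 1|)
      have := hγ.sq_sum t
      rw [cdkK, norm_mul, norm_mul, Real.norm_eq_abs, Real.norm_eq_abs, Real.norm_eq_abs,
        abs_of_nonneg (by positivity : 0 ≤ γ t 0 ^ 2 + γ t 1 ^ 2)]
      gcongr
      exact mul_le_of_le_one_right (abs_nonneg _) (by linarith [sq_nonneg (γ t 2)])
    -- v' = H v + K w is a damped equation with vanishing forcing in backward time; of the three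
    -- alternatives, |v| ≤ 1 leaves only convergence to 0.
    have hv : Tendsto (fun t => γ t 1) atBot (𝓝 0) := by
      rcases backward_dichotomy (half_pos (sub_pos.2 hab)) (f := fun t => γ t 1)
        (ρ := fun t => -cdkH a b (γ t))
        (Eventually.of_forall fun t => (hγ.deriv1 t).congr_deriv (by rw [neg_neg]))
        ((eventually_le_atBot 0).mono fun t ht => by
          linarith [(hball _ (hin' t ht)).1]) he with h | h | h
      · exact h
      · obtain ⟨t, ht⟩ := (h.eventually_gt_atTop 1).exists
        linarith [(abs_le.1 (hγ.abs_le_one 1 t)).2]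
      · obtain ⟨t, ht⟩ := (h.eventually_lt_atBot (-1)).exists
        linarith [(abs_le.1 (hγ.abs_le_one 1 t)).1]
    exact hnot ⟨range_ne_singleton hne, γ, hγ, rfl,
      tendsto_x hγ.1 (Eventually.of_forall fun t => (hu t).le) hv hw⟩

end SaddleX

/-! ### The case a = b: reduction to a field transversal to the equator -/

/-- For `a = b` the field is divisible by `z₃` on the sphere; this is the quotient. -/
noncomputable def reducedField (a : ℝ) (z : E3) : E3 :=
  !₂[z 0 * (z 1 - a * (z 0 ^ 2 + z 1 ^ 2) * (z 2 + z 1)),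
    z 1 ^ 2 - (1 - a) * (z 0 ^ 2 + z 1 ^ 2) - a * (z 0 ^ 2 + z 1 ^ 2) * z 1 * (z 2 + z 1),
    a * (z 0 ^ 2 + z 1 ^ 2) * (z 0 ^ 2 + z 1 ^ 2 - z 1 * z 2)]

lemma contDiff_reducedField (a : ℝ) : ContDiff ℝ 1 (reducedField a) := by
  rw [contDiff_euclidean]
  intro i
  fin_cases i <;> (simp [reducedField]; fun_prop)

lemma exists_reduced_flow (a : ℝ) :
    ∃ Φ : E3 → ℝ → E3,
      (∀ q ∈ Metric.sphere (0 : E3) 1, IsTrajectory (reducedField a) (Φ q) ∧ Φ q 0 = q) ∧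
      ∀ t, ContinuousOn (fun q => Φ q t) (Metric.sphere (0 : E3) 1) :=
  exists_sphere_flow (contDiff_reducedField a)
    (κ := fun z => a * z 1 * (z 0 ^ 2 + z 1 ^ 2)) (by fun_prop) fun z => by
    rw [inner_E3, norm_sq_E3]
    simp [reducedField]
    ring

/-- The terms not visibly divisible by w combine to multiples of 1 - u² - v², which equals w² on the
sphere. -/
lemma cdkField_eq_smul (a : ℝ) {z : E3} (hz : z ∈ Metric.sphere (0 : E3) 1) :
    cdkField a a z = z 2 • reducedField a z := by
  have h := mem_sphere_E3.1 hz
  ext i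
  fin_cases i <;> simp [cdkField, cdkF, cdkH, cdkK, cdkG, reducedField]
  · linear_combination z 0 * a * (z 0 ^ 2 + z 1 ^ 2) * h
  · linear_combination z 1 * a * (z 0 ^ 2 + z 1 ^ 2) * h
  · ring

/-- With σ' = w along γ, both γ and ζ ∘ σ solve the nonautonomous equation ż = w(t) R(z), whose
right-hand side is Lipschitz since |w| ≤ 1; uniqueness identifies them. -/
lemma exists_reparametrization {a : ℝ} {γ ζ : ℝ → E3} (hγ : IsTrajectory (cdkField a a) γ)
    (hζ : IsTrajectory (reducedField a) ζ) {s₀ : ℝ} (h0 : γ 0 = ζ s₀) :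
    ∃ σ : ℝ → ℝ, σ 0 = s₀ ∧ (∀ t, HasDerivAt σ (γ t 2) t) ∧ ∀ t, γ t = ζ (σ t) := by
  have hd : ∀ t, HasDerivAt (fun t => s₀ + ∫ τ in (0 : ℝ)..t, γ τ 2) (γ t 2) t := fun t =>
    (intervalIntegral.integral_hasDerivAt_right ((hγ.continuous_apply 2).intervalIntegrable _ _)
      ((hγ.continuous_apply 2).stronglyMeasurableAtFilter _ _)
      (hγ.continuous_apply 2).continuousAt).const_add s₀
  refine ⟨_, by simp, hd, fun t => ?_⟩
  obtain ⟨K, hK⟩ := exists_lipschitzOnWith_sphere (contDiff_reducedField a)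
  refine congrFun (ODE_solution_unique_univ
    (g := fun t => ζ (s₀ + ∫ τ in (0 : ℝ)..t, γ τ 2)) (v := fun t z => γ t 2 • reducedField a z)
    (s := fun _ => Metric.sphere (0 : E3) 1) (K := K) (t₀ := 0) (fun t => ?_)
    (fun t => ⟨?_, hγ.1 t⟩) (fun t => ⟨?_, hζ.1 _⟩) (by simpa using h0)) t
  · refine LipschitzOnWith.of_dist_le_mul fun x hx y hy => ?_
    rw [dist_smul₀]
    exact (mul_le_of_le_one_left dist_nonneg (hγ.abs_le_one 2 t)).trans (hK.dist_le_mul x hx y hy)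
  · exact cdkField_eq_smul a (hγ.1 t) ▸ hγ.2 t
  · exact (hζ.2 _).scomp t (hd t)

section Equator

variable {a : ℝ} {p : E3}

lemma cdkField_equator (a : ℝ) (hp : p ∈ infinityCircle) : cdkField a a p = 0 := by
  rw [cdkField_eq_smul a hp.1, hp.2, zero_smul]

/-- Every orbit emanating into the upper hemisphere is part of the orbit of the reduced field. -/
lemma exists_parameter_of_outgoing (ha : 0 < a) (hp : p ∈ infinityCircle) {γ ζ : ℝ → E3}
    (hγ : IsTrajectory (cdkField a a) γ) (hl : Tendsto γ atBot (𝓝 p))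
    (hr : Set.range γ ≠ {p}) (hw : ∀ t, 0 ≤ γ t 2) (hζ : IsTrajectory (reducedField a) ζ)
    (hζ0 : ζ 0 = p) :
    ∃ σ : ℝ → ℝ, Continuous σ ∧ (∀ t, 0 < σ t) ∧ Tendsto σ atBot (𝓝 0) ∧
      ∀ t, γ t = ζ (σ t) := by
  have hpos : ∀ t, 0 < γ t 2 := fun t => by
    refine lt_of_le_of_ne (hw t) fun h => ?_
    have hc := hγ.eq_const (contDiff_cdkField a a) (t₀ := t)
      (cdkField_equator a ⟨hγ.1 t, h.symm⟩)
    rw [funext hc] at hl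
    exact hγ.ne_of_range_ne (contDiff_cdkField a a) (cdkField_equator a hp) hr t
      (tendsto_const_nhds_iff.1 hl)
  obtain ⟨Φ, hΦ, -⟩ := exists_reduced_flow a
  obtain ⟨hξ, hξ0⟩ := hΦ (γ 0) (hγ.1 0)
  obtain ⟨τ, -, hτ, hγτ⟩ := exists_reparametrization hγ hξ hξ0.symm
  have hmono : StrictMono τ := strictMono_of_deriv_pos fun t => by
    rw [(hτ t).deriv]; exact hpos t
  have hGp : cdkG a a p = a := by
    have h1 := mem_sphere_E3.1 hp.1
    rw [hp.2] at h1
    have h2 : p 0 ^ 2 + p 1 ^ 2 = 1 := by linarith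
    rw [cdkG, hp.2, h2]
    linear_combination a * h2
  obtain ⟨T, hT⟩ := eventually_atBot.1
    ((((continuous_cdkG a a).tendsto p).comp hl).eventually_const_lt
      (show a / 2 < _ by rw [hGp]; linarith))
  -- The reduced time elapsed since -∞ is finite: τ' = w ≤ (2/a) w' for t ≤ T, so τ decreases by at
  -- most (2/a) w(T) ≤ 2/a going backwards from T.
  have hbound : BddBelow (Set.range τ) := by
    refine ⟨τ T - 2 / a, ?_⟩
    rintro _ ⟨t, rfl⟩
    have ha2 : 0 < 2 / a := by positivity
    rcases le_total T t with ht | ht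
    · linarith [hmono.monotone ht]
    · have hd : ∀ t, HasDerivAt (fun t => τ t - 2 / a * γ t 2)
          (γ t 2 - 2 / a * (cdkG a a (γ t) * γ t 2)) t := fun t =>
        (hτ t).sub ((hγ.deriv2 t).const_mul _)
      have hanti : AntitoneOn (fun t => τ t - 2 / a * γ t 2) (Set.Iic T) := by
        refine antitoneOn_of_deriv_nonpos (convex_Iic T)
          (fun t _ => (hd t).continuousAt.continuousWithinAt)
          (fun t _ => (hd t).differentiableAt.differentiableWithinAt) fun t ht => ?_
        rw [(hd t).deriv]
        have h1 : t ≤ T := Set.mem_Iic.1 (interior_subset ht)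
        have h2 := mul_lt_mul_of_pos_right (hT t h1) (hpos t)
        have h3 := mul_le_mul_of_nonneg_left h2.le ha2.le
        have h4 : 2 / a * (a / 2 * γ t 2) = γ t 2 := by field_simp
        simp only [Function.comp] at h3
        linarith
      have h1 := hanti (Set.mem_Iic.2 ht) Set.self_mem_Iic ht
      simp only at h1
      have h2 := mul_le_mul_of_nonneg_left (abs_le.1 (hγ.abs_le_one 2 T)).2 ha2.le
      have h3 := mul_pos ha2 (hpos t)
      linarith
  set s := ⨅ t, τ t with hs
  have hτs : Tendsto τ atBot (𝓝 s) := tendsto_atBot_ciInf hmono.monotone hbound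
  -- The reduced orbit reaches p at the finite time s, so it is a time shift of ζ.
  have hζs : Φ (γ 0) s = p := tendsto_nhds_unique
    ((((hξ.continuous).tendsto s).comp hτs).congr fun t => (hγτ t).symm) hl
  refine ⟨fun t => τ t - s, ?_, fun t => ?_, by simpa using hτs.sub_const s, fun t => ?_⟩
  · exact (continuous_iff_continuousAt.2 fun t => (hτ t).continuousAt).sub continuous_const
  · have h1 := ciInf_le hbound (t - 1)
    have h2 := hmono (show t - 1 < t by linarith)
    exact sub_pos.2 (h1.trans_lt h2)
  · rw [hγτ, hξ.eq_shift (contDiff_reducedField a) hζ (s := s) (t := 0) (hζs.trans hζ0.symm)]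
    congr 1
    ring

/-- The reduced field has third component a > 0 at p, so its orbit through p enters the upper
hemisphere. The original orbit starting there follows it backwards and takes infinite time to reach
p. -/
lemma exists_outgoing_upper (ha : 0 < a) (hp : p ∈ infinityCircle) :
    ∃ γ, IsTrajectory (cdkField a a) γ ∧ Tendsto γ atBot (𝓝 p) ∧ ∀ t, 0 < γ t 2 := by
  obtain ⟨Φ, hΦ, -⟩ := exists_reduced_flow a
  obtain ⟨hζ, hζ0⟩ := hΦ p hp.1
  set ζ := Φ p
  have hZ : ContinuousAt (fun s => reducedField a (ζ s) 2) 0 :=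
    (((EuclideanSpace.proj 2 : E3 →L[ℝ] ℝ).continuous.comp
      (contDiff_reducedField a).continuous).comp hζ.continuous).continuousAt
  have hZ0 : reducedField a (ζ 0) 2 = a := by
    have h1 := mem_sphere_E3.1 hp.1
    rw [hp.2] at h1
    have h2 : p 0 ^ 2 + p 1 ^ 2 = 1 := by linarith
    rw [hζ0]
    simp [reducedField, hp.2, h2]
  have hev : ∀ᶠ s in 𝓝 (0 : ℝ), a / 2 < reducedField a (ζ s) 2 :=
    hZ.eventually_const_lt (by simp only [hZ0]; linarith)
  obtain ⟨ε, hε, hball⟩ := Metric.eventually_nhds_iff_ball.1 hev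
  have hw : ∀ s, 0 ≤ s → s < ε → a / 2 * s ≤ ζ s 2 := fun s hs hsε => by
    have hsub : ∀ τ ∈ Set.Icc 0 s, τ ∈ Metric.ball (0 : ℝ) ε := fun τ hτ => by
      rw [Real.ball_eq_Ioo]
      exact ⟨by linarith [hτ.1], by linarith [hτ.2]⟩
    have := Convex.mul_sub_le_image_sub_of_le_deriv (convex_Icc 0 s) (f := fun s => ζ s 2)
      (C := a / 2)
      (fun τ _ => (hζ.hasDerivAt_apply 2 τ).continuousAt.continuousWithinAt)
      (fun τ _ => (hζ.hasDerivAt_apply 2 τ).differentiableAt.differentiableWithinAt)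
      (fun τ hτ => by
        rw [(hζ.hasDerivAt_apply 2 τ).deriv]
        exact (hball τ (hsub τ (interior_subset hτ))).le)
      0 (Set.left_mem_Icc.2 hs) s (Set.right_mem_Icc.2 hs) hs
    simp only [hζ0, hp.2] at this
    linarith
  obtain ⟨Ψ, hΨ, -⟩ := exists_cdk_flow a a
  obtain ⟨hγ, hγ0⟩ := hΨ (ζ (ε / 2)) (hζ.1 _)
  set γ := Ψ (ζ (ε / 2))
  obtain ⟨σ, hσ0, hσ, hγσ⟩ := exists_reparametrization hγ hζ hγ0
  have hpos : ∀ t, 0 < γ t 2 := pos_of_linear hγ.continuous_G hγ.deriv2 (t₀ := 0) (by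
    rw [hγ0]
    exact (by positivity : 0 < a / 2 * (ε / 2)).trans_le (hw _ (by positivity) (by linarith)))
  -- If σ reached 0, γ would be at p on the equator, contradicting w > 0.
  have hσpos : ∀ t, 0 < σ t := fun t => by
    by_contra! h
    obtain ⟨τ, hτ⟩ := mem_range_of_exists_le_of_exists_ge
      (continuous_iff_continuousAt.2 fun t => (hσ t).continuousAt) (c := 0)
      ⟨t, h⟩ ⟨0, by rw [hσ0]; positivity⟩
    have h1 := hpos τ
    rw [hγσ, hτ, hζ0, hp.2] at h1
    exact lt_irrefl _ h1
  have hlim := (backward_trap (t₀ := 0) (d := ε) (half_pos ha) (fun t _ => hσ t)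
    (fun t _ => (hσpos t).le) (fun t _ hlt => by
      rw [hγσ]; exact hw _ (hσpos t).le hlt) (by rw [hσ0]; linarith)).2
  refine ⟨γ, hγ, ?_, hpos⟩
  rw [← hζ0]
  exact ((hζ.continuous.tendsto 0).comp hlim).congr fun t => (hγσ t).symm

lemma existsUnique_outgoing_upper (ha : 0 < a) (hp : p ∈ infinityCircle) :
    ∃! O : Set E3, IsOutgoingOrbit (cdkField a a) p O ∧ ∀ z ∈ O, 0 ≤ z 2 := by
  obtain ⟨γ, hγ, hl, hw⟩ := exists_outgoing_upper ha hp
  have hr : Set.range γ ≠ {p} := range_ne_singleton (t := 0) fun h => by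
    have := hw 0
    rw [h, hp.2] at this
    exact lt_irrefl _ this
  refine ⟨Set.range γ, ⟨⟨hr, γ, hγ, rfl, hl⟩, ?_⟩, ?_⟩
  · rintro _ ⟨t, rfl⟩
    exact (hw t).le
  · rintro O ⟨⟨hr', γ', hγ', rfl, hl'⟩, hw'⟩
    obtain ⟨Φ, hΦ, -⟩ := exists_reduced_flow a
    obtain ⟨hζ, hζ0⟩ := hΦ p hp.1
    obtain ⟨σ, c, s0, sl, hs⟩ := exists_parameter_of_outgoing ha hp hγ hl hr
      (fun t => (hw t).le) hζ hζ0
    obtain ⟨σ', c', s0', sl', hs'⟩ := exists_parameter_of_outgoing ha hp hγ' hl' hr'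
      (fun t => hw' _ (Set.mem_range_self t)) hζ hζ0
    -- Both orbits are traversed along the same reduced orbit ζ with parameters decreasing to 0 from
    -- above, so they share a parameter value and hence a point.
    obtain ⟨x, y, hxy⟩ := exists_common_value c' c s0' s0 sl' sl
    exact hγ'.range_eq (contDiff_cdkField a a) hγ (s := x) (t := y) (by rw [hs', hs, hxy])

lemma existsUnique_outgoing_lower (ha : 0 < a) (hp : p ∈ infinityCircle) :
    ∃! O : Set E3, IsOutgoingOrbit (cdkField a a) p O ∧ ∀ z ∈ O, z 2 ≤ 0 := by
  have hneg := cdkField_neg a a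
  obtain ⟨O, ⟨hO, hw⟩, huniq⟩ := existsUnique_outgoing_upper ha (p := -p)
    ⟨by simpa using hp.1, by simpa using hp.2⟩
  refine ⟨(fun z => -z) '' O, ⟨by simpa using isOutgoingOrbit_image_neg hneg hO, ?_⟩, ?_⟩
  · rintro _ ⟨z, hz, rfl⟩
    simpa using hw z hz
  · rintro O' ⟨hO', hw'⟩
    rw [← huniq _ ⟨isOutgoingOrbit_image_neg hneg hO', by
      rintro _ ⟨z, hz, rfl⟩
      simpa using hw' z hz⟩]
    simp

/-! ### Stationary points at infinity for a ≠ b, and the theorem -/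

lemma cdkField_eq_zero_iff {b : ℝ} (hab : a ≠ b) (hp : p ∈ infinityCircle) :
    cdkField a b p = 0 ↔
      p = !₂[1, 0, 0] ∨ p = !₂[-1, 0, 0] ∨ p = !₂[0, 1, 0] ∨ p = !₂[0, -1, 0] := by
  constructor
  · intro h
    have h1 := mem_sphere_E3.1 hp.1
    have h2 := hp.2
    have h0 := congrArg (fun z : E3 => z 0) h
    simp [cdkField, cdkF, cdkG, h2] at h0
    rw [h2] at h1
    have hs : p 0 ^ 2 + p 1 ^ 2 = 1 := by linarith
    -- On the equator F = (b - a)v², so the first component alone already forces u = 0 or v = 0.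
    have key : (b - a) * p 1 ^ 2 * p 0 = 0 := by
      rcases h0 with h0 | h0
      · have : (b - a) * p 1 ^ 2 = 0 := by
          rw [hs] at h0
          linear_combination h0 - a * hs
        rw [this, zero_mul]
      · rw [h0, mul_zero]
    have hba : b - a ≠ 0 := sub_ne_zero.2 hab.symm
    rcases mul_eq_zero.1 key with h | h
    · have hv : p 1 = 0 := by simpa [hba] using h
      have : p 0 ^ 2 = 1 := by rw [hv] at hs; linarith
      rcases sq_eq_one_iff.1 this with hu | hu
      · left; ext i; fin_cases i <;> simp [hu, hv, h2]
      · right; left; ext i; fin_cases i <;> simp [hu, hv, h2]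
    · have : p 1 ^ 2 = 1 := by rw [h] at hs; linarith
      rcases sq_eq_one_iff.1 this with hv | hv
      · right; right; left; ext i; fin_cases i <;> simp [h, hv, h2]
      · right; right; right; ext i; fin_cases i <;> simp [h, hv, h2]
  · rintro (rfl | rfl | rfl | rfl) <;> ext i <;> fin_cases i <;>
      simp [cdkField, cdkF, cdkH, cdkK, cdkG]

end Equator

theorem lemma3p5 (a b : ℝ) (ha : 0 < a) (hb : 0 < b) :
    (a = b → ∀ p ∈ infinityCircle,
      poincareField (cdkP a) (cdkQ b) p = 0 ∧
      (∃! O : Set E3, IsOutgoingOrbit (poincareField (cdkP a) (cdkQ b)) p O ∧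
        ∀ z ∈ O, 0 ≤ z 2) ∧
      (∃! O : Set E3, IsOutgoingOrbit (poincareField (cdkP a) (cdkQ b)) p O ∧
        ∀ z ∈ O, z 2 ≤ 0)) ∧
    (a ≠ b → ∀ p ∈ infinityCircle,
      (poincareField (cdkP a) (cdkQ b) p = 0 ↔
        p = !₂[1, 0, 0] ∨ p = !₂[-1, 0, 0] ∨ p = !₂[0, 1, 0] ∨ p = !₂[0, -1, 0])) ∧
    (a < b →
      IsSaddlePoint (poincareField (cdkP a) (cdkQ b)) !₂[1, 0, 0] ∧
      IsSaddlePoint (poincareField (cdkP a) (cdkQ b)) !₂[-1, 0, 0] ∧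
      IsRepellingNode (poincareField (cdkP a) (cdkQ b)) !₂[0, 1, 0] ∧
      IsRepellingNode (poincareField (cdkP a) (cdkQ b)) !₂[0, -1, 0]) ∧
    (b < a →
      IsRepellingNode (poincareField (cdkP a) (cdkQ b)) !₂[1, 0, 0] ∧
      IsRepellingNode (poincareField (cdkP a) (cdkQ b)) !₂[-1, 0, 0] ∧
      IsSaddlePoint (poincareField (cdkP a) (cdkQ b)) !₂[0, 1, 0] ∧
      IsSaddlePoint (poincareField (cdkP a) (cdkQ b)) !₂[0, -1, 0]) := by
  have hnx : -(!₂[1, 0, 0] : E3) = !₂[-1, 0, 0] := by ext i; fin_cases i <;> simp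
  have hny : -(!₂[0, 1, 0] : E3) = !₂[0, -1, 0] := by ext i; fin_cases i <;> simp
  have hneg := cdkField_neg a b
  rw [poincareField_cdk ha.ne']
  refine ⟨?_, fun hab p hp => cdkField_eq_zero_iff hab hp, fun hab => ?_, fun hab => ?_⟩
  · rintro rfl p hp
    exact ⟨cdkField_equator a hp, existsUnique_outgoing_upper ha hp,
      existsUnique_outgoing_lower ha hp⟩
  · have hx := isSaddlePoint_x ha hab
    have hy := isRepellingNode_y ha hab
    exact ⟨hx, hnx ▸ hx.neg hneg, hy, hny ▸ hy.neg hneg⟩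
  · have hx := isRepellingNode_x hb hab
    have hy := isSaddlePoint_y hb hab
    exact ⟨hx, hnx ▸ hx.neg hneg, hy, hny ▸ hy.neg hneg⟩
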